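/- **Setting.** Let $K=\mathbb C[[h,\beta]]$, $q=e^{h}$, $t=e^{h\beta}$, $\ell\ge 2$, $I=\{1,\dots,\ell\}$, and let $\mathfrak g$ be of type $C_\ell$ with Cartan matrix $C_{ij}=2(\alpha_i,\alpha_j)/(\alpha_i,\alpha_i)$, where $\alpha_\ell$ is the long simple root, $(\alpha_\ell,\alpha_\ell)=2$. Put $r=2$ and $r_i=r(\alpha_i,\alpha_i)/2$, so $(r_1,\dots,r_\ell)=(1,\dots,1,2)$. Let $[n]_q=\frac{q^n-q^{-n}}{q-q^{-1}}$, $I_{ij}=2\delta_{ij}-C_{ij}$, $C_{ij}(q,t)=(q^{r_i}t^{-1}+q^{-r_i}t)\delta_{ij}-[I_{ij}]_q$ and $B_{ij}(q,t)=[r_i]_q\,C_{ij}(q,t)$. *Fock spaces.* For $\mu\in P=\mathbb C[\beta]\otimes\mathfrak h^*$, let $\pi_\mu$ be the Fock space with basis the monomials in $x_i[n]$ ($i\in I$, $n<0$) applied to $v_\mu$. It carries operators $x_i[n]$ ($n\ne0$) with $[x_i[n],x_j[m]]=\delta_{n,-m}\,n\frac{t^n-t^{-n}}{q^n-q^{-n}}B_{ij}(q^n,t^n)$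 and $x_i[n]v_\mu=0$ for $n>0$. On $\bigoplus_\mu\pi_\mu$ there are moreover the operators $q^{\xi a_j[0]}$, acting on $\pi_\mu$ by $q^{\xi(\mu,\alpha_j)}$, $q^{\xi y_j[0]}$, acting by $q^{\xi(\mu,\omega_j)}$, and $e^{\gamma Q_i}$, mapping $\pi_\mu$ to $\pi_{\mu+\gamma\beta r\alpha_i}$ and commuting with all $x_j[n]$. Put $a_i[m]=\frac{q^m-q^{-m}}{m}x_i[m]$, and define $y_i[m]$ by $a_j[m]=\sum_iC_{ij}(q^m,t^m)y_i[m]$. *Monomials.* Let $Y_i(z)=t^{2(\rho^\vee,\omega_i)}q^{-2r(\rho,\omega_i)+2y_i[0]}\exp\big(\sum_{m\ne0}y_i[m]z^{-m}\big)$. Let $\mathbf M$ be the set of normally ordered monomials $M={:}\prod Y_{i}(za)^{\pm1}{:}$ with $a\in\mathbb C^*q^{\mathbb Z}t^{\mathbb Z}$; they are identified with the Laurent monomials in the symbols $Y_{i,a}$, and $d_{i,a}(M)$ denotes the exponent of $Y_{i,a}$. Let $\mathbf H_{q,t}(\mathfrak g)$ be the $K$-span of $\mathbf M$. Products of monomials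 are normally ordered, and $A_j(z)=Y_j(zq^{r_j}t^{-1})Y_j(zq^{-r_j}t)\prod_{i\neq j}\prod_{s=0}^{I_{ij}-1}Y_i(zq^{I_{ij}-1-2s})^{-1}$. *The deformed $W$-algebra.* Let $S_i^{\pm}$ be the coefficient of $w^{-1}$ in $$e^{-Q_i/r_i}:\exp\Big(\sum_{m\neq0}\tfrac{a_i[m]}{q^{mr_i}-q^{-mr_i}}w^{-m}\Big):\quad\text{resp.}\quad e^{Q_i/\beta}:\exp\Big(-\sum_{m\neq0}\tfrac{a_i[m]}{t^m-t^{-m}}w^{-m}\Big):,$$ regarded as a map on $\pi_0$ (the base ring being extended to $\mathbb C[[h]]((\beta))$ for $S_i^-$). Then $\mathbf W_{q,t}(\mathfrak g)\subset\mathbf H_{q,t}(\mathfrak g)$ is the $K$-submodule of those $\Phi(z)=\sum_n\Phi_nz^n$ with $\Phi_nS_i^\pm v=S_i^\pm\Phi_nv$ for all $n\in\mathbb Z$, $i\in I$, $v\in\pi_0$. *The algorithm.* A monomial $M$ is *dominant* if all $d_{i,a}(M)\ge0$, and *generic* if all $d_{i,a}(M)\in\{-1,0,1\}$. It is *regular*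 if for all $i,a$: (1) $d_{i,a}(M)>0$ implies $d_{i,aq^{-2r_i}}(M)\ge0$ and $d_{i,at^2}(M)\ge0$; (2) if $d_{i,a}(M)$ and $d_{i,aq^{-2r_i}t^2}(M)$ are both positive (resp. both negative), so are $d_{i,aq^{-2r_i}}(M)$ and $d_{i,at^2}(M)$. The variable $Y_j(za)$ is *admissible* in $M$ if $d_{j,a}(M)>0$ and $d_{j,aq^{-2r_j}}(M)=d_{j,at^2}(M)=0$. The algorithm started from $m$ creates $m$ with coefficient $\lambda_m=1$ at step $0$. At each further step, for every monomial $M$ created at the previous step and every $Y_j(za)$ admissible in $M$, it creates $M'=M\,A_j(zaq^{-r_j}t)^{-1}$, if not already created, with coefficient $$\lambda_{M'}=\lambda_M\prod_{b\ne a}\left(\frac{(1-q^{-2r_j}ab^{-1})(1-t^2ab^{-1})}{(1-ab^{-1})(1-q^{-2r_j}t^2ab^{-1})}\right)^{d_{j,b}(M)} .$$ It *works* if all the monomials it creates are generic and regular and it stops after finitely many steps. *The explicit monomials.* Put $Y_0=1$ and $\bar k=2\ell-k+1$. For $1\le k\le\ell$ let $$\Lambda_k(z)=Y_k(zq^{-k+1}t^{k-1})\,Y_{k-1}(zq^{-k}t^{k})^{-1},\qquad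 \Lambda_{\bar k}(z)=Y_{k-1}(zq^{-2\ell+k-2}t^{2\ell-k})\,Y_k(zq^{-2\ell+k-3}t^{2\ell-k+1})^{-1}.$$ For $1\le i\le\ell$ let $S$ be the set of $\mathbf j=(j_1,\dots,j_i)$ with $1\le j_1<\dots<j_i\le2\ell$ such that, whenever $j_\alpha=k$ and $j_{\alpha'}=\bar k$ with $1\le k\le\ell$, one has $k\ne\ell+\alpha-\alpha'+1$. Put $\Lambda_{\mathbf j}=\prod_{\alpha=1}^{i}\Lambda_{j_\alpha}\big(zq^{-(i+1-2\alpha)}t^{\,i+1-2\alpha}\big)$ and $\mathrm{ht}_i(\mathbf j)=\sum_{\alpha=1}^i(j_\alpha-\alpha)$. **Proposition.** For every $1\le i\le \ell$ there are coefficients $c_{\mathbf j}(q,t)\in K$, $\mathbf j\in S$, such that $$T_i(z)=\sum_{\mathbf j\in S}c_{\mathbf j}(q,t)\,\Lambda_{\mathbf j}\ \in\ \mathbf W_{q,t}(\mathfrak g).$$ More precisely: * the monomials $\Lambda_{\mathbf j}$, $\mathbf j\in S$, are pairwise distinct, and the only dominant one is $\Lambda_{(1,\dots,i)}=Y_i(z)$;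 * the algorithm started from $Y_i(z)$ works, and for every $n\ge0$ the monomials it creates at step $n$ are exactly the $\Lambda_{\mathbf j}$ with $\mathbf j\in S$ and $\mathrm{ht}_i(\mathbf j)=n$; * the coefficients $c_{\mathbf j}$ can be taken to be those that the algorithm attaches to the $\Lambda_{\mathbf j}$, which lie in $K$ and do not depend on which of the possible monomials $M$ is used to compute them; thus $c_{(1,\dots,i)}=1$, and all $c_{\mathbf j}\neq0$. -/

import Mathlib

namespace DeformedW

noncomputable section

open PowerSeries

/-! ### The ground ring -/

/-- The ring `K = ℂ[[h, β]]`, realised as power series in `h` over `ℂ[[β]]`. -/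
abbrev KRing : Type := PowerSeries (PowerSeries ℂ)

/-- The fraction field of `K`. Since `ℂ[[h]]((β)) = K[1/β]`, it contains `K ⊆ ℂ[[h]]((β))`, so all the
operators below (including those with denominators `t ^ m - t ^ (-m)`) are defined over it.
All modules involved are free over `K`, so that this extension of scalars is harmless. -/
abbrev KFrac : Type := FractionRing KRing

/-- The power series variable `β`. -/
def betaVar : PowerSeries ℂ := PowerSeries.X

/-- `q ^ g = exp (h g)` for `g ∈ ℂ[[β]]`. -/
def qPow (g : PowerSeries ℂ) : KRing := PowerSeries.rescale g (PowerSeries.exp (PowerSeries ℂ))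

/-- `q = exp h`, viewed in the fraction field. -/
def q : KFrac := algebraMap KRing KFrac (qPow 1)

/-- `t = exp (h β)`, viewed in the fraction field. -/
def t : KFrac := algebraMap KRing KFrac (qPow betaVar)

/-! ### Cartan data and deformed Cartan matrices -/

/-- A Cartan matrix `A`, the integers `d i = r (α_i, α_i) / 2` making `diag d * A` symmetric, and
the maximal number `r` of edges between two vertices of the Dynkin diagram. -/
structure CartanData (l : ℕ) where
  A : Matrix (Fin l) (Fin l) ℤ
  d : Fin l → ℕ
  r : ℕ

/-- Type `C_l` (`l ≥ 2`), with `d = (1, …, 1, 2)`. The convention is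
`A i j = 2 (α_i, α_j) / (α_i, α_i)`, the transpose of the one in Mathlib. -/
def typeC (l : ℕ) : CartanData l where
  A := (CartanMatrix.C l).transpose
  d := fun i => if i.val + 1 = l then 2 else 1
  r := 2

/-- The `q`-integer `[k]_x = (x ^ k - x ^ (-k)) / (x - x⁻¹)`. -/
def qInt (x : KFrac) (k : ℤ) : KFrac := (x ^ k - x ^ (-k)) / (x - x⁻¹)

/-- The incidence matrix `I = 2 - A`. -/
def incidence {l : ℕ} (g : CartanData l) (i j : Fin l) : ℤ := (if i = j then 2 else 0) - g.A i j

/-- The deformed Cartan matrix `C(x, y)`, where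
`C_{ij}(x, y) = (x ^ d_i y⁻¹ + x ^ (-d_i) y) δ_{ij} - [I_{ij}]_x`. -/
def defCartan {l : ℕ} (g : CartanData l) (x y : KFrac) : Matrix (Fin l) (Fin l) KFrac :=
  Matrix.of fun i j =>
    (if i = j then x ^ (g.d i : ℤ) * y⁻¹ + x ^ (-(g.d i : ℤ)) * y else 0) - qInt x (incidence g i j)

/-- The deformed symmetrised Cartan matrix `B(x, y) = D(x, y) C(x, y)`, `D = diag [d_i]_x`. -/
def defSymCartan {l : ℕ} (g : CartanData l) (x y : KFrac) : Matrix (Fin l) (Fin l) KFrac :=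
  Matrix.of fun i j => qInt x (g.d i) * defCartan g x y i j

/-! ### Oscillators acting on a Fock space

The Heisenberg algebra acts faithfully on the direct sum of its Fock spaces and is treated as an
algebra of operators there. -/

/-- The space underlying every Fock representation `π_μ`, with its Poincaré–Birkhoff–Witt basis:
polynomials in the creation operators, the variable `(i, n)` being `x_i[-n]`. -/
abbrev Fock (l : ℕ) : Type := MvPolynomial (Fin l × ℕ+) KFrac

/-- The commutator `[x_i[n], x_j[-n]] = n (t ^ n - t ^ (-n)) / (q ^ n - q ^ (-n)) B_{ij}(q ^ n, t ^ n)`. -/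
def xComm {l : ℕ} (g : CartanData l) (n : ℤ) (i j : Fin l) : KFrac :=
  (n : KFrac) * ((t ^ n - t ^ (-n)) / (q ^ n - q ^ (-n))) * defSymCartan g (q ^ n) (t ^ n) i j

/-- The generator `x_i[n]` (`n ≠ 0`) on a Fock space: `x_i[-n]`, `n > 0`, multiplies, and
`x_i[n]`, `n > 0`, kills the vacuum vector `1` and satisfies the commutation relation `xComm`,
i.e. it is the corresponding derivation. The value at `n = 0` is not used. -/
def xMode {l : ℕ} (g : CartanData l) (i : Fin l) : ℤ → Module.End KFrac (Fock l)
  | Int.negSucc n => LinearMap.mulLeft KFrac (MvPolynomial.X (i, n.succPNat))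
  | Int.ofNat n =>
    (MvPolynomial.mkDerivation KFrac (fun p : Fin l × ℕ+ =>
      if (p.2 : ℕ) = n then (MvPolynomial.C (xComm g n i p.1) : Fock l) else 0)).toLinearMap

/-- Families of linear combinations of modes: `c` stands for the family of operators
`modeComb g c m = ∑_i c m i • x_i[m]`. -/
abbrev ModeFamily (l : ℕ) : Type := ℤ → Fin l → KFrac

def modeComb {l : ℕ} (g : CartanData l) (c : ModeFamily l) (m : ℤ) : Module.End KFrac (Fock l) :=
  ∑ i, c m i • xMode g i m

/-- `a_i[m] = (q ^ m - q ^ (-m)) / m • x_i[m]`. -/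
def aFam {l : ℕ} (i : Fin l) : ModeFamily l :=
  fun m => Pi.single i ((q ^ m - q ^ (-m)) / (m : KFrac))

/-- `y_i[m] = ∑_j (C(q ^ m, t ^ m)⁻¹)_{ji} • a_j[m]`, i.e. `a_j[m] = ∑_i C_{ij}(q ^ m, t ^ m) • y_i[m]`. -/
def yFam {l : ℕ} (g : CartanData l) (i : Fin l) : ModeFamily l :=
  fun m => ∑ j, (defCartan g (q ^ m) (t ^ m))⁻¹ j i • aFam j m

/-- `s⁺_i[m] = a_i[m] / (q ^ (m d_i) - q ^ (-m d_i))`. -/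
def sPlusFam {l : ℕ} (g : CartanData l) (i : Fin l) : ModeFamily l :=
  fun m => (q ^ (m * g.d i) - q ^ (-(m * g.d i)))⁻¹ • aFam i m

/-- `s⁻_i[m] = a_i[m] / (t ^ m - t ^ (-m))`. -/
def sMinusFam {l : ℕ} (i : Fin l) : ModeFamily l :=
  fun m => (t ^ m - t ^ (-m))⁻¹ • aFam i m

/-! ### Normally ordered exponentials -/

/-- The coefficient of `z ^ N` in `exp (∑_{m ≥ 1} f_m z ^ m)`. -/
def expCoeff {l : ℕ} (f : ℕ → Module.End KFrac (Fock l)) (N : ℕ) : Module.End KFrac (Fock l) :=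
  ∑ k ∈ Finset.range (N + 1), ((k.factorial : KFrac)⁻¹) •
    PowerSeries.coeff N ((PowerSeries.mk fun m => if m = 0 then 0 else f m) ^ k)

/-- The coefficient of `z ^ N` in `exp (∑_{m < 0} c_m z ^ (-m))`. -/
def creationCoeff {l : ℕ} (g : CartanData l) (c : ModeFamily l) (N : ℕ) :
    Module.End KFrac (Fock l) :=
  expCoeff (fun m => modeComb g c (-(m : ℤ))) N

/-- The coefficient of `z ^ (-N)` in `exp (∑_{m > 0} c_m z ^ (-m))`. -/
def annihilationCoeff {l : ℕ} (g : CartanData l) (c : ModeFamily l) (N : ℕ) :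
    Module.End KFrac (Fock l) :=
  expCoeff (fun m => modeComb g c (m : ℤ)) N

/-- The weight of a monomial in the `x_i[-n]`: the sum of the `n`'s. -/
def weight {l : ℕ} (s : Fin l × ℕ+ →₀ ℕ) : ℕ := s.sum fun p e => e * (p.2 : ℕ)

/-- Polynomials all of whose monomials have weight at most `d`. -/
def weightLE (l : ℕ) (d : ℤ) : Submodule KFrac (Fock l) where
  carrier := {p | ∀ s, MvPolynomial.coeff s p ≠ 0 → (weight s : ℤ) ≤ d}
  zero_mem' := by intro s hs; simp at hs
  add_mem' := by
    intro a b ha hb s hs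
    by_cases h : MvPolynomial.coeff s a = 0
    · exact hb s (by simpa [h] using hs)
    · exact ha s h
  smul_mem' := by
    intro c a ha s hs
    exact ha s (by intro h; simp [h] at hs)

def Lowers {l : ℕ} (T : Module.End KFrac (Fock l)) (m : ℤ) : Prop :=
  ∀ d, ∀ p ∈ weightLE l d, T p ∈ weightLE l (d - m)

theorem weight_sub_single {l : ℕ} (s : Fin l × ℕ+ →₀ ℕ) (p : Fin l × ℕ+) (hp : s p ≠ 0) :
    weight (s - Finsupp.single p 1) + (p.2 : ℕ) = weight s := by
  have h : s = (s - Finsupp.single p 1) + Finsupp.single p 1 := by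
    ext x
    by_cases hx : x = p
    · subst hx; simp; omega
    · simp [Ne.symm hx]
  conv_rhs => rw [h]
  unfold weight
  rw [Finsupp.sum_add_index' (by simp) (by intros; ring)]
  simp

theorem lowers_xMode {l : ℕ} (g : CartanData l) (i : Fin l) (n : ℕ) :
    Lowers (xMode g i (n : ℤ)) n := by
  intro d p hp
  rw [MvPolynomial.as_sum p, map_sum]
  refine Submodule.sum_mem _ fun s hs => ?_
  have hs' : (weight s : ℤ) ≤ d := hp s (by simpa using hs)
  change MvPolynomial.mkDerivation KFrac _ _ ∈ _
  rw [MvPolynomial.mkDerivation_monomial]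
  refine Submodule.smul_mem _ _ (Submodule.sum_mem _ fun x hx => ?_)
  dsimp only
  split_ifs with h
  · intro u hu
    rw [smul_eq_mul, mul_comm, MvPolynomial.coeff_C_mul, MvPolynomial.coeff_monomial] at hu
    have hu' : s - Finsupp.single x 1 = u := by
      by_contra hne
      simp [hne] at hu
    have := weight_sub_single s x (by simpa using hx)
    rw [← hu']
    omega
  · simp

theorem lowers_modeComb {l : ℕ} (g : CartanData l) (c : ModeFamily l) (n : ℕ) :
    Lowers (modeComb g c (n : ℤ)) n := by
  intro d p hp
  simp only [modeComb, LinearMap.sum_apply, LinearMap.smul_apply]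
  exact Submodule.sum_mem _ fun i _ => Submodule.smul_mem _ _ (lowers_xMode g i n d p hp)

theorem lowers_coeff_pow {l : ℕ} (f : PowerSeries (Module.End KFrac (Fock l)))
    (hf : ∀ n, Lowers (PowerSeries.coeff n f) n) (k : ℕ) :
    ∀ n, Lowers (PowerSeries.coeff n (f ^ k)) n := by
  induction k with
  | zero =>
    intro n d p hp
    rw [pow_zero, PowerSeries.coeff_one]
    split_ifs with h
    · subst h; simpa using hp
    · simp
  | succ k ih =>
    intro n d p hp
    rw [pow_succ, PowerSeries.coeff_mul, LinearMap.sum_apply]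
    refine Submodule.sum_mem _ fun x hx => ?_
    have h1 := ih x.1 _ _ (hf x.2 d p hp)
    have h2 : (d - (x.2 : ℤ) - (x.1 : ℤ)) = d - n := by
      have := Finset.HasAntidiagonal.mem_antidiagonal.1 hx
      omega
    rw [h2] at h1
    exact h1

theorem annihilationCoeff_eventually_zero {l : ℕ} (g : CartanData l) (c : ModeFamily l)
    (v : Fock l) : ∃ N₀ : ℕ, ∀ N, N₀ ≤ N → annihilationCoeff g c N v = 0 := by
  obtain ⟨D, hD⟩ : ∃ D : ℕ, v ∈ weightLE l D := by
    refine ⟨v.support.sup weight, fun s hs => ?_⟩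
    exact_mod_cast Finset.le_sup (f := weight) (by simpa using hs)
  refine ⟨D + 1, fun N hN => ?_⟩
  have hl : Lowers (annihilationCoeff g c N) N := by
    intro d p hp
    simp only [annihilationCoeff, expCoeff, LinearMap.sum_apply, LinearMap.smul_apply]
    refine Submodule.sum_mem _ fun k _ => Submodule.smul_mem _ _ ?_
    refine lowers_coeff_pow _ ?_ k N d p hp
    intro n d p hp
    rw [PowerSeries.coeff_mk]
    split_ifs with h
    · simp
    · exact lowers_modeComb g c n d p hp
  have h := hl D v hD
  ext s
  by_contra hne
  have := h s (by simpa using hne)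
  omega

/-- The coefficient of `z ^ n` in the normally ordered exponential
`:exp (∑_{m ≠ 0} c_m z ^ (-m)): = exp (∑_{m < 0} c_m z ^ (-m)) exp (∑_{m > 0} c_m z ^ (-m))`.
On every vector only finitely many terms of the sum are non-zero. -/
def normalExp {l : ℕ} (g : CartanData l) (c : ModeFamily l) (n : ℤ) :
    Module.End KFrac (Fock l) :=
  have hfin : ∀ v, (Function.support fun k : ℕ =>
      if 0 ≤ n + k then creationCoeff g c (n + k).toNat (annihilationCoeff g c k v)
      else 0).Finite := by
    intro v
    obtain ⟨N₀, hN⟩ := annihilationCoeff_eventually_zero g c v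
    refine (Set.finite_lt_nat N₀).subset fun k hk => ?_
    by_contra hlt
    exact hk (by simp [hN k (not_lt.1 hlt)])
  { toFun := fun v => ∑ᶠ k : ℕ,
      if 0 ≤ n + k then creationCoeff g c (n + k).toNat (annihilationCoeff g c k v) else 0
    map_add' := by
      intro v w
      rw [← finsum_add_distrib (hfin v) (hfin w)]
      refine finsum_congr fun k => ?_
      split_ifs <;> simp
    map_smul' := by
      intro a v
      rw [RingHom.id_apply, smul_finsum' a (hfin v)]
      refine finsum_congr fun k => ?_
      split_ifs <;> simp }

/-! ### The direct sum of all Fock representations -/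

/-- `P = ℂ[β] ⊗ 𝔥*`, in coordinates with respect to the simple roots. -/
abbrev Weights (l : ℕ) : Type := Fin l → Polynomial ℂ

/-- `(μ, α_j)`, where `(α_i, α_j) = d_i A_{ij} / r`. -/
def pairRoot {l : ℕ} (g : CartanData l) (μ : Weights l) (j : Fin l) : Polynomial ℂ :=
  ∑ i, Polynomial.C ((g.d i : ℂ) * (g.A i j : ℂ) / (g.r : ℂ)) * μ i

/-- The inverse of the Cartan matrix: `ω_i = ∑_k (A⁻¹)_{ki} α_k`. -/
def cartanInv {l : ℕ} (g : CartanData l) : Matrix (Fin l) (Fin l) ℂ :=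
  (g.A.map (Int.cast : ℤ → ℂ))⁻¹

/-- `(μ, ω_i)`, the eigenvalue of `y_i[0]` on `π_μ`. -/
def pairFund {l : ℕ} (g : CartanData l) (μ : Weights l) (i : Fin l) : Polynomial ℂ :=
  ∑ k, Polynomial.C (cartanInv g k i) * pairRoot g μ k

/-- `⨁_{μ ∈ P} π_μ`. -/
abbrev TotalFock (l : ℕ) : Type := Weights l →₀ Fock l

/-- An oscillator operator, acting in the same way on every `π_μ`. -/
def onAll {l : ℕ} (T : Module.End KFrac (Fock l)) : Module.End KFrac (TotalFock l) :=
  Finsupp.mapRange.linearMap T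

/-- The operator acting on `π_μ` by the scalar `q ^ (φ μ)`. -/
def qZeroMode {l : ℕ} (φ : Weights l → Polynomial ℂ) : Module.End KFrac (TotalFock l) :=
  Finsupp.lsum KFrac fun μ =>
    algebraMap KRing KFrac (qPow (φ μ : PowerSeries ℂ)) • Finsupp.lsingle μ

/-- The shift generator `exp (γ Q_i)`, where `b = γ β`: it maps `π_μ` to `π_{μ + γ β r α_i}`. -/
def shiftOp {l : ℕ} (g : CartanData l) (b : Polynomial ℂ) (i : Fin l) :
    Module.End KFrac (TotalFock l) :=
  Finsupp.lmapDomain (Fock l) KFrac fun μ => μ + Pi.single i (b * Polynomial.C (g.r : ℂ))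

/-- Formal series in `z, z⁻¹` with operator coefficients; `Φ n` is the coefficient of `z ^ n`. -/
abbrev FormalSeries (l : ℕ) : Type := ℤ → Module.End KFrac (TotalFock l)

/-! ### Monomials in the `Y_i(za)` and the space they span -/

/-- The spectral parameters `C q ^ m t ^ n ∈ ℂ* q ^ ℤ t ^ ℤ`, as triples `(C, m, n)`. -/
abbrev Spec : Type := ℂˣ × ℤ × ℤ

/-- The element `C q ^ m t ^ n` given by a triple (a triple is determined by this element). -/
def Spec.val (a : Spec) : KFrac :=
  algebraMap ℂ KFrac (a.1 : ℂ) * q ^ a.2.1 * t ^ a.2.2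

/-- The parameter `a q ^ m t ^ n`. -/
def Spec.shift (a : Spec) (m n : ℤ) : Spec := (a.1, a.2.1 + m, a.2.2 + n)

/-- Laurent monomials in the `Y_{i,a}`, written additively: `M (i, a)` is the degree `d_{i,a}(M)`,
and addition is the (normally ordered) product. -/
abbrev Mon (l : ℕ) : Type := (Fin l × Spec) →₀ ℤ

/-- The exponent of `q` in the constant `t ^ (2 (ρ^∨, ω_i)) q ^ (-2 r (ρ, ω_i))` of `Y_i(z)`, using
`t = q ^ β`, `(ρ^∨, α_k) = 1` and `r (ρ, α_k) = d_k`. -/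
def yConst {l : ℕ} (g : CartanData l) (i : Fin l) : Polynomial ℂ :=
  Polynomial.C (2 * ∑ k, cartanInv g k i) * Polynomial.X
    - Polynomial.C (2 * ∑ k, cartanInv g k i * (g.d k : ℂ))

/-- The field `:∏ Y_i(za) ^ {d_{i,a}}:` attached to a monomial, where
`Y_i(z) = t ^ (2 (ρ^∨, ω_i)) q ^ (-2 r (ρ, ω_i) + 2 y_i[0]) exp (∑_{m ≠ 0} y_i[m] z ^ (-m))`. -/
def Mon.field {l : ℕ} (g : CartanData l) (M : Mon l) : FormalSeries l := fun n =>
  qZeroMode (fun μ => M.sum fun p e => e • (yConst g p.1 + 2 * pairFund g μ p.1)) *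
    onAll (normalExp g (fun m => M.sum fun p e => e • (Spec.val p.2 ^ (-m) • yFam g p.1 m)) n)

/-- The space `𝐇_{q,t}(𝔤)`: the `K`-span of the monomials in the `Y_i(za)^{±1}`. -/
def bigH {l : ℕ} (g : CartanData l) : Submodule KRing (FormalSeries l) :=
  Submodule.span KRing (Set.range (Mon.field g))

/-! ### Screening operators and the deformed `W`-algebra -/

/-- The screening operator `S⁺_i`: the coefficient of `w ^ (-1)` in
`exp (-Q_i / d_i) :exp (∑_{m ≠ 0} s⁺_i[m] w ^ (-m)):`. -/
def screenPlus {l : ℕ} (g : CartanData l) (i : Fin l) : Module.End KFrac (TotalFock l) :=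
  shiftOp g (-(Polynomial.C ((g.d i : ℂ)⁻¹) * Polynomial.X)) i *
    onAll (normalExp g (sPlusFam g i) (-1))

/-- The screening operator `S⁻_i`: the coefficient of `w ^ (-1)` in
`exp (Q_i / β) :exp (- ∑_{m ≠ 0} s⁻_i[m] w ^ (-m)):`. -/
def screenMinus {l : ℕ} (g : CartanData l) (i : Fin l) : Module.End KFrac (TotalFock l) :=
  shiftOp g 1 i * onAll (normalExp g (-sMinusFam i) (-1))

/-- A formal series commutes with a screening operator `S`, which is regarded as a map on `π_0`
(the factors `w ^ {∓ s_i^±[0]}` of the screening currents, which are the identity on `π_0`,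
being omitted). -/
def CommutesOnVacuum {l : ℕ} (Φ : FormalSeries l) (S : Module.End KFrac (TotalFock l)) : Prop :=
  ∀ (n : ℤ) (v : Fock l), Φ n (S (Finsupp.single 0 v)) = S (Φ n (Finsupp.single 0 v))

/-- The deformed `W`-algebra `𝐖_{q,t}(𝔤)`: the fields in `𝐇_{q,t}(𝔤)` which commute with all the
screening operators. -/
def deformedW {l : ℕ} (g : CartanData l) : Submodule KRing (FormalSeries l) where
  carrier := {Φ | Φ ∈ bigH g ∧
    ∀ i, CommutesOnVacuum Φ (screenPlus g i) ∧ CommutesOnVacuum Φ (screenMinus g i)}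
  zero_mem' := ⟨Submodule.zero_mem _, fun i => ⟨fun n v => by simp, fun n v => by simp⟩⟩
  add_mem' := by
    rintro Φ Ψ ⟨h1, h2⟩ ⟨h3, h4⟩
    refine ⟨Submodule.add_mem _ h1 h3, fun i => ⟨fun n v => ?_, fun n v => ?_⟩⟩
    · simp [(h2 i).1 n v, (h4 i).1 n v]
    · simp [(h2 i).2 n v, (h4 i).2 n v]
  smul_mem' := by
    rintro c Φ ⟨h1, h2⟩
    refine ⟨Submodule.smul_mem _ _ h1, fun i => ⟨fun n v => ?_, fun n v => ?_⟩⟩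
    · have h := (h2 i).1 n v
      simp only [Pi.smul_apply, LinearMap.smul_apply, h]
      rw [← algebraMap_smul KFrac c, ← algebraMap_smul KFrac c, map_smul]
    · have h := (h2 i).2 n v
      simp only [Pi.smul_apply, LinearMap.smul_apply, h]
      rw [← algebraMap_smul KFrac c, ← algebraMap_smul KFrac c, map_smul]

/-! ### The algorithm -/

/-- The monomial of `A_j(za)`, i.e. `A_j = ∏_i Y_i ^ {C_{ij}(q, t)}`:
`Y_j(z a q ^ {d_j} t⁻¹) Y_j(z a q ^ {-d_j} t) ∏_{i ≠ j} ∏_{0 ≤ s < I_{ij}} Y_i(z a q ^ {I_{ij} - 1 - 2 s})⁻¹`. -/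
def aMon {l : ℕ} (g : CartanData l) (j : Fin l) (a : Spec) : Mon l :=
  Finsupp.single (j, a.shift (g.d j) (-1)) 1 + Finsupp.single (j, a.shift (-(g.d j : ℤ)) 1) 1
    - ∑ i, ∑ s ∈ Finset.range (incidence g i j).toNat,
        Finsupp.single (i, a.shift (incidence g i j - 1 - 2 * s) 0) 1

def IsDominant {l : ℕ} (M : Mon l) : Prop := ∀ i a, 0 ≤ M (i, a)

def IsGeneric {l : ℕ} (M : Mon l) : Prop := ∀ i a, M (i, a) = -1 ∨ M (i, a) = 0 ∨ M (i, a) = 1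

def IsRegular {l : ℕ} (g : CartanData l) (M : Mon l) : Prop :=
  ∀ (i : Fin l) (a : Spec),
    (0 < M (i, a) → 0 ≤ M (i, a.shift (-2 * g.d i) 0) ∧ 0 ≤ M (i, a.shift 0 2)) ∧
    (0 < M (i, a) → 0 < M (i, a.shift (-2 * g.d i) 2) →
      0 < M (i, a.shift (-2 * g.d i) 0) ∧ 0 < M (i, a.shift 0 2)) ∧
    (M (i, a) < 0 → M (i, a.shift (-2 * g.d i) 2) < 0 →
      M (i, a.shift (-2 * g.d i) 0) < 0 ∧ M (i, a.shift 0 2) < 0)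

/-- `Y_j(za)` is admissible in `M`. -/
def IsAdmissible {l : ℕ} (g : CartanData l) (M : Mon l) (j : Fin l) (a : Spec) : Prop :=
  0 < M (j, a) ∧ M (j, a.shift (-2 * g.d j) 0) = 0 ∧ M (j, a.shift 0 2) = 0

/-- The monomial `M A_j(z a q ^ {-d_j} t)⁻¹`. -/
def expand {l : ℕ} (g : CartanData l) (M : Mon l) (j : Fin l) (a : Spec) : Mon l :=
  M - aMon g j (a.shift (-(g.d j : ℤ)) 1)

/-- The state of the algorithm started from `m` after `n` steps: the set of all monomials created so
far, and the set of those created at step `n`. -/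
def algState {l : ℕ} (g : CartanData l) (m : Mon l) : ℕ → Set (Mon l) × Set (Mon l)
  | 0 => ({m}, {m})
  | n + 1 =>
    let created := (algState g m n).1
    let new : Set (Mon l) :=
      {M' | M' ∉ created ∧ ∃ M ∈ (algState g m n).2, ∃ j a,
        IsAdmissible g M j a ∧ M' = expand g M j a}
    (created ∪ new, new)

/-- The monomials created at step `n` of the algorithm started from `m`. -/
def algStep {l : ℕ} (g : CartanData l) (m : Mon l) (n : ℕ) : Set (Mon l) := (algState g m n).2

/-- The algorithm started from `m` never fails (all monomials it meets are generic and regular) and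
ends after finitely many steps. -/
def AlgorithmWorks {l : ℕ} (g : CartanData l) (m : Mon l) : Prop :=
  (∀ n, ∀ M ∈ algStep g m n, IsGeneric M ∧ IsRegular g M) ∧ ∃ n, algStep g m n = ∅

/-- The factor
`(1 - q ^ {-2d} x) (1 - t ^ 2 x) / ((1 - x) (1 - q ^ {-2d} t ^ 2 x))`. -/
def block (d : ℕ) (x : KFrac) : KFrac :=
  ((1 - q ^ (-2 * (d : ℤ)) * x) * (1 - t ^ 2 * x)) / ((1 - x) * (1 - q ^ (-2 * (d : ℤ)) * t ^ 2 * x))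

/-- The ratio between the coefficients of `M A_j(z a q ^ {-d_j} t)⁻¹` and of `M` in the algorithm:
the other factors `Y_j(zb)` of `M` contribute `block d_j (a / b)`, and the factors `Y_j(zc)⁻¹`
contribute `(block d_j (a / c))⁻¹`. -/
def coeffRatio {l : ℕ} (g : CartanData l) (M : Mon l) (j : Fin l) (a : Spec) : KFrac :=
  (M.erase (j, a)).prod fun p e =>
    if p.1 = j then block (g.d j) (a.val / p.2.val) ^ e else 1

/-- `lam` gives the coefficients which the algorithm started from `m` attaches to monomials: `m` has
coefficient `1`, and the coefficient of a created monomial is computed by `coeffRatio` from that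
of any of the monomials from which it is created. -/
def IsAlgorithmCoeff {l : ℕ} (g : CartanData l) (m : Mon l) (lam : Mon l → KRing) : Prop :=
  lam m = 1 ∧ ∀ n, ∀ M ∈ algStep g m n, ∀ j a, IsAdmissible g M j a →
    algebraMap KRing KFrac (lam (expand g M j a)) =
      algebraMap KRing KFrac (lam M) * coeffRatio g M j a

/-! ### The explicit monomials in type `C_l` -/

/-- `Y_k(z a q ^ m t ^ n)`, with `1 ≤ k ≤ l` and the convention `Y_0 = 1`. -/
def yMon (l : ℕ) (k : ℕ) (a : Spec) (m n : ℤ) : Mon l :=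
  if h : 1 ≤ k ∧ k ≤ l then Finsupp.single (⟨k - 1, by omega⟩, a.shift m n) 1 else 0

/-- `Λ_j(za)` for `1 ≤ j ≤ 2 l`: for `1 ≤ k ≤ l`,
`Λ_k(z) = Y_k(z q ^ {-k+1} t ^ {k-1}) Y_{k-1}(z q ^ {-k} t ^ k)⁻¹`, and, with `k̄ = 2 l - k + 1`,
`Λ_k̄(z) = Y_{k-1}(z q ^ {-2l+k-2} t ^ {2l-k}) Y_k(z q ^ {-2l+k-3} t ^ {2l-k+1})⁻¹`. -/
def lambdaBox (l : ℕ) (j : ℕ) (a : Spec) : Mon l :=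
  if j ≤ l then
    yMon l j a (-(j : ℤ) + 1) ((j : ℤ) - 1) - yMon l (j - 1) a (-(j : ℤ)) (j : ℤ)
  else
    let k := 2 * l - j + 1
    yMon l (k - 1) a (-2 * (l : ℤ) + k - 2) (2 * (l : ℤ) - k)
      - yMon l k a (-2 * (l : ℤ) + k - 3) (2 * (l : ℤ) - k + 1)

/-- `Λ_𝐣 = Λ_{j_1}(z q ^ {-(i-1)} t ^ {i-1}) Λ_{j_2}(z q ^ {-(i-3)} t ^ {i-3}) ⋯
Λ_{j_i}(z q ^ {i-1} t ^ {-(i-1)})`; the index `α` is counted from `0`. -/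
def lambdaMon (l i : ℕ) (j : Fin i → ℕ) : Mon l :=
  ∑ α : Fin i, lambdaBox l (j α)
    ((1, -((i : ℤ) - 1 - 2 * (α : ℤ)), (i : ℤ) - 1 - 2 * (α : ℤ)) : Spec)

open Classical in
/-- The set `S` of all `1 ≤ j_1 < ⋯ < j_i ≤ 2 l` such that, whenever `j_α = k` and
`j_β = 2 l - k + 1` with `1 ≤ k ≤ l`, one has `k ≠ l + α - β + 1`. -/
def indexSet (l i : ℕ) : Finset (Fin i → ℕ) :=
  (Fintype.piFinset fun _ : Fin i => Finset.Icc 1 (2 * l)).filter fun j =>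
    StrictMono j ∧ ∀ (k : ℕ) (α β : Fin i), 1 ≤ k → k ≤ l → j α = k → j β = 2 * l - k + 1 →
      (k : ℤ) ≠ (l : ℤ) + (α : ℤ) - (β : ℤ) + 1

/-- `∑_α (j_α - α)`, with `α` from `1` to `i`. -/
def height {i : ℕ} (j : Fin i → ℕ) : ℤ := ∑ α : Fin i, ((j α : ℤ) - ((α : ℤ) + 1))

/-- The index `(1, 2, …, i)`. -/
def initialIndex (i : ℕ) : Fin i → ℕ := fun α => (α : ℕ) + 1

/-- `T_i(z) = ∑_{𝐣 ∈ S} c_𝐣 Λ_𝐣`. -/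
def fundField (l i : ℕ) (c : (Fin i → ℕ) → KRing) : FormalSeries l :=
  ∑ j ∈ indexSet l i, c j • (lambdaMon l i j).field (typeC l)

end

end DeformedW

/-! Commutators. The product of a monomial field in `z` with a screening current in `w` is a scalar
function of `w / z` times the normally ordered product. Only the variables of the monomial at the
node of the current matter, and each `Y^{±1}` contributes a factor with one simple pole and one
zero. After correction by the zero modes, the two orders of multiplication give the expansions of
one rational function at `0` and at `∞`. Their difference is a sum of delta functions, so the
commutator is a sum over poles of a residue times a vertex operator (`normalExp_commutator`,
`lambdaMon_commutator`). The currents of both kinds are treated at once through a pair `(σ, τ)`,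
equal to `(q^{-d}, t)` or `(t, q^{-d})`: `τ` places the poles, and `σ` enters the relation that, up
to zero modes, `S(wσ²)` is `:A(wσ) S(w):`. By this relation `M` at the pole of `Y_j(za)` and `M
A_j(zaq^{-d}t)⁻¹` at the pole of the new `Y_j⁻¹` carry the same vertex operator (`monFam_sub_aMon`).

Combinatorics. An index `𝐣` is a set of occupied boxes among `1, …, 2l`. The variables at a node `k
< l` sit at the transitions `k → k + 1` and `2l - k → 2l - k + 1`, those at `l` at `l → l + 1`; the
exponent is the difference of the two occupation numbers (`lambdaMon_apply`). Multiplication by an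
`A⁻¹` moves a box from `x` to `x + 1` (`lambdaMon_flip`). The move stays in `S` exactly when the
variable is admissible, since both can fail only through the second variable of the node standing at
one special parameter (`shift_values`). So the algorithm explores `S` by height, and it reaches
everything because each index other than the initial one can be moved down inside `S`
(`exists_move_down`).

Coefficients. Independence of the path comes from a closed formula (`boxCoeff`): one factor
`pairFactor n` for each pair `k`, `2l - k + 1` contained in `𝐣`, where `n` is `k - l` plus the
difference of the positions. It vanishes exactly at `n = 1`, the value forbidden in `S`, and it lies
in `K` because `q^m t^n - 1` is `h (m + nβ)` times a unit. A move creates, destroys or transports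
one such pair, which reproduces the ratio of the algorithm (`exists_flip_data`,
`algebraMap_boxCoeff_flip`).

Cancellation. The residues are indexed by pairs `(𝐣, x)`. If moving the box at `x` stays in `S`, the
terms of `𝐣` and of the moved index at `x` cancel, the ratio of residues being the ratio of
coefficients (`slotCoeff_flip`). Otherwise the two parameters at the node have ratio `τ²` or `σ²`.
In the first case a zero of one factor removes the pole of the other; in the second the term cancels
against the index with both boxes moved, at the other slot (`slotCoeff_flip_flip`). This is an
involution without fixed points (`sum_slots_eq_zero`). -/

namespace DeformedW
noncomputable section
open PowerSeries Finset.HasAntidiagonal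

/-! ### Formal exponentials over a possibly non-commutative ring -/

section Exponential

variable {R : Type*} [Ring R]

/-- The Euler operator `X d/dX`. -/
def euler (F : PowerSeries R) : PowerSeries R := PowerSeries.mk fun n => n • coeff n F

theorem coeff_euler (F : PowerSeries R) (n : ℕ) : coeff n (euler F) = n • coeff n F := by
  simp [euler]

theorem euler_add (F G : PowerSeries R) : euler (F + G) = euler F + euler G := by
  ext n; simp [coeff_euler]

theorem euler_mul (F G : PowerSeries R) : euler (F * G) = euler F * G + F * euler G := by
  ext n
  simp only [coeff_euler, map_add, coeff_mul, Finset.smul_sum, ← Finset.sum_add_distrib]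
  refine Finset.sum_congr rfl fun x hx => ?_
  rw [← mem_antidiagonal.1 hx, add_smul, smul_mul_assoc, mul_smul_comm]

theorem euler_pow (F : PowerSeries R) (h : Commute F (euler F)) (k : ℕ) :
    euler (F ^ (k + 1)) = (k + 1) • (euler F * F ^ k) := by
  induction k with
  | zero => simp
  | succ k ih =>
    rw [pow_succ, euler_mul, ih, smul_mul_assoc, mul_assoc, ← pow_succ,
      (h.pow_left (k + 1)).eq, ← succ_nsmul]

/-- `E = exp F`, expressed by the differential equation. -/
structure IsExp (F E : PowerSeries R) : Prop where
  coeff_zero : coeff 0 E = 1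
  euler_eq : euler E = euler F * E

/-- Logarithmic derivatives add; commutation is needed only to bring `euler G` past `E`. -/
theorem IsExp.add {F G E E' : PowerSeries R} (h : IsExp F E) (h' : IsExp G E')
    (hc : Commute E (euler G)) : IsExp (F + G) (E * E') where
  coeff_zero := by
    rw [coeff_mul]; simp [h.coeff_zero, h'.coeff_zero]
  euler_eq := by
    rw [euler_mul, h.euler_eq, h'.euler_eq, euler_add, add_mul, mul_assoc, ← mul_assoc E, hc.eq,
      mul_assoc]

theorem IsExp.coeff_eq {F E : PowerSeries R} (h : IsExp F E) (N : ℕ) :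
    N • coeff N E = ∑ x ∈ antidiagonal N, x.1 • (coeff x.1 F * coeff x.2 E) := by
  rw [← coeff_euler, h.euler_eq, coeff_mul]
  exact Finset.sum_congr rfl fun x _ => by rw [coeff_euler, smul_mul_assoc]

theorem commute_series {F G : PowerSeries R} (h : ∀ m n, Commute (coeff m F) (coeff n G)) :
    Commute F G := by
  ext n
  rw [coeff_mul, coeff_mul]
  exact Finset.sum_equiv (Equiv.prodComm ℕ ℕ) (by simp [mem_antidiagonal, add_comm])
    fun x _ => (h x.1 x.2).eq

/-- Sequences determined recursively by an inhomogeneous version of the differential equation of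
the exponential. -/
theorem exp_recursion_unique' {V : Type*} [AddCommGroup V] [IsAddTorsionFree V]
    (φ : ℕ → V → V) (r e e' : ℕ → V) (h0 : e 0 = e' 0)
    (h : ∀ N, N • e N = ∑ x ∈ antidiagonal N, x.1 • φ x.1 (e x.2) + r N)
    (h' : ∀ N, N • e' N = ∑ x ∈ antidiagonal N, x.1 • φ x.1 (e' x.2) + r N) (N : ℕ) :
    e N = e' N := by
  induction N using Nat.strong_induction_on with
  | _ N ih =>
    rcases Nat.eq_zero_or_pos N with rfl | hN
    · exact h0
    · refine nsmul_right_injective hN.ne' ?_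
      dsimp only
      rw [h, h']
      congr 1
      refine Finset.sum_congr rfl fun x hx => ?_
      rcases Nat.eq_zero_or_pos x.1 with h1 | h1
      · simp [h1]
      · rw [ih x.2 (by have := mem_antidiagonal.1 hx; omega)]

theorem exp_recursion_unique {V : Type*} [AddCommGroup V] [IsAddTorsionFree V]
    (φ : ℕ → V → V) (e e' : ℕ → V) (h0 : e 0 = e' 0)
    (h : ∀ N, N • e N = ∑ x ∈ antidiagonal N, x.1 • φ x.1 (e x.2))
    (h' : ∀ N, N • e' N = ∑ x ∈ antidiagonal N, x.1 • φ x.1 (e' x.2)) (N : ℕ) :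
    e N = e' N :=
  exp_recursion_unique' φ 0 e e' h0 (by simpa using h) (by simpa using h') N

theorem IsExp.unique [IsAddTorsionFree R] {F E E' : PowerSeries R} (h : IsExp F E)
    (h' : IsExp F E') : E = E' := by
  ext N
  exact exp_recursion_unique (fun m v => coeff m F * v) (fun n => coeff n E)
    (fun n => coeff n E') (by rw [h.coeff_zero, h'.coeff_zero]) h.coeff_eq h'.coeff_eq N

theorem coeff_pow_eq_zero {F : PowerSeries R} (hF : coeff 0 F = 0) :
    ∀ {k n : ℕ}, n < k → coeff n (F ^ k) = 0 := by
  intro k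
  induction k with
  | zero => intro n h; omega
  | succ k ih =>
    intro n h
    rw [pow_succ, coeff_mul]
    refine Finset.sum_eq_zero fun x hx => ?_
    have := mem_antidiagonal.1 hx
    rcases Nat.eq_zero_or_pos x.2 with h2 | h2
    · rw [h2, hF, mul_zero]
    · rw [ih (by omega), zero_mul]

/-- Since `F` has no constant term, `F ^ k` starts in degree `k`, so cutting the exponential series
at `k ≤ N` does not affect degree `N`. Commuting coefficients give `euler (F ^ (k + 1)) = (k + 1) •
(euler F * F ^ k)`, as over a commutative ring. -/
theorem isExp_sum {K : Type*} [Field K] [CharZero K] [Algebra K R] {F : PowerSeries R}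
    (hF : coeff 0 F = 0) (hc : ∀ m n, Commute (coeff m F) (coeff n F)) :
    IsExp F (PowerSeries.mk fun N =>
      ∑ k ∈ Finset.range (N + 1), ((k.factorial : K)⁻¹) • coeff N (F ^ k)) where
  coeff_zero := by simp
  euler_eq := by
    have hcomm : Commute F (euler F) := commute_series fun m n => by
      rw [coeff_euler]; exact (hc m n).smul_right n
    have hext : ∀ b M, b < M → ∑ k ∈ Finset.range (b + 1), ((k.factorial : K)⁻¹) • coeff b (F ^ k)
        = ∑ k ∈ Finset.range M, ((k.factorial : K)⁻¹) • coeff b (F ^ k) := by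
      intro b M hb
      refine Finset.sum_subset (Finset.range_mono hb) fun k _ hk => ?_
      rw [coeff_pow_eq_zero hF (by simpa using hk), smul_zero]
    ext N
    rw [coeff_euler, coeff_mk, coeff_mul, Finset.sum_range_succ']
    have h0 : N • ((Nat.factorial 0 : K)⁻¹ • coeff N (F ^ 0)) = 0 := by
      rw [pow_zero, coeff_one]; split_ifs with h <;> simp [h]
    rw [smul_add, h0, add_zero, Finset.smul_sum]
    have h1 : ∀ k, N • (((k + 1).factorial : K)⁻¹ • coeff N (F ^ (k + 1)))
        = ∑ x ∈ antidiagonal N,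
          coeff x.1 (euler F) * ((k.factorial : K)⁻¹ • coeff x.2 (F ^ k)) := by
      intro k
      rw [smul_comm, ← coeff_euler, euler_pow F hcomm, map_nsmul, coeff_mul,
        ← Nat.cast_smul_eq_nsmul K (k + 1), smul_smul, Finset.smul_sum]
      refine Finset.sum_congr rfl fun x _ => ?_
      rw [mul_smul_comm]
      congr 1
      rw [Nat.factorial_succ]
      push_cast
      have : (k : K) + 1 ≠ 0 := by exact_mod_cast k.succ_ne_zero
      field_simp
    rw [Finset.sum_congr rfl fun k _ => h1 k, Finset.sum_comm]
    refine Finset.sum_congr rfl fun x hx => ?_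
    rw [coeff_mk, ← Finset.mul_sum]
    rcases Nat.eq_zero_or_pos x.1 with h | h
    · rw [h, coeff_euler, zero_smul, zero_mul, zero_mul]
    · rw [hext x.2 N (by have := mem_antidiagonal.1 hx; omega)]

end Exponential

theorem sum_antidiagonal_assoc {V : Type*} [AddCommMonoid V] (F : ℕ → ℕ → ℕ → V) (N : ℕ) :
    ∑ x ∈ antidiagonal N, ∑ y ∈ antidiagonal x.2, F x.1 y.1 y.2 =
      ∑ x ∈ antidiagonal N, ∑ y ∈ antidiagonal x.1, F y.1 y.2 x.2 := by
  rw [Finset.sum_sigma', Finset.sum_sigma']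
  refine Finset.sum_nbij' (fun s => ⟨(s.1.1 + s.2.1, s.2.2), (s.1.1, s.2.1)⟩)
    (fun s => ⟨(s.2.1, s.2.2 + s.1.2), (s.2.2, s.1.2)⟩) ?_ ?_ ?_ ?_ ?_
  · rintro ⟨⟨a, b⟩, ⟨c, d⟩⟩ h
    simp [mem_antidiagonal] at h ⊢; omega
  · rintro ⟨⟨a, b⟩, ⟨c, d⟩⟩ h
    simp [mem_antidiagonal] at h ⊢; omega
  · rintro ⟨⟨a, b⟩, ⟨c, d⟩⟩ h
    simp [mem_antidiagonal] at h ⊢; grind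
  · rintro ⟨⟨a, b⟩, ⟨c, d⟩⟩ h
    simp [mem_antidiagonal] at h ⊢; grind
  · rintro ⟨⟨a, b⟩, ⟨c, d⟩⟩ h
    rfl

theorem sum_antidiagonal_left_comm {V : Type*} [AddCommMonoid V] (F : ℕ → ℕ → ℕ → V) (N : ℕ) :
    ∑ x ∈ antidiagonal N, ∑ y ∈ antidiagonal x.2, F x.1 y.1 y.2 =
      ∑ x ∈ antidiagonal N, ∑ y ∈ antidiagonal x.2, F y.1 x.1 y.2 := by
  rw [sum_antidiagonal_assoc, sum_antidiagonal_assoc (fun a b c => F b a c)]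
  exact Finset.sum_congr rfl fun x _ =>
    Finset.sum_equiv (Equiv.prodComm ℕ ℕ) (by simp [mem_antidiagonal, add_comm]) fun _ _ => rfl

/-! ### Exponentials of series of derivations -/

section Derivations

variable {R : Type*} [CommRing R] [IsAddTorsionFree R] {D : ℕ → R →+ R}

/-- The exponential of a series of derivations is multiplicative. -/
theorem exp_derivation_mul (hD : ∀ m a b, D m (a * b) = a * D m b + b * D m a)
    {A : ℕ → R → R} (h0 : ∀ v, A 0 v = v)
    (h : ∀ N v, N • A N v = ∑ x ∈ antidiagonal N, x.1 • D x.1 (A x.2 v)) (N : ℕ) (v w : R) :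
    A N (v * w) = ∑ x ∈ antidiagonal N, A x.1 v * A x.2 w := by
  refine exp_recursion_unique (fun m v => D m v) (fun N => A N (v * w))
      (fun N => ∑ x ∈ antidiagonal N, A x.1 v * A x.2 w) ?_
      (fun N => h N _) (fun N => ?_) N
  · simp [h0]
  · have e1 : ∀ x : ℕ × ℕ, x.1 • D x.1 (∑ y ∈ antidiagonal x.2, A y.1 v * A y.2 w) =
        ∑ y ∈ antidiagonal x.2, (x.1 • (A y.1 v * D x.1 (A y.2 w)) +
            x.1 • (A y.2 w * D x.1 (A y.1 v))) := by
      intro x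
      rw [map_sum, Finset.smul_sum]
      refine Finset.sum_congr rfl fun y _ => ?_
      rw [hD, smul_add]
    have e2 : ∀ x ∈ antidiagonal N, N • (A x.1 v * A x.2 w) =
        ∑ y ∈ antidiagonal x.2, (y.1 • (A x.1 v * D y.1 (A y.2 w))) +
        ∑ y ∈ antidiagonal x.1, (y.1 • (A x.2 w * D y.1 (A y.2 v))) := by
      intro x hx
      rw [← mem_antidiagonal.1 hx, add_smul, add_comm (x.1 • _), ← mul_smul_comm,
        ← smul_mul_assoc, h, h, Finset.mul_sum, Finset.sum_mul]
      congr 1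
      · exact Finset.sum_congr rfl fun y _ => by rw [mul_smul_comm]
      · exact Finset.sum_congr rfl fun y _ => by rw [smul_mul_assoc, mul_comm (D _ _)]
    rw [Finset.smul_sum, Finset.sum_congr rfl e2, Finset.sum_congr rfl fun x _ => e1 x]
    simp only [Finset.sum_add_distrib]
    -- The sums run over triples with `a + b + c = N` and differ only in the place of the index
    -- carried by the derivation.
    rw [sum_antidiagonal_left_comm fun a b c => b • (A a v * D b (A c w)),
      ← sum_antidiagonal_assoc fun a b c => a • (A c w * D a (A b v))]

/-- A derivation acting on the exponential of a series on which it takes a single constant value. -/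
theorem derivation_exp (hD : ∀ m a b, D m (a * b) = a * D m b + b * D m a)
    {L E : PowerSeries R} (hE : IsExp L E) {m : ℕ} {b : R}
    (hm : 1 ≤ m) (hL : ∀ N, D m (coeff N L) = if N = m then b else 0) (N : ℕ) :
    D m (coeff N E) = if m ≤ N then b * coeff (N - m) E else 0 := by
  have h1 : D m 1 = 0 := by simpa using hD m 1 1
  -- `H = b X^m E` is the expected value of `D m` on `E`, since `D m` sends `L` to `b X^m`. Both
  -- satisfy the recursion of the exponential with the source term `m • H`, coming from `euler (X^m)
  -- = m X^m` on one side and from the derivative of `L` on the other.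
  set H : PowerSeries R := X ^ m * (C b * E) with hH
  have hHc : ∀ N, coeff N H = if m ≤ N then b * coeff (N - m) E else 0 := by
    intro N; rw [hH, coeff_X_pow_mul']; split_ifs <;> simp
  have hX : euler (X ^ m : PowerSeries R) = m • X ^ m := by
    ext n; rw [coeff_euler, map_nsmul, coeff_X_pow]; split_ifs with h <;> simp [h]
  have hC : euler (C b : PowerSeries R) = 0 := by
    ext n; rw [coeff_euler, coeff_C]; split_ifs with h <;> simp [h]
  have hHe : euler H = euler L * H + m • H := by
    rw [hH, euler_mul, euler_mul, hX, hC, hE.euler_eq, zero_mul, zero_add, smul_mul_assoc]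
    ring
  rw [← hHc]
  refine exp_recursion_unique' (fun k e => coeff k L * e) (fun N => m • coeff N H)
    (fun N => D m (coeff N E)) (fun N => coeff N H) ?_ (fun N => ?_) (fun N => ?_) N
  · rw [hE.coeff_zero, h1, hHc, if_neg (by omega)]
  · rw [← map_nsmul, hE.coeff_eq, map_sum]
    simp only [map_nsmul, hD, smul_add, Finset.sum_add_distrib]
    congr 1
    rw [hHc]
    simp only [hL]
    split_ifs with h
    · rw [Finset.sum_eq_single (m, N - m)]
      · simp [mul_comm]
      · rintro ⟨x, y⟩ hx hne
        have hx' := mem_antidiagonal.1 hx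
        dsimp only at hx' ⊢
        rw [if_neg, mul_zero, smul_zero]
        rintro rfl
        exact hne (by ext <;> simp; omega)
      · intro hn
        exact absurd (mem_antidiagonal.2 (by simp; omega)) hn
    · rw [smul_zero]
      refine Finset.sum_eq_zero fun x hx => ?_
      have hx' := mem_antidiagonal.1 hx
      rw [if_neg (by omega), mul_zero, smul_zero]
  · rw [← coeff_euler, hHe, map_add, map_nsmul, coeff_mul]
    congr 1
    exact Finset.sum_congr rfl fun x _ => by rw [coeff_euler, smul_mul_assoc]

end Derivations

/-- The exponential of a series of derivations acting on another exponential. -/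
theorem exp_derivation_exp {R V : Type*} [CommRing R] [AddCommGroup V] [IsAddTorsionFree V] [Module R V]
    {D : ℕ → V →ₗ[R] V} {A : ℕ → V → V} (h0 : ∀ v, A 0 v = v)
    (h : ∀ N v, N • A N v = ∑ x ∈ antidiagonal N, x.1 • D x.1 (A x.2 v))
    {b f : ℕ → R} (hf : IsExp (PowerSeries.mk b) (PowerSeries.mk f)) {E : ℤ → V}
    (hE : ∀ m, 1 ≤ m → ∀ n, D m (E n) = b m • E (n - m)) (k : ℕ) (n : ℤ) :
    A k (E n) = f k • E (n - k) := by
  have hf0 : f 0 = 1 := by simpa using hf.coeff_zero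
  have key := exp_recursion_unique (V := ℤ → V)
    (fun m v n => D m (v n)) (fun k n => A k (E n)) (fun k n => f k • E (n - k)) ?_ ?_ ?_ k
  · exact congrFun key n
  · funext n; simp [h0, hf0]
  · intro N; funext n
    simp [h, Finset.sum_apply]
  · intro N; funext n
    have := hf.coeff_eq N
    simp only [coeff_mk] at this
    simp only [Pi.smul_apply, Finset.sum_apply]
    rw [← smul_assoc, this, Finset.sum_smul]
    refine Finset.sum_congr rfl fun x hx => ?_
    rcases Nat.eq_zero_or_pos x.1 with h1 | h1
    · simp [h1]
    · rw [map_smul, hE _ h1, smul_smul, smul_assoc, mul_comm]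
      congr 3
      have := mem_antidiagonal.1 hx
      push_cast [← this]
      ring

theorem IsExp.smul_pow {K R : Type*} [CommRing K] [Ring R] [Algebra K R] (r : K)
    {F E : PowerSeries R} (h : IsExp F E) :
    IsExp (PowerSeries.mk fun n => r ^ n • coeff n F) (PowerSeries.mk fun n => r ^ n • coeff n E) where
  coeff_zero := by simp [h.coeff_zero]
  euler_eq := by
    ext N
    rw [coeff_euler, coeff_mk, smul_comm, h.coeff_eq, coeff_mul, Finset.smul_sum]
    refine Finset.sum_congr rfl fun x hx => ?_
    rw [coeff_euler, coeff_mk, coeff_mk, ← mem_antidiagonal.1 hx, smul_comm, smul_mul_assoc,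
      smul_mul_smul_comm, pow_add]

theorem IsExp.commute {R : Type*} [Ring R] [IsAddTorsionFree R] {F E : PowerSeries R}
    (h : IsExp F E) {T : R} (hT : ∀ m, Commute T (coeff m F)) (N : ℕ) : Commute T (coeff N E) := by
  refine exp_recursion_unique (fun m v => coeff m F * v) (fun N => T * coeff N E)
    (fun N => coeff N E * T) (by simp [h.coeff_zero]) (fun N => ?_) (fun N => ?_) N
  · rw [← mul_smul_comm, h.coeff_eq, Finset.mul_sum]
    refine Finset.sum_congr rfl fun x _ => ?_
    rw [mul_smul_comm, ← mul_assoc, (hT _).eq, mul_assoc]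
  · rw [← smul_mul_assoc, h.coeff_eq, Finset.sum_mul]
    exact Finset.sum_congr rfl fun x _ => by rw [smul_mul_assoc, mul_assoc]

end
end DeformedW

namespace DeformedW
noncomputable section
open PowerSeries Finset.HasAntidiagonal

/-! ### Creation and annihilation parts of normally ordered exponentials -/

instance : CharZero KFrac := charZero_of_injective_algebraMap (R := ℂ) (FaithfulSMul.algebraMap_injective ℂ KFrac)

theorem isAddTorsionFree_of_module (V : Type*) [AddCommGroup V] [Module KFrac V] :
    IsAddTorsionFree V :=
  haveI := Module.compHom V (algebraMap ℚ KFrac)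
  IsAddTorsionFree.of_module_rat V

instance {σ : Type*} : IsAddTorsionFree (MvPolynomial σ KFrac) := isAddTorsionFree_of_module _

theorem derivation_sum_apply {ι A : Type*} [CommRing A] [Algebra KFrac A] (s : Finset ι)
    (D : ι → Derivation KFrac A A) (v : A) : (∑ i ∈ s, D i) v = ∑ i ∈ s, D i v := by
  classical
  induction s using Finset.induction_on with
  | empty => simp
  | insert a s ha ih => rw [Finset.sum_insert ha, Finset.sum_insert ha, Derivation.add_apply, ih]

variable {l : ℕ} (g : CartanData l)

/-- The polynomial by which the creation operator `∑_i c (-N) i • x_i[-N]` multiplies. -/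
def creationLin (c : ModeFamily l) (N : ℕ) : Fock l :=
  if h : 0 < N then ∑ i, c (-(N : ℤ)) i • (MvPolynomial.X (i, ⟨N, h⟩) : Fock l) else 0

/-- The derivation `∑_i c m i • x_i[m]`, `m ≥ 0`. -/
def annihilationDer (c : ModeFamily l) (m : ℕ) : Derivation KFrac (Fock l) (Fock l) :=
  MvPolynomial.mkDerivation KFrac fun p : Fin l × ℕ+ =>
    if (p.2 : ℕ) = m then (MvPolynomial.C (∑ i, c m i * xComm g m i p.1) : Fock l) else 0

/-- The scalar commutator of `∑_i c m i • x_i[m]` and `∑_j s (-m) j • x_j[-m]`. -/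
def bracket (c s : ModeFamily l) (m : ℤ) : KFrac :=
  ∑ i, ∑ j, c m i * s (-m) j * xComm g m i j

theorem modeComb_neg (c : ModeFamily l) {N : ℕ} (hN : N ≠ 0) :
    modeComb g c (-(N : ℤ)) = LinearMap.mulLeft KFrac (creationLin c N) := by
  obtain ⟨n, rfl⟩ := Nat.exists_eq_succ_of_ne_zero hN
  refine LinearMap.ext fun v => ?_
  have h : (-((n.succ : ℕ) : ℤ)) = Int.negSucc n := rfl
  simp only [modeComb, creationLin, Nat.succ_pos, dif_pos, LinearMap.sum_apply,
    LinearMap.smul_apply, LinearMap.mulLeft_apply, Finset.sum_mul, smul_mul_assoc]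
  rw [h]
  rfl

theorem modeComb_natCast (c : ModeFamily l) (m : ℕ) :
    modeComb g c (m : ℤ) = (annihilationDer g c m).toLinearMap := by
  have h : (annihilationDer g c m) = ∑ i, c m i • MvPolynomial.mkDerivation KFrac
      (fun p : Fin l × ℕ+ =>
        if (p.2 : ℕ) = m then (MvPolynomial.C (xComm g m i p.1) : Fock l) else 0) := by
    refine MvPolynomial.derivation_ext fun p => ?_
    simp only [annihilationDer, MvPolynomial.mkDerivation_X, derivation_sum_apply,
      Derivation.smul_apply]
    split_ifs <;> simp [MvPolynomial.smul_eq_C_mul]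
  refine LinearMap.ext fun v => ?_
  rw [h, Derivation.coeFn_coe, derivation_sum_apply]
  simp only [modeComb, LinearMap.sum_apply]
  rfl

theorem annihilationDer_zero (c : ModeFamily l) : annihilationDer g c 0 = 0 := by
  refine MvPolynomial.derivation_ext fun p => ?_
  simp [annihilationDer, MvPolynomial.mkDerivation_X]

theorem annihilationDer_creationLin (c s : ModeFamily l) (m N : ℕ) :
    annihilationDer g c m (creationLin s N) =
      if m = N then MvPolynomial.C (bracket g c s m) else 0 := by
  rcases Nat.eq_zero_or_pos N with rfl | hN
  -- In degree `0` the bracket also vanishes, because `xComm` carries the factor `n`.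
  · by_cases h : m = 0
    · subst h
      simp [creationLin, bracket, xComm]
    · simp [creationLin, h]
  · simp only [creationLin, hN, dif_pos, map_sum, Derivation.map_smul, annihilationDer,
      MvPolynomial.mkDerivation_X]
    by_cases h : m = N
    · subst h
      simp only [PNat.mk_coe, if_true, bracket, map_sum, MvPolynomial.smul_eq_C_mul, ← map_mul,
        Finset.mul_sum]
      rw [Finset.sum_comm]
      refine Finset.sum_congr rfl fun i _ => Finset.sum_congr rfl fun j _ => ?_
      congr 1; ring
    · simp [h, Ne.symm h]

/-- The commutator is again a derivation, and it kills the generators because both derivations send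
them to constants. -/
theorem derivation_commute_of_const {D D' : Derivation KFrac (Fock l) (Fock l)}
    (h : ∀ p, ∃ a, D (MvPolynomial.X p) = MvPolynomial.C a)
    (h' : ∀ p, ∃ a, D' (MvPolynomial.X p) = MvPolynomial.C a) :
    Commute (D.toLinearMap : Module.End KFrac (Fock l)) D'.toLinearMap := by
  have h0 : ⁅D, D'⁆ = 0 := by
    refine MvPolynomial.derivation_ext fun p => ?_
    obtain ⟨a, ha⟩ := h p
    obtain ⟨b, hb⟩ := h' p
    have hC : ∀ (E : Derivation KFrac (Fock l) (Fock l)) (a : KFrac),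
        E (MvPolynomial.C a) = 0 := fun E a => E.map_algebraMap a
    rw [Derivation.commutator_apply, ha, hb, hC, hC, sub_zero]; rfl
  refine LinearMap.ext fun v => ?_
  have := congrArg (fun E : Derivation KFrac (Fock l) (Fock l) => E v) h0
  simp only [Derivation.commutator_apply, Derivation.coe_zero, Pi.zero_apply, sub_eq_zero] at this
  exact this

theorem annihilationDer_X (c : ModeFamily l) (m : ℕ) (p : Fin l × ℕ+) :
    ∃ a, annihilationDer g c m (MvPolynomial.X p) = MvPolynomial.C a := by
  rw [annihilationDer, MvPolynomial.mkDerivation_X]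
  split_ifs
  · exact ⟨_, rfl⟩
  · exact ⟨0, by simp⟩

theorem commute_annihilationDer (c s : ModeFamily l) (m n : ℕ) :
    Commute ((annihilationDer g c m).toLinearMap : Module.End KFrac (Fock l))
      (annihilationDer g s n).toLinearMap :=
  derivation_commute_of_const (annihilationDer_X g c m) (annihilationDer_X g s n)

/-- The power series of derivations `∑_m c_m ζ^m`. -/
def derSeries (c : ModeFamily l) : PowerSeries (Module.End KFrac (Fock l)) :=
  PowerSeries.mk fun m => (annihilationDer g c m).toLinearMap

/-- The power series `∑_N creationLin c N ζ^N`. -/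
def linSeries (c : ModeFamily l) : PowerSeries (Fock l) := PowerSeries.mk (creationLin c)

/-- The creation part of a normally ordered exponential, as a sequence of polynomials. -/
def creationPoly (c : ModeFamily l) (N : ℕ) : Fock l := creationCoeff g c N 1

theorem isExp_expCoeff {f : ℕ → Module.End KFrac (Fock l)} (h0 : f 0 = 0)
    (hc : ∀ m n, Commute (f m) (f n)) :
    IsExp (PowerSeries.mk f) (PowerSeries.mk (expCoeff f)) := by
  have h : (PowerSeries.mk fun m => if m = 0 then 0 else f m) = PowerSeries.mk f := by
    ext1 m; rw [coeff_mk, coeff_mk]; split_ifs with h <;> simp [h, h0]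
  have := isExp_sum (K := KFrac) (F := PowerSeries.mk f) (by simpa using h0) (by simpa using hc)
  unfold expCoeff
  rw [h]
  exact this

theorem isExp_annihilation (c : ModeFamily l) :
    IsExp (derSeries g c) (PowerSeries.mk (annihilationCoeff g c)) := by
  have : annihilationCoeff g c = expCoeff fun m => (annihilationDer g c m).toLinearMap := by
    funext N
    simp only [annihilationCoeff, modeComb_natCast]
  rw [this]
  refine isExp_expCoeff ?_ fun m n => commute_annihilationDer g c c m n
  rw [annihilationDer_zero]; rfl

theorem isExp_creation_op (c : ModeFamily l) :
    IsExp (PowerSeries.mk fun N => LinearMap.mulLeft KFrac (creationLin c N))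
      (PowerSeries.mk (creationCoeff g c)) := by
  have : creationCoeff g c = expCoeff fun N => LinearMap.mulLeft KFrac (creationLin c N) := by
    funext N
    simp only [creationCoeff, expCoeff]
    refine Finset.sum_congr rfl fun k _ => ?_
    congr 3
    ext1 m
    rw [coeff_mk, coeff_mk]
    split_ifs with h
    · rfl
    · rw [modeComb_neg g c h]
  rw [this]
  refine isExp_expCoeff (LinearMap.ext fun v => by simp [creationLin]) fun m n => ?_
  refine LinearMap.ext fun v => ?_
  simp only [Module.End.mul_apply, LinearMap.mulLeft_apply]
  ring

/-- The creation part is multiplication by one polynomial, its value on the vacuum. The annihilation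
part, an exponential of derivations, can then be applied to that polynomial. -/
theorem creationCoeff_apply (c : ModeFamily l) (N : ℕ) (v : Fock l) :
    creationCoeff g c N v = creationPoly g c N * v := by
  have hE := isExp_creation_op g c
  have hr : ∀ (w : Fock l) (N : ℕ), N • creationCoeff g c N w = ∑ x ∈ antidiagonal N,
      x.1 • (creationLin c x.1 * creationCoeff g c x.2 w) := by
    intro w N
    have := congrArg (fun T : Module.End KFrac (Fock l) => T w) (hE.coeff_eq N)
    simpa [LinearMap.sum_apply] using this
  refine exp_recursion_unique (fun m v => creationLin c m * v)
    (fun N => creationCoeff g c N v) (fun N => creationPoly g c N * v) ?_ (hr v) (fun N => ?_) N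
  · have := hE.coeff_zero
    rw [coeff_mk] at this
    simp [creationPoly, this]
  · dsimp only [creationPoly]
    rw [← smul_mul_assoc, hr 1 N, Finset.sum_mul]
    exact Finset.sum_congr rfl fun x _ => by rw [smul_mul_assoc, mul_assoc]

theorem isExp_creation (c : ModeFamily l) :
    IsExp (linSeries c) (PowerSeries.mk (creationPoly g c)) where
  coeff_zero := by
    have := (isExp_creation_op g c).coeff_zero
    rw [coeff_mk] at this
    simp [creationPoly, this]
  euler_eq := by
    ext1 N
    have := congrArg (fun T : Module.End KFrac (Fock l) => T 1)
      ((isExp_creation_op g c).coeff_eq N)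
    rw [coeff_euler, coeff_mul]
    simpa only [LinearMap.sum_apply, linSeries, coeff_euler, coeff_mk, LinearMap.smul_apply,
      Module.End.mul_apply, LinearMap.mulLeft_apply, smul_mul_assoc, creationPoly] using this

/-- The creation part indexed by the integers, zero in negative degrees. -/
def creationInt (c : ModeFamily l) (n : ℤ) : Fock l :=
  if 0 ≤ n then creationPoly g c n.toNat else 0

theorem creationInt_natCast (c : ModeFamily l) (n : ℕ) :
    creationInt g c n = creationPoly g c n := by simp [creationInt]

theorem creationInt_neg (c : ModeFamily l) {n : ℤ} (h : n < 0) : creationInt g c n = 0 := by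
  simp [creationInt, not_le.2 h]

theorem annihilation_zero (c : ModeFamily l) : annihilationCoeff g c 0 = 1 := by
  have := (isExp_annihilation g c).coeff_zero
  rwa [coeff_mk] at this

theorem annihilation_recursion (c : ModeFamily l) (N : ℕ) (v : Fock l) :
    N • annihilationCoeff g c N v = ∑ x ∈ antidiagonal N,
      x.1 • annihilationDer g c x.1 (annihilationCoeff g c x.2 v) := by
  have := congrArg (fun T : Module.End KFrac (Fock l) => T v)
    ((isExp_annihilation g c).coeff_eq N)
  simpa [LinearMap.sum_apply, derSeries] using this

/-- The annihilation part is multiplicative, being the exponential of a derivation. -/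
theorem annihilation_mul (c : ModeFamily l) (N : ℕ) (v w : Fock l) :
    annihilationCoeff g c N (v * w) = ∑ x ∈ antidiagonal N,
      annihilationCoeff g c x.1 v * annihilationCoeff g c x.2 w := by
  exact exp_derivation_mul (D := fun m => (annihilationDer g c m).toLinearMap.toAddMonoidHom)
    (fun m a b => (annihilationDer g c m).leibniz a b)
    (A := fun n v => annihilationCoeff g c n v) (fun v => by rw [annihilation_zero]; rfl)
    (fun N v => annihilation_recursion g c N v) N v w

end
end DeformedW

namespace DeformedW
noncomputable section
open PowerSeries Finset.HasAntidiagonal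

/-! ### Products of normally ordered exponentials -/

section NormalOrdering

variable {l : ℕ} (g : CartanData l)

instance : IsAddTorsionFree (Module.End KFrac (Fock l)) :=
  isAddTorsionFree_of_module (Module.End KFrac (Fock l))

theorem annihilationDer_creationInt (c s : ModeFamily l) (m : ℕ) (hm : 1 ≤ m) (n : ℤ) :
    annihilationDer g c m (creationInt g s n) =
      bracket g c s m • creationInt g s (n - m) := by
  rcases lt_or_ge n 0 with hn | hn
  · rw [creationInt_neg g s hn, creationInt_neg g s (by omega), map_zero, smul_zero]
  · lift n to ℕ using hn
    have := derivation_exp (D := fun m => (annihilationDer g c m).toLinearMap.toAddMonoidHom)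
      (fun m a b => (annihilationDer g c m).leibniz a b) (isExp_creation g s) hm
      (b := MvPolynomial.C (bracket g c s m)) (fun N => by
        rw [linSeries, coeff_mk]
        refine (annihilationDer_creationLin g c s m N).trans ?_
        simp only [eq_comm]) n
    rw [coeff_mk, coeff_mk] at this
    rw [creationInt_natCast]
    refine Eq.trans this ?_
    split_ifs with h
    · rw [← Nat.cast_sub h, creationInt_natCast, MvPolynomial.smul_eq_C_mul]
    · rw [creationInt_neg g s (by omega), smul_zero]

/-- The series `f` collects all contractions between the annihilation part of one field and the
creation part of the other; it is the exponential of the scalar brackets. -/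
theorem annihilation_creationInt {c s : ModeFamily l} {f : ℕ → KFrac}
    (hf : IsExp (PowerSeries.mk fun m => bracket g c s m) (PowerSeries.mk f)) (k : ℕ) (n : ℤ) :
    annihilationCoeff g c k (creationInt g s n) = f k • creationInt g s (n - k) :=
  exp_derivation_exp (D := fun m => (annihilationDer g c m).toLinearMap)
    (A := fun k v => annihilationCoeff g c k v) (fun v => by rw [annihilation_zero]; rfl)
    (fun N v => annihilation_recursion g c N v) hf
    (fun m hm n => annihilationDer_creationInt g c s m hm n) k n

theorem commute_annihilationCoeff (c s : ModeFamily l) (k j : ℕ) :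
    Commute (annihilationCoeff g c k) (annihilationCoeff g s j) := by
  have h1 : ∀ m, Commute (annihilationCoeff g c k) (annihilationDer g s m).toLinearMap := by
    intro m
    have := ((isExp_annihilation g c).commute
      (T := ((annihilationDer g s m).toLinearMap : Module.End KFrac (Fock l)))
      (fun n => by rw [derSeries, coeff_mk]; exact commute_annihilationDer g s c m n) k).symm
    rwa [coeff_mk] at this
  have := (isExp_annihilation g s).commute (T := annihilationCoeff g c k)
    (fun n => by rw [derSeries, coeff_mk]; exact h1 n) j
  rwa [coeff_mk] at this

/-- The family of modes of the field evaluated at `zx`, as a function of `z`. -/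
def scaleFam (x : KFrac) (s : ModeFamily l) : ModeFamily l := fun m => x ^ (-m) • s m

theorem annihilationDer_add (c s : ModeFamily l) (m : ℕ) :
    annihilationDer g (c + s) m = annihilationDer g c m + annihilationDer g s m := by
  refine MvPolynomial.derivation_ext fun p => ?_
  simp only [annihilationDer, MvPolynomial.mkDerivation_X, Derivation.add_apply]
  split_ifs <;> simp [add_mul, Finset.sum_add_distrib]

theorem annihilationDer_smul (a : KFrac) (c s : ModeFamily l) (m : ℕ)
    (h : c m = a • s m) :
    annihilationDer g c m = a • annihilationDer g s m := by
  refine MvPolynomial.derivation_ext fun p => ?_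
  simp only [annihilationDer, MvPolynomial.mkDerivation_X, Derivation.smul_apply, h]
  split_ifs
  · rw [MvPolynomial.smul_eq_C_mul, ← MvPolynomial.C_mul, Finset.mul_sum]
    simp [mul_assoc]
  · simp

theorem annihilation_add (c s : ModeFamily l) (N : ℕ) :
    annihilationCoeff g (c + s) N =
      ∑ x ∈ antidiagonal N, annihilationCoeff g c x.1 * annihilationCoeff g s x.2 := by
  have h : derSeries g (c + s) = derSeries g c + derSeries g s := by
    ext1 m
    rw [map_add, derSeries, derSeries, derSeries, coeff_mk, coeff_mk, coeff_mk,
      annihilationDer_add]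
    rfl
  have h1 := (isExp_annihilation g c).add (isExp_annihilation g s) <| commute_series fun m n => by
    rw [coeff_mk, coeff_euler]
    refine Commute.smul_right ?_ n
    have h2 := (isExp_annihilation g c).commute (T := coeff n (derSeries g s)) (fun k => by
      rw [derSeries, derSeries, coeff_mk, coeff_mk]; exact commute_annihilationDer g s c n k) m
    rw [coeff_mk] at h2
    exact h2.symm
  rw [← h] at h1
  have := congrArg (coeff N) ((isExp_annihilation g (c + s)).unique h1)
  rw [coeff_mk, coeff_mul] at this
  simpa using this

theorem annihilation_scale (x : KFrac) (s : ModeFamily l) (N : ℕ) :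
    annihilationCoeff g (scaleFam x s) N = x⁻¹ ^ N • annihilationCoeff g s N := by
  have h := (isExp_annihilation g s).smul_pow x⁻¹
  have h2 : (PowerSeries.mk fun n => x⁻¹ ^ n • coeff n (derSeries g s)) =
      derSeries g (scaleFam x s) := by
    ext1 m
    rw [coeff_mk, derSeries, derSeries, coeff_mk, coeff_mk,
      annihilationDer_smul g (x⁻¹ ^ m) (scaleFam x s) s m (by simp [scaleFam])]
    rfl
  rw [h2] at h
  have := congrArg (coeff N) ((isExp_annihilation g (scaleFam x s)).unique h)
  simpa using this

theorem creationLin_add (c s : ModeFamily l) (N : ℕ) :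
    creationLin (c + s) N = creationLin c N + creationLin s N := by
  unfold creationLin
  split_ifs <;> simp [add_smul, Finset.sum_add_distrib]

theorem creationLin_scale (x : KFrac) (s : ModeFamily l) (N : ℕ) :
    creationLin (scaleFam x s) N = x ^ N • creationLin s N := by
  unfold creationLin
  split_ifs <;> simp [scaleFam, Finset.smul_sum, smul_smul]

theorem creation_add (c s : ModeFamily l) (N : ℕ) :
    creationPoly g (c + s) N =
      ∑ x ∈ antidiagonal N, creationPoly g c x.1 * creationPoly g s x.2 := by
  have h : linSeries (c + s) = linSeries c + linSeries s := by
    ext1 m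
    rw [map_add, linSeries, linSeries, linSeries, coeff_mk, coeff_mk, coeff_mk, creationLin_add]
  have h1 := (isExp_creation g c).add (isExp_creation g s) (Commute.all _ _)
  rw [← h] at h1
  have := congrArg (coeff N) ((isExp_creation g (c + s)).unique h1)
  rw [coeff_mk, coeff_mul] at this
  simpa using this

theorem creation_scale (x : KFrac) (s : ModeFamily l) (N : ℕ) :
    creationPoly g (scaleFam x s) N = x ^ N • creationPoly g s N := by
  have h := (isExp_creation g s).smul_pow x
  have h2 : (PowerSeries.mk fun n => x ^ n • coeff n (linSeries s)) =
      linSeries (scaleFam x s) := by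
    ext1 m
    rw [coeff_mk, linSeries, linSeries, coeff_mk, coeff_mk, creationLin_scale]
  rw [h2] at h
  have := congrArg (coeff N) ((isExp_creation g (scaleFam x s)).unique h)
  simpa using this

theorem annihilation_lowers (c : ModeFamily l) (N : ℕ) : Lowers (annihilationCoeff g c N) N := by
  intro d p hp
  simp only [annihilationCoeff, expCoeff, LinearMap.sum_apply, LinearMap.smul_apply]
  refine Submodule.sum_mem _ fun k _ => Submodule.smul_mem _ _ ?_
  refine lowers_coeff_pow _ ?_ k N d p hp
  intro n d p hp
  rw [PowerSeries.coeff_mk]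
  split_ifs with h
  · simp
  · exact lowers_modeComb g c n d p hp

theorem eq_zero_of_mem_weightLE {d : ℤ} (hd : d < 0) {v : Fock l} (hv : v ∈ weightLE l d) :
    v = 0 := by
  ext s
  by_contra hne
  have := hv s (by simpa using hne)
  omega

theorem exists_mem_weightLE (v : Fock l) : ∃ D : ℕ, v ∈ weightLE l D := by
  refine ⟨v.support.sup weight, fun s hs => ?_⟩
  exact_mod_cast Finset.le_sup (f := weight) (by simpa using hs)

/-- Any sufficiently large bound may replace the `finsum`, so sums with different truncations can be
compared. -/
theorem normalExp_apply (c : ModeFamily l) (n : ℤ) (v : Fock l) {N : ℕ}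
    (hN : ∀ k, N ≤ k → annihilationCoeff g c k v = 0) :
    normalExp g c n v =
      ∑ k ∈ Finset.range N, creationInt g c (n + k) * annihilationCoeff g c k v := by
  have h : ∀ k : ℕ, (if 0 ≤ n + k then creationCoeff g c (n + k).toNat (annihilationCoeff g c k v)
      else 0) = creationInt g c (n + k) * annihilationCoeff g c k v := by
    intro k
    rw [creationInt]
    split_ifs with h
    · rw [creationCoeff_apply]
    · rw [zero_mul]
  change (∑ᶠ k : ℕ, if 0 ≤ n + k then creationCoeff g c (n + k).toNat (annihilationCoeff g c k v)
      else 0) = _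
  rw [finsum_congr h]
  refine finsum_eq_sum_of_support_subset _ fun k hk => ?_
  rw [Finset.coe_range, Set.mem_Iio]
  by_contra hlt
  exact hk (by simp [hN k (not_lt.1 hlt)])

end NormalOrdering

end
end DeformedW

/-! ### Operator product expansions and commutators of vertex operators -/

namespace DeformedW
noncomputable section
open PowerSeries Finset.HasAntidiagonal

theorem sum_range_antidiagonal {V : Type*} [AddCommMonoid V] (F : ℕ → ℕ → V) {P Q : ℕ}
    (hF : ∀ a b, P ≤ a ∨ Q ≤ b → F a b = 0) {N : ℕ} (hN : P + Q ≤ N) :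
    ∑ k ∈ Finset.range N, ∑ x ∈ antidiagonal k, F x.1 x.2 =
      ∑ a ∈ Finset.range P, ∑ b ∈ Finset.range Q, F a b := by
  rw [Finset.sum_sigma', ← Finset.sum_product']
  symm
  refine Finset.sum_of_injOn (fun x : ℕ × ℕ => (⟨x.1 + x.2, x⟩ : Σ _ : ℕ, ℕ × ℕ)) ?_ ?_ ?_ ?_
  · intro x _ y _ h
    simpa using (Sigma.mk.inj_iff.1 h).2
  · rintro ⟨a, b⟩ h
    simp [mem_antidiagonal] at h ⊢
    omega
  · rintro ⟨k, a, b⟩ h h'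
    refine hF a b ?_
    by_contra! hlt
    refine h' ⟨(a, b), by simpa using hlt, ?_⟩
    simp [mem_antidiagonal] at h
    simp [h.2]
  · intro x _
    rfl

theorem add_sub_sub_cancel_left {V : Type*} [AddCommGroup V] (a b c : V) :
    a + b - (a - c) = b + c := by abel

section NormalOrdering

variable {l : ℕ} (g : CartanData l)

/-- The coefficient of `z ^ a w ^ b` in the normally ordered product of two exponential fields,
applied to a vector of weight less than `N`. -/
def orderedCoeff (c s : ModeFamily l) (v : Fock l) (N : ℕ) (a b : ℤ) : Fock l :=
  ∑ k ∈ Finset.range N, ∑ j ∈ Finset.range N,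
    (creationInt g c (a + k) * creationInt g s (b + j)) *
      annihilationCoeff g c k (annihilationCoeff g s j v)

/-- Creation parts are commuting polynomials and annihilation parts commute, so normal ordering
forgets the order of the fields. Hence the two products in a commutator are expressed through the
same coefficients. -/
theorem orderedCoeff_swap (c s : ModeFamily l) (v : Fock l) (N : ℕ) (a b : ℤ) :
    orderedCoeff g s c v N b a = orderedCoeff g c s v N a b := by
  unfold orderedCoeff
  rw [Finset.sum_comm]
  refine Finset.sum_congr rfl fun k _ => Finset.sum_congr rfl fun j _ => ?_
  have := congrArg (fun T : Module.End KFrac (Fock l) => T v)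
    (commute_annihilationCoeff g c s k j).eq
  simp only [Module.End.mul_apply] at this
  rw [this, mul_comm (creationInt g s _)]

theorem orderedCoeff_eq_zero (c s : ModeFamily l) (v : Fock l) {N : ℕ} {a b : ℤ}
    (h : a + N ≤ 0 ∨ b + N ≤ 0) : orderedCoeff g c s v N a b = 0 := by
  refine Finset.sum_eq_zero fun k hk => Finset.sum_eq_zero fun j hj => ?_
  rw [Finset.mem_range] at hk hj
  rcases h with h | h
  · rw [creationInt_neg g c (by omega), zero_mul, zero_mul]
  · rw [creationInt_neg g s (by omega), mul_zero, zero_mul]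

variable {g} {v : Fock l} {D : ℕ}

theorem annihilation_eq_zero (hv : v ∈ weightLE l D) (c : ModeFamily l) {k : ℕ} (hk : D < k) :
    annihilationCoeff g c k v = 0 :=
  eq_zero_of_mem_weightLE (d := (D : ℤ) - k) (by omega) (annihilation_lowers g c k D v hv)

theorem annihilation_annihilation_eq_zero (hv : v ∈ weightLE l D) (c s : ModeFamily l) {k j : ℕ}
    (hk : D < k + j) : annihilationCoeff g c k (annihilationCoeff g s j v) = 0 :=
  eq_zero_of_mem_weightLE (d := (D : ℤ) - j - k) (by omega)
    (annihilation_lowers g c k _ _ (annihilation_lowers g s j D v hv))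

/-- The operator product expansion of two normally ordered exponentials. -/
theorem normalExp_normalExp (hv : v ∈ weightLE l D) {c s : ModeFamily l} {f : ℕ → KFrac}
    (hf : IsExp (PowerSeries.mk fun m => bracket g c s m) (PowerSeries.mk f)) (n m : ℤ) {P : ℕ}
    (hP : m + D < P) :
    normalExp g c n (normalExp g s m v) =
      ∑ p ∈ Finset.range P, f p • orderedCoeff g c s v (D + 1) (n + p) (m - p) := by
  rw [normalExp_apply g s m v (N := D + 1) fun k hk => annihilation_eq_zero hv s hk, map_sum]
  have h1 : ∀ j ∈ Finset.range (D + 1),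
      normalExp g c n (creationInt g s (m + j) * annihilationCoeff g s j v) =
      ∑ a ∈ Finset.range P, ∑ b ∈ Finset.range (D + 1), f a • (
        (creationInt g c (n + a + b) * creationInt g s (m - a + j)) *
          annihilationCoeff g c b (annihilationCoeff g s j v)) := by
    intro j hj
    rw [Finset.mem_range] at hj
    obtain ⟨N₁, hN₁⟩ := annihilationCoeff_eventually_zero g c
      (creationInt g s (m + j) * annihilationCoeff g s j v)
    rw [normalExp_apply g c n _ (N := max N₁ (P + (D + 1)))
      fun k hk => hN₁ k (le_trans (le_max_left _ _) hk)]
    have h2 : ∀ k : ℕ, creationInt g c (n + k) *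
        annihilationCoeff g c k (creationInt g s (m + j) * annihilationCoeff g s j v) =
        ∑ x ∈ antidiagonal k, f x.1 • (
        (creationInt g c (n + x.1 + x.2) * creationInt g s (m - x.1 + j)) *
          annihilationCoeff g c x.2 (annihilationCoeff g s j v)) := by
      intro k
      rw [annihilation_mul, Finset.mul_sum]
      refine Finset.sum_congr rfl fun x hx => ?_
      rw [annihilation_creationInt g hf, ← mem_antidiagonal.1 hx, smul_mul_assoc, mul_smul_comm,
        ← mul_assoc]
      push_cast
      rw [← add_assoc, sub_add_eq_add_sub]
    rw [Finset.sum_congr rfl fun k _ => h2 k]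
    refine sum_range_antidiagonal (fun a b => f a • (
        (creationInt g c (n + a + b) * creationInt g s (m - a + j)) *
          annihilationCoeff g c b (annihilationCoeff g s j v))) ?_ (le_max_right _ _)
    -- For `a ≥ P` the creation index `m - a + j` is negative, because `j ≤ D`; for `b > D` the
    -- annihilation part exceeds the weight of `v`.
    rintro a b (h | h)
    · rw [creationInt_neg g s (by omega), mul_zero, zero_mul, smul_zero]
    · rw [annihilation_annihilation_eq_zero hv c s (by omega), mul_zero, smul_zero]
  rw [Finset.sum_congr rfl h1, Finset.sum_comm]
  refine Finset.sum_congr rfl fun a _ => ?_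
  rw [orderedCoeff, Finset.smul_sum, Finset.sum_comm]
  exact Finset.sum_congr rfl fun b _ => by rw [Finset.smul_sum]

/-- The window `[-P, P)` need only contain all `b` with `n - b ≥ 0` and `m + b ≥ 0`. A fixed window
lets the sum over `b` be taken outside the sums over annihilation indices. -/
theorem creationInt_add_scale (c s : ModeFamily l) (x : KFrac) (n m : ℤ) {P : ℤ}
    (hP : n < P) (hP' : m ≤ P) :
    creationInt g (c + scaleFam x s) (n + m) =
      ∑ b ∈ Finset.Ico (-P) P, (x ^ (b + m)) •
        (creationInt g c (n - b) * creationInt g s (m + b)) := by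
  rcases lt_or_ge (n + m) 0 with h | h
  · rw [creationInt_neg g _ h]
    refine (Finset.sum_eq_zero fun b _ => ?_).symm
    rcases lt_or_ge (n - b) 0 with h1 | h1
    · rw [creationInt_neg g c h1, zero_mul, smul_zero]
    · rw [creationInt_neg g s (by omega), mul_zero, smul_zero]
  · obtain ⟨k, hk⟩ := Int.eq_ofNat_of_zero_le h
    rw [hk, creationInt_natCast, creation_add]
    refine Finset.sum_of_injOn (fun y : ℕ × ℕ => (y.2 : ℤ) - m) ?_ ?_ ?_ ?_
    · rintro ⟨a, b⟩ h1 ⟨a', b'⟩ h2 h3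
      simp [mem_antidiagonal] at h1 h2 h3
      ext <;> simp <;> omega
    · rintro ⟨a, b⟩ h1
      simp [mem_antidiagonal] at h1 ⊢
      omega
    · intro b _ h1
      rcases lt_or_ge (n - b) 0 with h2 | h2
      · rw [creationInt_neg g c h2, zero_mul, smul_zero]
      · rcases lt_or_ge (m + b) 0 with h3 | h3
        · rw [creationInt_neg g s h3, mul_zero, smul_zero]
        · refine absurd ⟨((n - b).toNat, (m + b).toNat), ?_, ?_⟩ h1
          · simp [mem_antidiagonal]; omega
          · simp; omega
    · rintro ⟨a, b⟩ h1
      rw [mem_antidiagonal] at h1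
      dsimp only at h1 ⊢
      rw [show n - (b - m) = (a : ℤ) by omega, show m + (b - m) = (b : ℤ) by omega,
        creationInt_natCast, creationInt_natCast, sub_add_cancel, creation_scale, zpow_natCast,
        mul_smul_comm]

/-- The value of the normally ordered product of two exponential fields at `w = xz`. -/
theorem normalExp_add_scale (hv : v ∈ weightLE l D) (c s : ModeFamily l) {x : KFrac} (hx : x ≠ 0)
    (n : ℤ) {P : ℤ} (hP : D < P) (hP' : n + D < P) :
    normalExp g (c + scaleFam x s) n v =
      ∑ b ∈ Finset.Ico (-P) P, x ^ b • orderedCoeff g c s v (D + 1) (n - b) b := by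
  rw [normalExp_apply g _ n v (N := (D + 1) + (D + 1))
    fun k hk => annihilation_eq_zero hv _ (by omega)]
  have h1 : ∀ k : ℕ, creationInt g (c + scaleFam x s) (n + k) *
      annihilationCoeff g (c + scaleFam x s) k v = ∑ y ∈ antidiagonal k,
        x⁻¹ ^ y.2 • (creationInt g (c + scaleFam x s) (n + y.1 + y.2) *
          annihilationCoeff g c y.1 (annihilationCoeff g s y.2 v)) := by
    intro k
    rw [annihilation_add, LinearMap.sum_apply, Finset.mul_sum]
    refine Finset.sum_congr rfl fun y hy => ?_
    rw [Module.End.mul_apply, annihilation_scale, LinearMap.smul_apply, map_smul, mul_smul_comm,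
      ← mem_antidiagonal.1 hy]
    push_cast
    rw [← add_assoc]
  rw [Finset.sum_congr rfl fun k _ => h1 k,
    sum_range_antidiagonal (fun a b => x⁻¹ ^ b • (creationInt g (c + scaleFam x s) (n + a + b) *
          annihilationCoeff g c a (annihilationCoeff g s b v))) (P := D + 1) (Q := D + 1) _ le_rfl]
  · simp only [orderedCoeff, Finset.smul_sum]
    rw [Finset.sum_comm]
    conv_rhs => rw [Finset.sum_comm]
    rw [Finset.sum_comm]
    refine Finset.sum_congr rfl fun a ha => ?_
    conv_rhs => rw [Finset.sum_comm]
    refine Finset.sum_congr rfl fun b hb => ?_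
    rw [Finset.mem_range] at ha hb
    rw [creationInt_add_scale c s x (n + a) b (P := P) (by omega) (by omega), Finset.sum_mul,
      Finset.smul_sum]
    refine Finset.sum_congr rfl fun d _ => ?_
    rw [smul_mul_assoc, smul_smul, zpow_add₀ hx, zpow_natCast, inv_pow, mul_comm (x ^ d),
      inv_mul_cancel_left₀ (pow_ne_zero _ hx), show n + (a : ℤ) - d = n - d + a by ring,
      add_comm (b : ℤ)]
  · rintro a b h
    rw [annihilation_annihilation_eq_zero hv c s (by omega), mul_zero, smul_zero]

/-- The commutator of two exponential fields whose operator product expansion has only simple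
poles, at `w = x_e z`; the constant `κ` accounts for the zero modes. -/
theorem normalExp_commutator {ι : Type*} (X : Finset ι) (R x : ι → KFrac) (hx : ∀ e, x e ≠ 0)
    {c s : ModeFamily l} {f f' : ℕ → KFrac} {κ : KFrac}
    (hf : IsExp (PowerSeries.mk fun m => bracket g c s m) (PowerSeries.mk f))
    (hf' : IsExp (PowerSeries.mk fun m => bracket g s c m) (PowerSeries.mk f'))
    (h0 : κ * f 0 = 1 + ∑ e ∈ X, R e)
    (h1 : ∀ p, 1 ≤ p → κ * f p = ∑ e ∈ X, R e * x e ^ (-(p : ℤ)))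
    (h2 : ∀ p, 1 ≤ p → f' p = -∑ e ∈ X, R e * x e ^ (p : ℤ)) (n : ℤ) (v : Fock l) :
    κ • normalExp g c n (normalExp g s (-1) v) - normalExp g s (-1) (normalExp g c n v) =
      ∑ e ∈ X, (R e * x e) • normalExp g (c + scaleFam (x e) s) (n - 1) v := by
  obtain ⟨D, hv⟩ := exists_mem_weightLE v
  set P : ℕ := D + n.natAbs + 5 with hP
  set G := orderedCoeff g c s v (D + 1) with hG
  have hf'0 : f' 0 = 1 := by simpa using hf'.coeff_zero
  have e1 := normalExp_normalExp hv hf n (-1) (P := P) (by omega)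
  have e2 := normalExp_normalExp hv hf' (-1) n (P := P) (by omega)
  simp only [orderedCoeff_swap g c s] at e2
  rw [e1, e2]
  have e3 : ∀ e, (R e * x e) • normalExp g (c + scaleFam (x e) s) (n - 1) v =
      ∑ p ∈ Finset.range P, (R e * x e ^ (-(p : ℤ))) • G (n + p) (-1 - p) +
      ∑ p ∈ Finset.range P, (R e * x e ^ ((p : ℤ) + 1)) • G (n - (p + 1)) (-1 + (p + 1)) := by
    intro e
    rw [normalExp_add_scale hv c s (hx e) (n - 1) (P := P) (by omega) (by omega)]
    -- The delta function at `w = x_e z` is split into its negative and its nonnegative powers of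
    -- `w`. The first half matches the expansion of the product with the current on the right, the
    -- second that with the current on the left.
    have : Finset.Ico (-(P : ℤ)) P = (Finset.range P).image (fun p : ℕ => -1 - (p : ℤ)) ∪
        (Finset.range P).image (fun p : ℕ => (p : ℤ)) := by
      ext b
      simp only [Finset.mem_Ico, Finset.mem_union, Finset.mem_image, Finset.mem_range]
      constructor
      · intro h
        rcases lt_or_ge b 0 with hb | hb
        · exact Or.inl ⟨(-1 - b).toNat, by omega, by omega⟩
        · exact Or.inr ⟨b.toNat, by omega, by omega⟩
      · rintro (⟨p, h, rfl⟩ | ⟨p, h, rfl⟩) <;> omega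
    rw [this, Finset.sum_union, Finset.sum_image, Finset.sum_image, smul_add, Finset.smul_sum,
      Finset.smul_sum]
    · congr 1
      · refine Finset.sum_congr rfl fun p _ => ?_
        rw [smul_smul, mul_assoc, ← zpow_one_add₀ (hx e),
          show n - 1 - (-1 - (p : ℤ)) = n + p by ring, show 1 + (-1 - (p : ℤ)) = -p by ring]
      · refine Finset.sum_congr rfl fun p _ => ?_
        rw [smul_smul, mul_assoc, ← zpow_one_add₀ (hx e), add_comm 1 (p : ℤ),
          show n - 1 - (p : ℤ) = n - (p + 1) by ring, show -1 + ((p : ℤ) + 1) = p by ring]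
    · intro a _ b _ h; simpa using h
    · intro a _ b _ h; simpa using h
    · rw [Finset.disjoint_left]
      intro b hb hb'
      simp only [Finset.mem_image] at hb hb'
      obtain ⟨p, _, rfl⟩ := hb
      obtain ⟨p', _, h⟩ := hb'
      omega
  rw [Finset.sum_congr rfl fun e _ => e3 e, Finset.sum_add_distrib, Finset.sum_comm,
    Finset.sum_comm (s := X)]
  simp only [← Finset.sum_smul]
  have e4 : ∑ p ∈ Finset.range P, f' p • G (n - p) (-1 + p) = G n (-1) -
      ∑ p ∈ Finset.range P, (∑ e ∈ X, R e * x e ^ ((p : ℤ) + 1)) •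
        G (n - (p + 1)) (-1 + (p + 1)) := by
    -- The term with `p = P` is zero for reasons of weight, so the sum may be extended by it and
    -- then reindexed from `p + 1`.
    have h3 : G (n - P) (-1 + P) = 0 := orderedCoeff_eq_zero g c s v (Or.inl (by omega))
    have := Finset.sum_range_succ (fun p : ℕ => f' p • G (n - p) (-1 + p)) P
    rw [h3, smul_zero, add_zero, Finset.sum_range_succ'] at this
    rw [← this, hf'0, one_smul, Nat.cast_zero, sub_zero, add_zero, add_comm, sub_eq_add_neg,
      ← Finset.sum_neg_distrib]
    congr 1
    refine Finset.sum_congr rfl fun p _ => ?_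
    rw [h2 _ (by omega)]
    push_cast
    rw [neg_smul]
  have e5 : κ • ∑ p ∈ Finset.range P, f p • G (n + p) (-1 - p) = G n (-1) +
      ∑ p ∈ Finset.range P, (∑ e ∈ X, R e * x e ^ (-(p : ℤ))) • G (n + p) (-1 - p) := by
    have h3 : ∀ p : ℕ, κ * f p = (if p = 0 then 1 else 0) + ∑ e ∈ X, R e * x e ^ (-(p : ℤ)) := by
      intro p
      rcases Nat.eq_zero_or_pos p with rfl | hp
      · simp [h0]
      · rw [h1 p hp, if_neg hp.ne', zero_add]
    rw [Finset.smul_sum]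
    simp only [smul_smul, h3, add_smul, Finset.sum_add_distrib, ite_smul, one_smul, zero_smul]
    rw [Finset.sum_ite_eq' (Finset.range P) 0 fun p : ℕ => G (n + p) (-1 - p),
      if_pos (Finset.mem_range.2 (by omega)), Nat.cast_zero, add_zero, sub_zero]
  -- The value `1` of the rational function at `∞`, which is the constant in its partial fractions,
  -- contributes `G n (-1)` to both products and cancels.
  rw [e4, e5]
  exact add_sub_sub_cancel_left _ _ _

end NormalOrdering

end
end DeformedW

namespace DeformedW
noncomputable section
open PowerSeries Finset.HasAntidiagonal

/-! ### The elements `q ^ m t ^ n` -/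

theorem qPow_add (a b : PowerSeries ℂ) : qPow (a + b) = qPow a * qPow b :=
  (PowerSeries.exp_mul_exp_eq_exp_add a b).symm

theorem qPow_zero : qPow 0 = 1 := by
  simp [qPow]

theorem coeff_one_qPow (a : PowerSeries ℂ) : coeff 1 (qPow a) = a := by
  simp [qPow, coeff_rescale, coeff_exp]

theorem qPow_eq_one_iff (a : PowerSeries ℂ) : qPow a = 1 ↔ a = 0 := by
  refine ⟨fun h => ?_, fun h => by rw [h, qPow_zero]⟩
  rw [← coeff_one_qPow a, h]
  simp [coeff_one]

/-- `q ^ a` in the fraction field. -/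
def qPowF (a : PowerSeries ℂ) : KFrac := algebraMap KRing KFrac (qPow a)

theorem qPowF_add (a b : PowerSeries ℂ) : qPowF (a + b) = qPowF a * qPowF b := by
  simp [qPowF, qPow_add]

theorem qPowF_zero : qPowF 0 = 1 := by simp [qPowF, qPow_zero]

theorem qPowF_ne_zero (a : PowerSeries ℂ) : qPowF a ≠ 0 := by
  intro h
  have := qPowF_add a (-a)
  rw [h, zero_mul, add_neg_cancel, qPowF_zero] at this
  exact one_ne_zero this

theorem qPowF_neg (a : PowerSeries ℂ) : qPowF (-a) = (qPowF a)⁻¹ := by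
  refine eq_inv_of_mul_eq_one_left ?_
  rw [← qPowF_add, neg_add_cancel, qPowF_zero]

theorem qPowF_zsmul (n : ℤ) (a : PowerSeries ℂ) : qPowF (n • a) = qPowF a ^ n := by
  have hnat : ∀ k : ℕ, qPowF (k • a) = qPowF a ^ k := by
    intro k
    induction k with
    | zero => simp [qPowF_zero]
    | succ k ih => rw [succ_nsmul, qPowF_add, ih, pow_succ]
  cases n with
  | ofNat k => simpa using hnat k
  | negSucc k => rw [negSucc_zsmul, qPowF_neg, hnat, zpow_negSucc]

theorem qPowF_eq_one_iff (a : PowerSeries ℂ) : qPowF a = 1 ↔ a = 0 := by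
  rw [← qPow_eq_one_iff, qPowF, ← map_one (algebraMap KRing KFrac)]
  exact (IsFractionRing.injective KRing KFrac).eq_iff

theorem q_ne_zero : q ≠ 0 := qPowF_ne_zero 1

theorem t_ne_zero : t ≠ 0 := qPowF_ne_zero betaVar

theorem q_zpow_mul_t_zpow (m n : ℤ) : q ^ m * t ^ n = qPowF (m • 1 + n • betaVar) := by
  rw [qPowF_add, qPowF_zsmul, qPowF_zsmul]; rfl

theorem zsmul_one_add_zsmul_beta_eq_zero_iff (m n : ℤ) :
    (m • 1 + n • betaVar : PowerSeries ℂ) = 0 ↔ m = 0 ∧ n = 0 := by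
  refine ⟨fun h => ?_, by rintro ⟨rfl, rfl⟩; simp⟩
  have h0 := congrArg (coeff 0) h
  have h1 := congrArg (coeff 1) h
  simp only [map_add, map_zsmul, betaVar, coeff_one, coeff_X] at h0 h1
  simpa using And.intro h0 h1

theorem q_zpow_mul_t_zpow_eq_one_iff (m n : ℤ) : q ^ m * t ^ n = 1 ↔ m = 0 ∧ n = 0 := by
  rw [q_zpow_mul_t_zpow, qPowF_eq_one_iff, zsmul_one_add_zsmul_beta_eq_zero_iff]

theorem q_zpow_mul_t_zpow_inj {m n m' n' : ℤ} :
    q ^ m * t ^ n = q ^ m' * t ^ n' ↔ m = m' ∧ n = n' := by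
  have h : q ^ (m - m') * t ^ (n - n') = 1 ↔ q ^ m * t ^ n = q ^ m' * t ^ n' := by
    rw [zpow_sub₀ q_ne_zero, zpow_sub₀ t_ne_zero, div_mul_div_comm, div_eq_one_iff_eq]
    exact mul_ne_zero (zpow_ne_zero _ q_ne_zero) (zpow_ne_zero _ t_ne_zero)
  rw [← h, q_zpow_mul_t_zpow_eq_one_iff, sub_eq_zero, sub_eq_zero]

theorem q_zpow_mul_t_zpow_ne_neg_one (m n : ℤ) : q ^ m * t ^ n ≠ -1 := by
  intro h
  have h2 : q ^ (2 * m) * t ^ (2 * n) = 1 := by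
    rw [mul_comm 2 m, mul_comm 2 n, zpow_mul, zpow_mul, ← mul_zpow, h]; norm_num
  obtain ⟨h3, h4⟩ := (q_zpow_mul_t_zpow_eq_one_iff _ _).1 h2
  have h5 : m = 0 := by omega
  have h6 : n = 0 := by omega
  subst h5 h6
  norm_num at h

theorem spec_val_one (m n : ℤ) : Spec.val (1, m, n) = q ^ m * t ^ n := by
  simp [Spec.val]

/-! ### Integrality of the coefficients -/

/-- Indeed `exp (ha) - 1 = ha ∑ (ha)^n / (n + 1)!`, and the last series has constant term `1`.
Questions of divisibility between such differences thus reduce to the exponents `a` in `ℂ[[β]]`. -/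
theorem exists_qPow_sub_one (a : PowerSeries ℂ) :
    ∃ u : KRingˣ, qPow a - 1 = X * PowerSeries.C a * (u : KRing) := by
  let f : KRing := PowerSeries.mk fun n => algebraMap ℚ (PowerSeries ℂ) ((n + 1).factorial : ℚ)⁻¹ * a ^ n
  have hf : IsUnit f := by
    rw [PowerSeries.isUnit_iff_constantCoeff]
    simp [f]
  refine ⟨hf.unit, ?_⟩
  ext1 n
  rw [IsUnit.unit_spec, mul_assoc]
  cases n with
  | zero =>
    rw [map_sub, qPow, coeff_rescale, coeff_exp]
    simp
  | succ n =>
    rw [coeff_succ_X_mul, coeff_C_mul, map_sub, qPow, coeff_rescale, coeff_exp, coeff_mk,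
      coeff_one, if_neg n.succ_ne_zero, sub_zero, pow_succ, one_div]
    ring

/-- The factor of a coefficient contributed by a pair of boxes `k`, `2 l - k + 1`. -/
def pairFactor (n : ℤ) : KFrac :=
  ((1 - q ^ (2 - 2 * n) * t ^ (2 * n - 2)) * (1 - q ^ (4 - 2 * n) * t ^ (2 * n))) /
    ((1 - q ^ (4 - 2 * n) * t ^ (2 * n - 2)) * (1 - q ^ (2 - 2 * n) * t ^ (2 * n)))

theorem one_sub_qt_ne_zero {m n : ℤ} (h : ¬(m = 0 ∧ n = 0)) : 1 - q ^ m * t ^ n ≠ 0 := fun h0 =>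
  h ((q_zpow_mul_t_zpow_eq_one_iff m n).1 (sub_eq_zero.1 h0).symm)

theorem pairFactor_ne_zero {n : ℤ} (hn : n ≠ 1) : pairFactor n ≠ 0 := by
  refine div_ne_zero (mul_ne_zero ?_ ?_) (mul_ne_zero ?_ ?_) <;>
    exact one_sub_qt_ne_zero (by omega)

theorem isUnit_linear {m : ℤ} (hm : m ≠ 0) (n : ℤ) :
    IsUnit (m • 1 + n • betaVar : PowerSeries ℂ) := by
  rw [PowerSeries.isUnit_iff_constantCoeff]
  simpa [betaVar] using hm

theorem mul_units_cancel {A : Type*} [CommRing A] (x : A) {r g₁ g₂ g₃ g₄ : A}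
    (h : r * (g₃ * g₄) = g₁ * g₂) (u₁ u₂ u₃ u₄ : Aˣ) :
    r * (u₁ : A) * (u₂ : A) * ↑u₃⁻¹ * ↑u₄⁻¹ * (x * g₃ * (u₃ : A) * (x * g₄ * (u₄ : A))) =
      x * g₁ * (u₁ : A) * (x * g₂ * (u₂ : A)) := by
  calc _ = x * x * (r * (g₃ * g₄)) * u₁ * u₂ * (↑u₃⁻¹ * (u₃ : A)) * (↑u₄⁻¹ * (u₄ : A)) := by ring
    _ = _ := by rw [h, Units.inv_mul, Units.inv_mul]; ring

/-- Every factor of numerator and denominator is `h` times a linear form `m + kβ` times a unit. The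
powers of `h` cancel, and `m + kβ` is a unit of `ℂ[[β]]` unless `m = 0`, so only `n = 1` and `n = 2`
need attention. -/
theorem exists_pairFactor (n : ℤ) : ∃ w : KRing, algebraMap KRing KFrac w = pairFactor n := by
  obtain ⟨u₁, h₁⟩ := exists_qPow_sub_one ((2 - 2 * n) • 1 + (2 * n - 2) • betaVar)
  obtain ⟨u₂, h₂⟩ := exists_qPow_sub_one ((4 - 2 * n) • 1 + (2 * n) • betaVar)
  obtain ⟨u₃, h₃⟩ := exists_qPow_sub_one ((4 - 2 * n) • 1 + (2 * n - 2) • betaVar)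
  obtain ⟨u₄, h₄⟩ := exists_qPow_sub_one ((2 - 2 * n) • 1 + (2 * n) • betaVar)
  obtain ⟨r, hr⟩ : ∃ r : PowerSeries ℂ,
      r * (((4 - 2 * n) • 1 + (2 * n - 2) • betaVar) * ((2 - 2 * n) • 1 + (2 * n) • betaVar)) =
      ((2 - 2 * n) • 1 + (2 * n - 2) • betaVar) * ((4 - 2 * n) • 1 + (2 * n) • betaVar) := by
    by_cases h1 : n = 1
    -- Here the linear form with `m = k = 0` occurs in the numerator.
    · exact ⟨0, by subst h1; simp⟩
    -- Here `4 - 2n = 0` both above and below; `4β / 2β = 2` leaves `2 (-2 + 2β) / (-2 + 4β)`, whose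
    -- denominator is a unit.
    by_cases h2 : n = 2
    · subst h2
      obtain ⟨v, hv⟩ := isUnit_linear (m := -2) (by norm_num) 4
      refine ⟨2 * ((-2 : ℤ) • 1 + (2 : ℤ) • betaVar) * ↑v⁻¹, ?_⟩
      norm_num only
      rw [← hv]
      simp only [zsmul_eq_mul]
      push_cast
      linear_combination (-2 + 2 * betaVar) * (4 * betaVar) * v.inv_mul
    · have h3 := (isUnit_linear (m := 4 - 2 * n) (by omega) (2 * n - 2)).mul
        (isUnit_linear (m := 2 - 2 * n) (by omega) (2 * n))
      obtain ⟨v, hv⟩ := h3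
      refine ⟨((2 - 2 * n) • 1 + (2 * n - 2) • betaVar) * ((4 - 2 * n) • 1 + (2 * n) • betaVar) *
        ↑v⁻¹, ?_⟩
      rw [← hv, mul_assoc, Units.inv_mul, mul_one]
  have e : ∀ m k : ℤ, 1 - q ^ m * t ^ k =
      -algebraMap KRing KFrac (qPow (m • 1 + k • betaVar) - 1) := by
    intro m k
    rw [q_zpow_mul_t_zpow, qPowF, map_sub, map_one]; ring
  refine ⟨PowerSeries.C r * (u₁ : KRing) * (u₂ : KRing) * ↑u₃⁻¹ * ↑u₄⁻¹, ?_⟩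
  rw [pairFactor, eq_div_iff (mul_ne_zero (one_sub_qt_ne_zero (by omega))
    (one_sub_qt_ne_zero (by omega))), e, e, e, e, neg_mul_neg, neg_mul_neg, ← map_mul, ← map_mul,
    ← map_mul, h₁, h₂, h₃, h₄]
  have hr' := congrArg (PowerSeries.C (R := PowerSeries ℂ)) hr
  rw [map_mul, map_mul, map_mul] at hr'
  exact congrArg (algebraMap KRing KFrac) (mul_units_cancel (X : KRing) hr' u₁ u₂ u₃ u₄)

end
end DeformedW

namespace DeformedW
noncomputable section
open PowerSeries Finset.HasAntidiagonal

/-! ### Cartan matrices of type `C` -/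

section Cartan

theorem sum_fin_ite_val {F : Type*} [AddCommMonoid F] {l : ℕ} (k : ℕ) (w : Fin l → F) :
    ∑ j : Fin l, (if (j : ℕ) = k then w j else 0) = if h : k < l then w ⟨k, h⟩ else 0 := by
  split_ifs with h
  · rw [Finset.sum_eq_single (⟨k, h⟩ : Fin l)]
    · simp
    · intro b _ hb
      rw [if_neg]
      rintro rfl
      exact hb rfl
    · simp
  · exact Finset.sum_eq_zero fun j _ => if_neg (by omega)

/-- A kernel vector `V` is determined by `V 0`: the upper rows are the three-term recursion of `u`,
so `V k = u (k + 1) V 0` before the last entry. The last two rows give `s V (l - 1) = u l V 0` and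
`e V (l - 1) = u (l - 1) V 0`, which forces `V 0 = 0` unless `e * u l = s * u (l - 1)`. The same
computation serves the Cartan matrix and its deformation. -/
theorem det_ne_zero_of_typeC {F : Type*} [Field F] {l : ℕ} (hl : 2 ≤ l)
    {M : Matrix (Fin l) (Fin l) F} {c e s : F} {u : ℕ → F} (hs : s ≠ 0)
    (hM : ∀ i j, M i j = if j = i then (if (i : ℕ) + 1 = l then e else c)
      else if (j : ℕ) = i + 1 then (if (j : ℕ) + 1 = l then -s else -1)
      else if (j : ℕ) + 1 = i then -1 else 0)
    (hu0 : u 0 = 0) (hu1 : u 1 = 1) (hu : ∀ k, u (k + 2) = c * u (k + 1) - u k)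
    (h : e * u l ≠ s * u (l - 1)) : M.det ≠ 0 := by
  intro hdet
  obtain ⟨v, hv0, hv⟩ := Matrix.exists_mulVec_eq_zero_iff.2 hdet
  let V : ℕ → F := fun k => if h : k < l then v ⟨k, h⟩ else 0
  have hrow : ∀ i : Fin l, (if (i : ℕ) + 1 = l then e else c) * V i -
      (if (i : ℕ) + 2 = l then s else 1) * V (i + 1) - (if (i : ℕ) = 0 then 0 else V (i - 1)) = 0 := by
    intro i
    have h1 := congrFun hv i
    rw [Matrix.mulVec, dotProduct] at h1
    have h2 : ∀ j, M i j * v j =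
        (if (j : ℕ) = i then (if (i : ℕ) + 1 = l then e else c) * v j else 0) -
        (if (j : ℕ) = i + 1 then (if (i : ℕ) + 2 = l then s else 1) * v j else 0) -
        (if (i : ℕ) = 0 then 0 else if (j : ℕ) = i - 1 then v j else 0) := by
      intro j
      rw [hM]
      simp only [Fin.ext_iff]
      split_ifs <;> first | omega | ring
    rw [Finset.sum_congr rfl fun j _ => h2 j, Finset.sum_sub_distrib, Finset.sum_sub_distrib,
      sum_fin_ite_val, sum_fin_ite_val] at h1
    rw [Pi.zero_apply] at h1
    refine Eq.trans ?_ h1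
    congr 1
    · congr 1
      · simp [V]
      · simp only [V]; split_ifs <;> simp
    · by_cases h0 : (i : ℕ) = 0
      · simp [h0]
      · simp only [h0, if_false]
        rw [sum_fin_ite_val]
  have hVu : ∀ k, k + 1 < l → V k = u (k + 1) * V 0 := by
    intro k
    induction k using Nat.strong_induction_on with
    | _ k ih =>
      intro hk
      match k, ih, hk with
      | 0, _, _ => rw [hu1, one_mul]
      | 1, ih, hk =>
        have := hrow ⟨0, by omega⟩
        simp only [Nat.zero_add, if_true, sub_zero] at this
        rw [if_neg (by omega), if_neg (by omega), one_mul] at this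
        rw [hu, hu1, hu0]
        linear_combination -this
      | k + 2, ih, hk =>
        have := hrow ⟨k + 1, by omega⟩
        simp only [Nat.add_sub_cancel] at this
        rw [if_neg (by omega), if_neg (by omega), if_neg (by omega), one_mul,
          ih (k + 1) (by omega) (by omega), ih k (by omega) (by omega)] at this
        rw [hu (k + 1)]
        linear_combination -this
  obtain ⟨n, rfl⟩ : ∃ n, l = n + 2 := ⟨l - 2, by omega⟩
  have hs1 : s * V (n + 1) = u (n + 2) * V 0 := by
    have := hrow ⟨n, by omega⟩
    dsimp only at this
    rw [if_neg (by omega), if_pos rfl, hVu n (by omega)] at this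
    rw [hu]
    rcases Nat.eq_zero_or_pos n with rfl | hn
    · rw [if_pos rfl] at this
      rw [hu0]
      linear_combination -this
    · rw [if_neg (by omega), hVu (n - 1) (by omega), Nat.sub_add_cancel hn] at this
      linear_combination -this
  have he : e * V (n + 1) = V n := by
    have := hrow ⟨n + 1, by omega⟩
    have hz : V (n + 1 + 1) = 0 := dif_neg (by omega)
    dsimp only at this
    rw [if_pos rfl, if_neg (Nat.succ_ne_zero n), hz, Nat.add_sub_cancel, mul_zero, sub_zero] at this
    linear_combination this
  have h0 : V 0 = 0 := by
    by_contra hne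
    refine h (mul_right_cancel₀ hne ?_)
    rw [mul_assoc, ← hs1, mul_left_comm, he, hVu n (by omega), mul_assoc]
    rfl
  refine hv0 (funext fun i => ?_)
  have hVi : V i = v i := dif_pos i.2
  rw [← hVi, Pi.zero_apply]
  by_cases hi : (i : ℕ) + 1 < n + 2
  · rw [hVu _ hi, h0, mul_zero]
  · rw [show (i : ℕ) = n + 1 by omega]
    rw [h0, mul_zero] at hs1
    exact (mul_eq_zero.1 hs1).resolve_left hs

theorem typeC_A {l : ℕ} (i j : Fin l) : (typeC l).A i j =
    if j = i then 2 else if (j : ℕ) = i + 1 then (if (j : ℕ) + 1 = l then -2 else -1)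
      else if (j : ℕ) + 1 = i then -1 else 0 := by
  simp only [typeC, Matrix.transpose_apply, CartanMatrix.C, Matrix.of_apply]
  split_ifs <;> first | rfl | omega

theorem typeC_d {l : ℕ} (i : Fin l) : (typeC l).d i = if (i : ℕ) + 1 = l then 2 else 1 := rfl

theorem typeC_d_pos {l : ℕ} (i : Fin l) : 0 < (typeC l).d i := by
  rw [typeC_d]; split_ifs <;> omega

theorem typeC_incidence {l : ℕ} (i j : Fin l) : incidence (typeC l) i j =
    if j = i then 0 else if (j : ℕ) = i + 1 then (if (j : ℕ) + 1 = l then 2 else 1)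
      else if (j : ℕ) + 1 = i then 1 else 0 := by
  rw [incidence, typeC_A]
  simp only [eq_comm (a := i)]
  split_ifs <;> rfl

theorem isUnit_det_cartan {l : ℕ} (hl : 2 ≤ l) :
    IsUnit ((typeC l).A.map (Int.cast : ℤ → ℂ)).det := by
  rw [isUnit_iff_ne_zero]
  refine det_ne_zero_of_typeC hl (c := 2) (e := 2) (s := 2) (u := fun k => k) two_ne_zero ?_
    (by simp) (by simp) (by intro k; push_cast; ring) ?_
  · intro i j
    rw [Matrix.map_apply, typeC_A]
    split_ifs <;> simp
  · intro h
    have h1 : (l : ℂ) = ((l - 1 : ℕ) : ℂ) := mul_left_cancel₀ two_ne_zero h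
    have h2 : l = l - 1 := by exact_mod_cast h1
    omega

theorem qInt_zero (x : KFrac) : qInt x 0 = 0 := by simp [qInt]

theorem qInt_one {x : KFrac} (hx : x ^ 2 ≠ 1) (h0 : x ≠ 0) : qInt x 1 = 1 := by
  have : x - x⁻¹ ≠ 0 := by
    intro h
    apply hx
    field_simp at h
    linear_combination h
  rw [qInt, zpow_one, zpow_neg_one, div_self this]

theorem qInt_two {x : KFrac} (hx : x ^ 2 ≠ 1) (h0 : x ≠ 0) : qInt x 2 = x + x⁻¹ := by
  have : x - x⁻¹ ≠ 0 := by
    intro h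
    apply hx
    field_simp at h
    linear_combination h
  rw [qInt, div_eq_iff this, zpow_neg, show (2 : ℤ) = ((2 : ℕ) : ℤ) by rfl, zpow_natCast]
  ring

/-- With `p = y / x` the diagonal entry away from the last node is `p + p⁻¹`, and the recursion is
solved by `u k = (p^k - p^{-k}) / (p - p⁻¹)`. The numerator of the remaining condition factors as
`(p - p⁻¹) (x⁻¹ p^l + x p^{-l})`. -/
theorem isUnit_det_defCartan {l : ℕ} (hl : 2 ≤ l) {x y : KFrac} (hx0 : x ≠ 0) (hy0 : y ≠ 0)
    (hx : x ^ 2 ≠ 1) (hx' : x + x⁻¹ ≠ 0) (hp : (y / x) ^ 2 ≠ 1)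
    (hxy : x⁻¹ * (y / x) ^ l + x * ((y / x) ^ l)⁻¹ ≠ 0) :
    IsUnit (defCartan (typeC l) x y).det := by
  rw [isUnit_iff_ne_zero]
  set p := y / x with hpdef
  have hp0 : p ≠ 0 := div_ne_zero hy0 hx0
  have hp1 : p - p⁻¹ ≠ 0 := by
    intro h
    apply hp
    field_simp at h
    linear_combination h
  have hy : y = p * x := by rw [hpdef, div_mul_cancel₀ _ hx0]
  refine det_ne_zero_of_typeC hl (c := x * y⁻¹ + x⁻¹ * y) (e := x ^ 2 * y⁻¹ + (x ^ 2)⁻¹ * y)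
    (s := x + x⁻¹) (u := fun k => (p ^ k - (p ^ k)⁻¹) / (p - p⁻¹)) hx' ?_ (by simp) ?_ ?_ ?_
  · intro i j
    rw [defCartan, Matrix.of_apply, typeC_incidence, typeC_d]
    simp only [eq_comm (a := i)]
    split_ifs <;> simp [qInt_zero, qInt_one hx hx0, qInt_two hx hx0, zpow_neg]
  · simp only [pow_one]; exact div_self hp1
  · intro k
    rw [div_eq_iff hp1, sub_mul, mul_assoc, div_mul_cancel₀ _ hp1, div_mul_cancel₀ _ hp1, hy]
    field_simp
    ring
  · obtain ⟨n, rfl⟩ : ∃ n, l = n + 1 := ⟨l - 1, by omega⟩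
    intro h
    simp only [Nat.add_sub_cancel] at h
    rw [mul_div_assoc', mul_div_assoc', div_left_inj' hp1] at h
    apply hxy
    have h2 : (p - p⁻¹) * (x⁻¹ * p ^ (n + 1) + x * (p ^ (n + 1))⁻¹) =
        (x ^ 2 * y⁻¹ + (x ^ 2)⁻¹ * y) * (p ^ (n + 1) - (p ^ (n + 1))⁻¹) -
          (x + x⁻¹) * (p ^ n - (p ^ n)⁻¹) := by
      rw [hy]
      field_simp
      ring
    rw [h, sub_self] at h2
    exact (mul_eq_zero.1 h2).resolve_left hp1

theorem isUnit_det_defCartan_zpow {l : ℕ} (hl : 2 ≤ l) {m : ℤ} (hm : m ≠ 0) :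
    IsUnit (defCartan (typeC l) (q ^ m) (t ^ m)).det := by
  have hq : (q ^ m) ≠ 0 := zpow_ne_zero _ q_ne_zero
  have ht : (t ^ m) ≠ 0 := zpow_ne_zero _ t_ne_zero
  have e1 : (t ^ m / q ^ m) = q ^ (-m) * t ^ m := by rw [zpow_neg]; field_simp
  refine isUnit_det_defCartan hl hq ht ?_ ?_ ?_ ?_
  · intro h
    have := (q_zpow_mul_t_zpow_eq_one_iff (m * 2) 0).1 (by rw [zpow_mul]; simpa using h)
    omega
  · intro h
    refine q_zpow_mul_t_zpow_ne_neg_one (2 * m) 0 ?_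
    rw [zpow_zero, mul_one, two_mul, zpow_add₀ q_ne_zero]
    field_simp at h
    linear_combination h
  · intro h
    rw [e1, mul_pow, ← zpow_natCast, ← zpow_natCast, ← zpow_mul, ← zpow_mul,
      q_zpow_mul_t_zpow_eq_one_iff] at h
    omega
  · rw [e1]
    intro h
    -- If the sum of the two terms vanished, their quotient, a monomial in `q` and `t`, would be
    -- `-1`.
    refine q_zpow_mul_t_zpow_ne_neg_one (-2 * m * l - 2 * m) (2 * m * l) ?_
    have e2 : (q ^ (-m) * t ^ m) ^ l ≠ 0 :=
      pow_ne_zero _ (mul_ne_zero (zpow_ne_zero _ q_ne_zero) ht)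
    have e3 : q ^ (-2 * m * l - 2 * m) * t ^ (2 * m * l) =
        (q ^ (-m) * t ^ m) ^ l * (q ^ (-m) * t ^ m) ^ l * (q ^ m)⁻¹ * (q ^ m)⁻¹ := by
      rw [show -2 * m * (l : ℤ) - 2 * m = -m * l + -m * l + -m + -m by ring,
        show 2 * m * (l : ℤ) = m * l + m * l by ring, zpow_add₀ q_ne_zero, zpow_add₀ q_ne_zero,
        zpow_add₀ q_ne_zero, zpow_add₀ t_ne_zero, zpow_mul, zpow_mul, mul_pow, ← zpow_neg,
        zpow_natCast, zpow_natCast]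
      ring
    rw [e3]
    field_simp at h
    field_simp
    linear_combination h

end Cartan

end
end DeformedW

namespace DeformedW
noncomputable section
open PowerSeries Finset.HasAntidiagonal

/-! ### Commutators of the generators -/

section Brackets

theorem sub_div_neg {F : Type*} [Field F] (a b c : F) : (a - b) / -c = (b - a) / c := by
  rw [div_neg, ← neg_div, neg_sub]

theorem sub_div_sub_swap {F : Type*} [Field F] (a b c d : F) :
    (a - b) / (c - d) = (b - a) / (d - c) := by
  rw [← neg_sub b, ← neg_sub d, neg_div_neg_eq]

theorem bracket_add_left {l : ℕ} (g : CartanData l) (c c' s : ModeFamily l) (m : ℤ) :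
    bracket g (c + c') s m = bracket g c s m + bracket g c' s m := by
  simp [bracket, add_mul, Finset.sum_add_distrib]

theorem bracket_add_right {l : ℕ} (g : CartanData l) (c c' s : ModeFamily l) (m : ℤ) :
    bracket g s (c + c') m = bracket g s c m + bracket g s c' m := by
  simp [bracket, mul_add, add_mul, Finset.sum_add_distrib]

theorem bracket_smul_left {l : ℕ} (g : CartanData l) (f : ℤ → KFrac) (c s : ModeFamily l) (m : ℤ) :
    bracket g (fun m => f m • c m) s m = f m * bracket g c s m := by
  simp [bracket, Finset.mul_sum, mul_assoc]

theorem bracket_smul_right {l : ℕ} (g : CartanData l) (f : ℤ → KFrac) (c s : ModeFamily l) (m : ℤ) :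
    bracket g s (fun m => f m • c m) m = f (-m) * bracket g s c m := by
  simp [bracket, Finset.mul_sum, mul_assoc, mul_left_comm]

variable {l : ℕ}

theorem typeC_d_mul_incidence (i j : Fin l) {x : KFrac} (hx : x ^ 2 ≠ 1) (h0 : x ≠ 0) :
    qInt x ((typeC l).d i) * qInt x (incidence (typeC l) i j) =
      qInt x ((typeC l).d j) * qInt x (incidence (typeC l) j i) := by
  rw [typeC_incidence, typeC_incidence, typeC_d, typeC_d]
  have := i.2
  have := j.2
  simp only [Fin.ext_iff]
  split_ifs <;> first | omega | simp [qInt_zero, qInt_one hx h0]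

theorem defSymCartan_symm (i j : Fin l) {x : KFrac} (hx : x ^ 2 ≠ 1) (h0 : x ≠ 0) (y : KFrac) :
    defSymCartan (typeC l) x y i j = defSymCartan (typeC l) x y j i := by
  simp only [defSymCartan, defCartan, Matrix.of_apply, mul_sub]
  rw [typeC_d_mul_incidence i j hx h0]
  by_cases h : i = j
  · subst h; rfl
  · rw [if_neg h, if_neg (Ne.symm h), mul_zero, mul_zero]

theorem q_zpow_sq_ne_one {m : ℤ} (hm : m ≠ 0) : (q ^ m) ^ 2 ≠ 1 := by
  intro h
  have := (q_zpow_mul_t_zpow_eq_one_iff (m * 2) 0).1 (by rw [zpow_mul]; simpa using h)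
  omega

theorem q_zpow_sub_ne_zero {m : ℤ} (hm : m ≠ 0) : q ^ m - q ^ (-m) ≠ 0 := by
  intro h
  apply q_zpow_sq_ne_one hm
  rw [zpow_neg] at h
  have := zpow_ne_zero m q_ne_zero
  field_simp at h
  linear_combination h

theorem qInt_q (m : ℤ) (d : ℕ) :
    qInt (q ^ m) d = (q ^ (m * d) - q ^ (-(m * d))) / (q ^ m - q ^ (-m)) := by
  rw [qInt, zpow_mul, zpow_neg, zpow_neg, zpow_neg, zpow_mul]

/-- The commutator of `a_i[m]` and `y_i[-m]`. -/
def pairingAY (d : ℕ) (m : ℤ) : KFrac :=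
  (q ^ (m * d) - q ^ (-(m * d))) * (t ^ m - t ^ (-m)) / m

theorem aFam_neg (i : Fin l) (m : ℤ) : aFam i (-m) = aFam i m := by
  rw [aFam, neg_neg]
  congr 1
  push_cast
  exact sub_div_neg _ _ _

theorem sum_xComm_mul_aFam (i k : Fin l) {m : ℤ} (hm : m ≠ 0) :
    ((q ^ m - q ^ (-m)) / (m : KFrac)) * ((q ^ m - q ^ (-m)) / (m : KFrac)) *
      xComm (typeC l) m i k = pairingAY ((typeC l).d i) m * defCartan (typeC l) (q ^ m) (t ^ m) i k := by
  have h1 := q_zpow_sub_ne_zero hm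
  have h2 : (m : KFrac) ≠ 0 := by exact_mod_cast hm
  rw [xComm, defSymCartan, Matrix.of_apply, qInt_q, pairingAY]
  field_simp

theorem xComm_symm (i k : Fin l) {m : ℤ} (hm : m ≠ 0) :
    xComm (typeC l) m i k = xComm (typeC l) m k i := by
  rw [xComm, xComm, defSymCartan_symm i k (q_zpow_sq_ne_one hm) (zpow_ne_zero _ q_ne_zero)]

theorem defCartan_neg (i j : Fin l) (m : ℤ) :
    defCartan (typeC l) (q ^ (-m)) (t ^ (-m)) i j = defCartan (typeC l) (q ^ m) (t ^ m) i j := by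
  have h : ∀ k, qInt (q ^ (-m)) k = qInt (q ^ m) k := by
    intro k
    rw [qInt, qInt, ← zpow_mul, ← zpow_mul, ← zpow_mul, ← zpow_mul, ← zpow_neg, ← zpow_neg, neg_neg,
      neg_mul_neg, neg_mul, mul_neg]
    exact sub_div_sub_swap _ _ _ _
  rw [defCartan, defCartan, Matrix.of_apply, Matrix.of_apply, h]
  congr 2
  simp only [← zpow_mul, ← zpow_neg]
  rw [add_comm]
  ring_nf

theorem yFam_apply (j k : Fin l) (m : ℤ) : yFam (typeC l) j m k =
    (defCartan (typeC l) (q ^ m) (t ^ m))⁻¹ k j * ((q ^ m - q ^ (-m)) / (m : KFrac)) := by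
  simp [yFam, aFam, Finset.sum_apply, Pi.single_apply]

/-- The row of `C` produced by `a_i` meets the column of `C⁻¹` in the definition of `y_j`, so the
pairing becomes diagonal. -/
theorem bracket_aFam_yFam (hl : 2 ≤ l) (i j : Fin l) {m : ℤ} (hm : m ≠ 0) :
    bracket (typeC l) (aFam i) (yFam (typeC l) j) m =
      if i = j then pairingAY ((typeC l).d i) m else 0 := by
  have hm' : -m ≠ 0 := neg_ne_zero.2 hm
  have hC : (defCartan (typeC l) (q ^ (-m)) (t ^ (-m))) = defCartan (typeC l) (q ^ m) (t ^ m) := by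
    ext a b; exact defCartan_neg a b m
  have h1 : ∀ a b, aFam i m a * yFam (typeC l) j (-m) b * xComm (typeC l) m a b =
      if a = i then pairingAY ((typeC l).d i) m * (defCartan (typeC l) (q ^ m) (t ^ m) i b *
        (defCartan (typeC l) (q ^ m) (t ^ m))⁻¹ b j) else 0 := by
    intro a b
    have hy : yFam (typeC l) j (-m) b = (defCartan (typeC l) (q ^ m) (t ^ m))⁻¹ b j *
        ((q ^ m - q ^ (-m)) / (m : KFrac)) := by
      rw [yFam_apply, hC, neg_neg]
      push_cast
      exact congrArg _ (sub_div_neg _ _ _)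
    rw [hy, aFam, Pi.single_apply]
    split_ifs with h
    · subst h
      linear_combination
        (defCartan (typeC l) (q ^ m) (t ^ m))⁻¹ b j * sum_xComm_mul_aFam a b hm
    · ring
  simp only [bracket, h1]
  rw [Finset.sum_comm]
  simp only [Finset.sum_ite_eq', Finset.mem_univ, if_true]
  rw [← Finset.mul_sum, ← Matrix.mul_apply,
    Matrix.mul_nonsing_inv _ (isUnit_det_defCartan_zpow hl hm), Matrix.one_apply, mul_ite, mul_one,
    mul_zero]

theorem bracket_yFam_aFam (hl : 2 ≤ l) (i j : Fin l) {m : ℤ} (hm : m ≠ 0) :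
    bracket (typeC l) (yFam (typeC l) j) (aFam i) m =
      if i = j then pairingAY ((typeC l).d i) m else 0 := by
  have h1 : ∀ a b, yFam (typeC l) j m a * aFam i (-m) b * xComm (typeC l) m a b =
      if b = i then pairingAY ((typeC l).d i) m * (defCartan (typeC l) (q ^ m) (t ^ m) i a *
        (defCartan (typeC l) (q ^ m) (t ^ m))⁻¹ a j) else 0 := by
    intro a b
    rw [yFam_apply, aFam_neg, aFam, Pi.single_apply]
    split_ifs with h
    · subst h
      rw [← mul_assoc, ← sum_xComm_mul_aFam b a hm, xComm_symm a b hm]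
      ring
    · ring
  simp only [bracket, h1]
  simp only [Finset.sum_ite_eq', Finset.mem_univ, if_true]
  rw [← Finset.mul_sum, ← Matrix.mul_apply,
    Matrix.mul_nonsing_inv _ (isUnit_det_defCartan_zpow hl hm), Matrix.one_apply, mul_ite, mul_one,
    mul_zero]

/-- `a_j[m] = ∑_i C_{ij}(q ^ m, t ^ m) y_i[m]`. -/
theorem sum_defCartan_smul_yFam (hl : 2 ≤ l) (j : Fin l) {m : ℤ} (hm : m ≠ 0) :
    ∑ i, defCartan (typeC l) (q ^ m) (t ^ m) i j • yFam (typeC l) i m = aFam j m := by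
  funext k
  simp only [Finset.sum_apply, Pi.smul_apply, smul_eq_mul, yFam_apply]
  have h : ∀ i, defCartan (typeC l) (q ^ m) (t ^ m) i j *
      ((defCartan (typeC l) (q ^ m) (t ^ m))⁻¹ k i * ((q ^ m - q ^ (-m)) / (m : KFrac))) =
      ((defCartan (typeC l) (q ^ m) (t ^ m))⁻¹ k i * defCartan (typeC l) (q ^ m) (t ^ m) i j) *
      ((q ^ m - q ^ (-m)) / (m : KFrac)) := fun i => by ring
  simp only [h]
  rw [← Finset.sum_mul, ← Matrix.mul_apply,
    Matrix.nonsing_inv_mul _ (isUnit_det_defCartan_zpow hl hm), Matrix.one_apply, aFam,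
    Pi.single_apply, ite_mul, one_mul, zero_mul]

end Brackets

end
end DeformedW

namespace DeformedW
noncomputable section
open PowerSeries Finset.HasAntidiagonal

/-! ### Screening currents -/

section Screening

variable {l : ℕ}

/-- The two pairs of parameters attached to the screening currents at a node with `d_i = d`. -/
def IsScreenPair (d : ℕ) (σ τ : KFrac) : Prop :=
  (σ = q ^ (-(d : ℤ)) ∧ τ = t) ∨ (σ = t ∧ τ = q ^ (-(d : ℤ)))

/-- The modes `a_i[m] / (σ ^ (-m) - σ ^ m)` of a screening current. -/
def screenFam (σ : KFrac) (i : Fin l) : ModeFamily l :=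
  fun m => (σ ^ (-m) - σ ^ m)⁻¹ • aFam i m

theorem sPlusFam_eq (i : Fin l) :
    sPlusFam (typeC l) i = screenFam (q ^ (-((typeC l).d i : ℤ))) i := by
  funext m
  rw [sPlusFam, screenFam, ← zpow_mul, ← zpow_mul, neg_mul_neg, neg_mul, mul_comm m]

theorem neg_sMinusFam_eq (i : Fin l) : -sMinusFam i = screenFam t i := by
  funext m
  rw [Pi.neg_apply, sMinusFam, screenFam, ← neg_smul, ← inv_neg, neg_sub]

variable {d : ℕ} {σ τ : KFrac}

theorem IsScreenPair.ne_zero (h : IsScreenPair d σ τ) : σ ≠ 0 ∧ τ ≠ 0 := by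
  rcases h with ⟨rfl, rfl⟩ | ⟨rfl, rfl⟩
  · exact ⟨zpow_ne_zero _ q_ne_zero, t_ne_zero⟩
  · exact ⟨t_ne_zero, zpow_ne_zero _ q_ne_zero⟩

theorem IsScreenPair.mul_eq (h : IsScreenPair d σ τ) : τ * σ = q ^ (-(d : ℤ)) * t := by
  rcases h with ⟨rfl, rfl⟩ | ⟨rfl, rfl⟩
  · rw [mul_comm]
  · rfl

theorem t_zpow_sub_ne_zero {m : ℤ} (hm : m ≠ 0) : t ^ (-m) - t ^ m ≠ 0 := by
  intro h
  have h1 : q ^ (0 : ℤ) * t ^ (-m) = q ^ (0 : ℤ) * t ^ m := by rw [sub_eq_zero.1 h]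
  rw [q_zpow_mul_t_zpow_inj] at h1
  omega

theorem IsScreenPair.sub_ne_zero (h : IsScreenPair d σ τ) (hd : 0 < d) {m : ℤ} (hm : m ≠ 0) :
    σ ^ (-m) - σ ^ m ≠ 0 := by
  rcases h with ⟨rfl, rfl⟩ | ⟨rfl, rfl⟩
  · rw [← zpow_mul, ← zpow_mul, show -(d : ℤ) * m = -(d * m) by ring,
      show -(d : ℤ) * -m = d * m by ring]
    exact q_zpow_sub_ne_zero (mul_ne_zero (by omega) hm)
  · exact t_zpow_sub_ne_zero hm

/-- The pairing is symmetric in `σ` and `τ`. Division by the `σ`-factor, which turns `a_i` into the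
screening modes, leaves an expression in `τ` alone; therefore `τ` controls poles and zeros for both
kinds of screening. -/
theorem IsScreenPair.pairingAY_eq (h : IsScreenPair d σ τ) (m : ℤ) :
    pairingAY d m = (σ ^ (-m) - σ ^ m) * ((τ ^ m - τ ^ (-m)) / m) := by
  rcases h with ⟨rfl, rfl⟩ | ⟨rfl, rfl⟩
  · rw [pairingAY, ← zpow_mul, ← zpow_mul, neg_mul_neg, neg_mul, mul_comm (d : ℤ), mul_div_assoc]
  · rw [pairingAY, ← zpow_mul, ← zpow_mul, neg_mul_neg, neg_mul, mul_comm (d : ℤ)]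
    ring

theorem bracket_zero (g : CartanData l) (c s : ModeFamily l) : bracket g c s 0 = 0 := by
  simp [bracket, xComm]

theorem bracket_screenFam_yFam (hl : 2 ≤ l) {i : Fin l} (h : IsScreenPair ((typeC l).d i) σ τ)
    (j : Fin l) (m : ℤ) : bracket (typeC l) (screenFam σ i) (yFam (typeC l) j) m =
      if i = j then (τ ^ m - τ ^ (-m)) / m else 0 := by
  rcases eq_or_ne m 0 with rfl | hm
  · rw [bracket_zero]; simp
  · have h1 := h.sub_ne_zero (typeC_d_pos i) hm
    rw [show screenFam σ i = fun m => (σ ^ (-m) - σ ^ m)⁻¹ • aFam i m from rfl,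
      bracket_smul_left, bracket_aFam_yFam hl i j hm, h.pairingAY_eq]
    split_ifs
    · rw [inv_mul_cancel_left₀ h1]
    · rw [mul_zero]

theorem bracket_yFam_screenFam (hl : 2 ≤ l) {i : Fin l} (h : IsScreenPair ((typeC l).d i) σ τ)
    (j : Fin l) (m : ℤ) : bracket (typeC l) (yFam (typeC l) j) (screenFam σ i) m =
      if i = j then (τ ^ (-m) - τ ^ m) / m else 0 := by
  rcases eq_or_ne m 0 with rfl | hm
  · rw [bracket_zero]; simp
  · have h1 := h.sub_ne_zero (typeC_d_pos i) (neg_ne_zero.2 hm)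
    rw [show screenFam σ i = fun m => (σ ^ (-m) - σ ^ m)⁻¹ • aFam i m from rfl,
      bracket_smul_right, bracket_yFam_aFam hl i j hm, h.pairingAY_eq]
    split_ifs
    · rw [show (σ ^ (-m) - σ ^ m) = -(σ ^ (-(-m)) - σ ^ (-m)) by rw [neg_neg, neg_sub], neg_mul,
        mul_neg, inv_mul_cancel_left₀ h1, ← neg_div, neg_sub]
    · rw [mul_zero]

theorem aFam_zero (i : Fin l) : aFam i 0 = 0 := by simp [aFam]

/-- The difference equation of the screening current: `σ^{-2m} - 1 = σ^{-m} (σ^{-m} - σ^m)`, and the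
last factor cancels the denominator of the modes. -/
theorem scaleFam_screenFam_mul_sq (h : IsScreenPair d σ τ) (hd : 0 < d) {x : KFrac} (hx : x ≠ 0)
    (i : Fin l) : scaleFam (x * σ ^ 2) (screenFam σ i) =
      scaleFam x (screenFam σ i) + scaleFam (x * σ) (aFam i) := by
  funext m
  rcases eq_or_ne m 0 with rfl | hm
  · simp [scaleFam, screenFam, aFam_zero]
  · have h1 := h.sub_ne_zero hd hm
    have hσ := zpow_ne_zero m h.ne_zero.1
    simp only [scaleFam, screenFam, Pi.add_apply, smul_smul, ← add_smul]
    congr 1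
    have hσ2 : (σ ^ 2) ^ m = (σ ^ m) ^ 2 := by
      rw [← zpow_natCast, ← zpow_natCast, zpow_comm]
    simp only [zpow_neg, mul_zpow, hσ2] at h1 ⊢
    have hx' := zpow_ne_zero m hx
    have h2 : 1 - (σ ^ m) ^ 2 ≠ 0 := by
      intro h0; apply h1; field_simp; linear_combination h0
    field_simp
    ring

/-! ### Modes of monomials -/

/-- The modes of the field attached to a monomial. -/
def monFam (g : CartanData l) : Mon l →+ ModeFamily l :=
  Finsupp.liftAddHom fun p =>
    (AddMonoidHom.mk' (fun e : ℤ => (fun m => e • (Spec.val p.2 ^ (-m) • yFam g p.1 m) : ModeFamily l))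
      fun a b => by funext m; exact add_smul _ _ _)

theorem monFam_eq (g : CartanData l) (M : Mon l) : monFam g M =
    fun m => M.sum fun p e => e • (Spec.val p.2 ^ (-m) • yFam g p.1 m) := by
  funext m
  rw [monFam, Finsupp.liftAddHom_apply, Finsupp.sum, Finsupp.sum, Finset.sum_apply]
  rfl

theorem monFam_single (g : CartanData l) (i : Fin l) (a : Spec) :
    monFam g (Finsupp.single (i, a) 1) = scaleFam a.val (yFam g i) := by
  funext m
  rw [monFam_eq]
  simp [scaleFam]

theorem Spec.val_shift (a : Spec) (m n : ℤ) : (a.shift m n).val = a.val * (q ^ m * t ^ n) := by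
  simp only [Spec.val, Spec.shift, zpow_add₀ q_ne_zero, zpow_add₀ t_ne_zero]
  ring

theorem Spec.val_ne_zero (a : Spec) : a.val ≠ 0 := by
  refine mul_ne_zero (mul_ne_zero ?_ (zpow_ne_zero _ q_ne_zero)) (zpow_ne_zero _ t_ne_zero)
  simp

theorem sum_range_zpow_qInt {x : KFrac} (hx : x ^ 2 ≠ 1) (h0 : x ≠ 0) {k : ℤ}
    (hk : k = 0 ∨ k = 1 ∨ k = 2) :
    ∑ s ∈ Finset.range k.toNat, x ^ (-(k - 1 - 2 * (s : ℤ))) = qInt x k := by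
  rcases hk with rfl | rfl | rfl
  · simp [qInt_zero]
  · simp [qInt_one hx h0]
  · rw [qInt_two hx h0]
    simp [Finset.sum_range_succ]
    ring

theorem incidence_cases (i j : Fin l) : incidence (typeC l) i j = 0 ∨
    incidence (typeC l) i j = 1 ∨ incidence (typeC l) i j = 2 := by
  rw [typeC_incidence]; split_ifs <;> simp

theorem yFam_zero (g : CartanData l) (i : Fin l) : yFam g i 0 = 0 := by
  simp [yFam, aFam_zero]

/-- The explicit product defining `A_j` is matched with `∑_i C_{ij} y_i`: the string of shifts `q^{I
- 1 - 2s}` sums to the `q`-integer `[I]`. -/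
theorem monFam_aMon (hl : 2 ≤ l) (j : Fin l) (b : Spec) :
    monFam (typeC l) (aMon (typeC l) j b) = scaleFam b.val (aFam j) := by
  rw [aMon, map_sub, map_add, monFam_single, monFam_single, map_sum]
  simp only [map_sum, monFam_single]
  funext m
  rcases eq_or_ne m 0 with rfl | hm
  · simp [scaleFam, yFam_zero, aFam_zero]
  · have hq := zpow_ne_zero m q_ne_zero
    rw [scaleFam, ← sum_defCartan_smul_yFam hl j hm]
    simp only [Pi.sub_apply, Pi.add_apply, Finset.sum_apply, scaleFam, Spec.val_shift]
    have h1 : ∀ i : Fin l, ∑ s ∈ Finset.range (incidence (typeC l) i j).toNat,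
        (b.val * (q ^ (incidence (typeC l) i j - 1 - 2 * (s : ℤ)) * t ^ (0 : ℤ))) ^ (-m) •
          yFam (typeC l) i m =
        (b.val ^ (-m) * qInt (q ^ m) (incidence (typeC l) i j)) • yFam (typeC l) i m := by
      intro i
      rw [← Finset.sum_smul, ← sum_range_zpow_qInt (q_zpow_sq_ne_one hm) hq (incidence_cases i j),
        Finset.mul_sum]
      congr 1
      refine Finset.sum_congr rfl fun s _ => ?_
      rw [zpow_zero, mul_one, mul_zpow, ← zpow_mul, ← zpow_mul]
      congr 2
      ring
    rw [Finset.sum_congr rfl fun i _ => h1 i, Finset.smul_sum]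
    have h2 : ∀ i : Fin l, b.val ^ (-m) • defCartan (typeC l) (q ^ m) (t ^ m) i j •
        yFam (typeC l) i m = (if i = j then (b.val ^ (-m) * (
          (q ^ m) ^ ((typeC l).d j : ℤ) * (t ^ m)⁻¹ + (q ^ m) ^ (-((typeC l).d j : ℤ)) * t ^ m)) •
            yFam (typeC l) j m else 0) -
          (b.val ^ (-m) * qInt (q ^ m) (incidence (typeC l) i j)) • yFam (typeC l) i m := by
      intro i
      rw [smul_smul, defCartan, Matrix.of_apply]
      split_ifs with h
      · subst h; rw [← sub_smul, mul_sub]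
      · rw [zero_sub, zero_sub, mul_neg, neg_smul]
    rw [Finset.sum_congr rfl fun i _ => h2 i, Finset.sum_sub_distrib, Finset.sum_ite_eq',
      if_pos (Finset.mem_univ _)]
    congr 1
    rw [← add_smul]
    congr 1
    rw [mul_zpow, mul_zpow, mul_zpow, mul_zpow, ← zpow_mul, ← zpow_mul, ← zpow_mul, ← zpow_mul,
      ← zpow_mul, ← zpow_mul, ← zpow_neg]
    ring_nf

/-- `Y_i(za)` has its pole at `w = aτz`, and `Y_i(zaτ²σ²)⁻¹` has its pole at `w = aτσ²z`. By the
difference equation the vertex operators at these two poles are the same. -/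
theorem monFam_sub_aMon (hl : 2 ≤ l) {i : Fin l} (h : IsScreenPair ((typeC l).d i) σ τ) (M : Mon l)
    (a : Spec) : monFam (typeC l) (M - aMon (typeC l) i (a.shift (-((typeC l).d i : ℤ)) 1)) +
        scaleFam (a.val * τ * σ ^ 2) (screenFam σ i) =
      monFam (typeC l) M + scaleFam (a.val * τ) (screenFam σ i) := by
  rw [map_sub, monFam_aMon hl, Spec.val_shift, zpow_one, ← h.mul_eq,
    scaleFam_screenFam_mul_sq h (typeC_d_pos i) (mul_ne_zero a.val_ne_zero h.ne_zero.2), mul_assoc]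
  abel

end Screening

end
end DeformedW

namespace DeformedW
noncomputable section
open PowerSeries Finset.HasAntidiagonal

/-! ### Operator product expansions with simple poles -/

section PartialFractions

variable {F : Type*} [Field F]

/-- `(1 - α X)⁻¹`. -/
def geo (α : F) : PowerSeries F := PowerSeries.mk fun n => α ^ n

theorem coeff_geo (α : F) (n : ℕ) : coeff n (geo α) = α ^ n := coeff_mk _ _

theorem geo_mul (α : F) : (1 - PowerSeries.C α * X) * geo α = 1 := by
  ext1 n
  rw [sub_mul, one_mul, map_sub, mul_assoc, coeff_C_mul, coeff_geo, coeff_one]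
  cases n with
  | zero => simp
  | succ n => rw [coeff_succ_X_mul, coeff_geo, if_neg n.succ_ne_zero, pow_succ']; ring

theorem coeff_geo_mul_geo {α β : F} (h : α ≠ β) (p : ℕ) :
    coeff p (geo α * geo β) = (α ^ (p + 1) - β ^ (p + 1)) / (α - β) := by
  rw [eq_div_iff (sub_ne_zero.2 h), mul_comm, coeff_mul, ← (Commute.all α β).mul_geom_sum₂ (p + 1),
    Finset.Nat.sum_antidiagonal_eq_sum_range_succ fun a b => coeff a (geo α) * coeff b (geo β)]
  simp [geo]

/-- The expansion of `(1 - β X) / (1 - α X)`. -/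
def factorSeries (α β : F) : PowerSeries F := (1 - PowerSeries.C β * X) * geo α

theorem factorSeries_eq {α : F} (hα : α ≠ 0) (β : F) :
    factorSeries α β = PowerSeries.C (β / α) + PowerSeries.C (1 - β / α) * geo α := by
  ext1 n
  rw [factorSeries, sub_mul, one_mul, map_sub, mul_assoc, coeff_C_mul, coeff_geo, map_add, coeff_C,
    coeff_C_mul, coeff_geo]
  cases n with
  | zero => simp
  | succ n => rw [coeff_succ_X_mul, coeff_geo, if_neg n.succ_ne_zero]; field_simp; ring

theorem C_mul_factorSeries {α β : F} (hα : α ≠ 0) (hβ : β ≠ 0) :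
    PowerSeries.C (α / β) * factorSeries α β =
      PowerSeries.C 1 + PowerSeries.C (α / β - 1) * geo α := by
  rw [factorSeries_eq hα, mul_add, ← mul_assoc, ← map_mul, ← map_mul, mul_sub, mul_one,
    div_mul_div_cancel₀ hβ, div_self hα]

theorem inv_div_inv_sub_inv {α β : F} (hα : α ≠ 0) (hβ : β ≠ 0) (h : α ≠ β) :
    α⁻¹ / (α⁻¹ - β⁻¹) = 1 - α / (α - β) := by
  have h1 : α - β ≠ 0 := sub_ne_zero.2 h
  have h2 : β - α ≠ 0 := sub_ne_zero.2 h.symm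
  rw [inv_sub_inv hα hβ]
  field_simp
  ring

theorem isExp_factorSeries [CharZero F] (α β : F) :
    IsExp (PowerSeries.mk fun m => (α ^ m - β ^ m) / m) (factorSeries α β) where
  coeff_zero := by simp [factorSeries, geo]
  euler_eq := by
    have he : euler (PowerSeries.mk fun m => (α ^ m - β ^ m) / (m : F)) = geo α - geo β := by
      ext1 n
      rw [coeff_euler, coeff_mk, nsmul_eq_mul, map_sub, coeff_geo, coeff_geo]
      rcases Nat.eq_zero_or_pos n with rfl | hn
      · simp
      · have : (n : F) ≠ 0 := by exact_mod_cast hn.ne'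
        field_simp
    have hP : ∀ γ : F, euler (1 - PowerSeries.C γ * X) = -(PowerSeries.C γ * X) := by
      intro γ
      ext1 n
      rw [coeff_euler, map_sub, map_neg, coeff_one, coeff_C_mul, coeff_X]
      rcases n with _ | _ | n <;> simp
    have h1 : euler (1 : PowerSeries F) = 0 := by
      ext1 n
      rw [coeff_euler, coeff_one]
      split_ifs with h <;> simp [h]
    have hα := geo_mul α
    have hβ := geo_mul β
    have hg : euler (geo α) = PowerSeries.C α * X * (geo α * geo α) := by
      have := congrArg euler hα
      rw [euler_mul, hP, h1] at this
      linear_combination geo α * this - euler (geo α) * hα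
    rw [he, factorSeries, euler_mul, hP, hg]
    linear_combination ((1 - PowerSeries.C β * X) * geo α) * (-hα) + geo α * hβ

/-- Partial fractions. The poles may coincide when `d₁` or `d₂` is zero, since then the fraction
with a vanishing denominator is multiplied by zero; this covers nodes with fewer than two variables.
-/
theorem coeff_mul_affine_geo {c₁ c₂ d₁ d₂ α₁ α₂ : F} (h : d₁ = 0 ∨ d₂ = 0 ∨ α₁ ≠ α₂) (p : ℕ) :
    coeff p ((PowerSeries.C c₁ + PowerSeries.C d₁ * geo α₁) *
      (PowerSeries.C c₂ + PowerSeries.C d₂ * geo α₂)) = (if p = 0 then c₁ * c₂ else 0) +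
      d₁ * (c₂ + d₂ * α₁ / (α₁ - α₂)) * α₁ ^ p + d₂ * (c₁ + d₁ * α₂ / (α₂ - α₁)) * α₂ ^ p := by
  have e : (PowerSeries.C c₁ + PowerSeries.C d₁ * geo α₁) *
      (PowerSeries.C c₂ + PowerSeries.C d₂ * geo α₂) = PowerSeries.C (c₁ * c₂) +
      PowerSeries.C (d₁ * c₂) * geo α₁ + PowerSeries.C (c₁ * d₂) * geo α₂ +
      PowerSeries.C (d₁ * d₂) * (geo α₁ * geo α₂) := by
    simp only [map_mul]; ring
  rw [e, map_add, map_add, map_add, coeff_C, coeff_C_mul, coeff_C_mul, coeff_C_mul, coeff_geo,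
    coeff_geo]
  rcases h with rfl | rfl | h
  · ring
  · ring
  · rw [coeff_geo_mul_geo h]
    have h1 : α₁ - α₂ ≠ 0 := sub_ne_zero.2 h
    rw [← neg_sub α₁ α₂]
    field_simp
    ring

end PartialFractions

/-! ### The commutator of a monomial with a screening operator -/

section Commutator

/-- The inverse of the position `w / z` of the pole of the operator product expansion of
`Y_i(za) ^ s`, `s ∈ {-1, 0, 1}`, with a screening current. -/
def poleInv (τ : KFrac) (s : ℤ) (a : KFrac) : KFrac :=
  if s = 1 then (τ * a)⁻¹ else if s = -1 then τ * a⁻¹ else 1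

/-- The inverse of the position of the corresponding zero. -/
def zeroInv (τ : KFrac) (s : ℤ) (a : KFrac) : KFrac :=
  if s = 1 then τ * a⁻¹ else if s = -1 then (τ * a)⁻¹ else 1

/-- The residue at this pole. -/
def poleRes (τ : KFrac) (s : ℤ) : KFrac :=
  if s = 1 then (τ ^ 2)⁻¹ - 1 else if s = -1 then τ ^ 2 - 1 else 0

/-- The residue of a product of two such expansions at the pole of the first one. -/
def poleRes₂ (τ : KFrac) (s₁ : ℤ) (a₁ : KFrac) (s₂ : ℤ) (a₂ : KFrac) : KFrac :=
  poleRes τ s₁ * (1 + poleRes τ s₂ * poleInv τ s₁ a₁ / (poleInv τ s₁ a₁ - poleInv τ s₂ a₂))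

variable {τ : KFrac}

theorem poleInv_ne_zero (hτ : τ ≠ 0) {s : ℤ} {a : KFrac} (ha : a ≠ 0) : poleInv τ s a ≠ 0 := by
  unfold poleInv
  split_ifs
  · exact inv_ne_zero (mul_ne_zero hτ ha)
  · exact mul_ne_zero hτ (inv_ne_zero ha)
  · exact one_ne_zero

theorem zeroInv_ne_zero (hτ : τ ≠ 0) {s : ℤ} {a : KFrac} (ha : a ≠ 0) : zeroInv τ s a ≠ 0 := by
  unfold zeroInv
  split_ifs
  · exact mul_ne_zero hτ (inv_ne_zero ha)
  · exact inv_ne_zero (mul_ne_zero hτ ha)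
  · exact one_ne_zero

theorem poleInv_div_zeroInv (hτ : τ ≠ 0) {s : ℤ} {a : KFrac} (ha : a ≠ 0) :
    poleInv τ s a / zeroInv τ s a = 1 + poleRes τ s := by
  unfold poleInv zeroInv poleRes
  split_ifs <;> field_simp <;> ring

theorem zpow_poleInv_sub {s : ℤ} (hs : s = -1 ∨ s = 0 ∨ s = 1) {a : KFrac}
    (m : ℕ) : (s : KFrac) * (a ^ (-(m : ℤ)) * ((τ ^ (-(m : ℤ)) - τ ^ (m : ℤ)) / (m : ℤ))) =
      (poleInv τ s a ^ m - zeroInv τ s a ^ m) / m := by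
  rcases hs with rfl | rfl | rfl <;> simp [poleInv, zeroInv, mul_pow] <;> ring

theorem zpow_poleInv_sub' {s : ℤ} (hs : s = -1 ∨ s = 0 ∨ s = 1) {a : KFrac}
    (m : ℕ) : (s : KFrac) * (a ^ (m : ℤ) * ((τ ^ (m : ℤ) - τ ^ (-(m : ℤ))) / (m : ℤ))) =
      ((poleInv τ s a)⁻¹ ^ m - (zeroInv τ s a)⁻¹ ^ m) / m := by
  rcases hs with rfl | rfl | rfl <;> simp [poleInv, zeroInv, mul_pow] <;> ring

theorem one_add_poleRes {s : ℤ} (hs : s = -1 ∨ s = 0 ∨ s = 1) :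
    1 + poleRes τ s = τ ^ (-2 * s) := by
  rcases hs with rfl | rfl | rfl <;> simp [poleRes]

variable {l : ℕ}

/-- The two products are normalised to `1` at `0` and at `∞` respectively. The ratio of these
normalisations is `α / β` for each factor, and together they give `τ^{-2(s₁ + s₂)}`, exactly the
power contributed by the zero modes. -/
theorem normalExp_commutator_two (g : CartanData l) {c S : ModeFamily l} (hτ : τ ≠ 0) {s₁ s₂ : ℤ}
    (hs₁ : s₁ = -1 ∨ s₁ = 0 ∨ s₁ = 1) (hs₂ : s₂ = -1 ∨ s₂ = 0 ∨ s₂ = 1) {a₁ a₂ : KFrac}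
    (ha₁ : a₁ ≠ 0) (ha₂ : a₂ ≠ 0)
    (hp : s₁ = 0 ∨ s₂ = 0 ∨ poleInv τ s₁ a₁ ≠ poleInv τ s₂ a₂)
    (h : ∀ m : ℕ, bracket g c S m =
      (s₁ : KFrac) * (a₁ ^ (-(m : ℤ)) * ((τ ^ (-(m : ℤ)) - τ ^ (m : ℤ)) / (m : ℤ))) +
      (s₂ : KFrac) * (a₂ ^ (-(m : ℤ)) * ((τ ^ (-(m : ℤ)) - τ ^ (m : ℤ)) / (m : ℤ))))
    (h' : ∀ m : ℕ, bracket g S c m =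
      (s₁ : KFrac) * (a₁ ^ (m : ℤ) * ((τ ^ (m : ℤ) - τ ^ (-(m : ℤ))) / (m : ℤ))) +
      (s₂ : KFrac) * (a₂ ^ (m : ℤ) * ((τ ^ (m : ℤ) - τ ^ (-(m : ℤ))) / (m : ℤ))))
    (n : ℤ) (v : Fock l) :
    τ ^ (-2 * (s₁ + s₂)) • normalExp g c n (normalExp g S (-1) v) -
        normalExp g S (-1) (normalExp g c n v) =
      (poleRes₂ τ s₁ a₁ s₂ a₂ * (poleInv τ s₁ a₁)⁻¹) •
        normalExp g (c + scaleFam (poleInv τ s₁ a₁)⁻¹ S) (n - 1) v +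
      (poleRes₂ τ s₂ a₂ s₁ a₁ * (poleInv τ s₂ a₂)⁻¹) •
        normalExp g (c + scaleFam (poleInv τ s₂ a₂)⁻¹ S) (n - 1) v := by
  set α₁ := poleInv τ s₁ a₁ with hα₁
  set α₂ := poleInv τ s₂ a₂ with hα₂
  set β₁ := zeroInv τ s₁ a₁ with hβ₁
  set β₂ := zeroInv τ s₂ a₂ with hβ₂
  set ρ₁ := poleRes τ s₁ with hρ₁
  set ρ₂ := poleRes τ s₂ with hρ₂
  have hα₁0 : α₁ ≠ 0 := poleInv_ne_zero hτ ha₁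
  have hα₂0 : α₂ ≠ 0 := poleInv_ne_zero hτ ha₂
  have hβ₁0 : β₁ ≠ 0 := zeroInv_ne_zero hτ ha₁
  have hβ₂0 : β₂ ≠ 0 := zeroInv_ne_zero hτ ha₂
  have e₁ : α₁ / β₁ = 1 + ρ₁ := poleInv_div_zeroInv hτ ha₁
  have e₂ : α₂ / β₂ = 1 + ρ₂ := poleInv_div_zeroInv hτ ha₂
  have hp' : ρ₁ = 0 ∨ ρ₂ = 0 ∨ α₁ ≠ α₂ := by
    rcases hp with rfl | rfl | hp
    · exact Or.inl (by simp [hρ₁, poleRes])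
    · exact Or.inr (Or.inl (by simp [hρ₂, poleRes]))
    · exact Or.inr (Or.inr hp)
  have hκ : τ ^ (-2 * (s₁ + s₂)) = (α₁ / β₁) * (α₂ / β₂) := by
    rw [e₁, e₂, one_add_poleRes hs₁, one_add_poleRes hs₂, ← zpow_add₀ hτ, mul_add]
  have f1 : IsExp (PowerSeries.mk fun m : ℕ => bracket g c S m)
      (factorSeries α₁ β₁ * factorSeries α₂ β₂) := by
    have := (isExp_factorSeries α₁ β₁).add (isExp_factorSeries α₂ β₂) (Commute.all _ _)
    refine (congrArg (fun G => IsExp G _) ?_).mpr this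
    ext1 m
    rw [map_add, coeff_mk, coeff_mk, coeff_mk, h, zpow_poleInv_sub hs₁, zpow_poleInv_sub hs₂]
  have f2 : IsExp (PowerSeries.mk fun m : ℕ => bracket g S c m)
      (factorSeries α₁⁻¹ β₁⁻¹ * factorSeries α₂⁻¹ β₂⁻¹) := by
    have := (isExp_factorSeries α₁⁻¹ β₁⁻¹).add (isExp_factorSeries α₂⁻¹ β₂⁻¹) (Commute.all _ _)
    refine (congrArg (fun G => IsExp G _) ?_).mpr this
    ext1 m
    rw [map_add, coeff_mk, coeff_mk, coeff_mk, h', zpow_poleInv_sub' hs₁,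
      zpow_poleInv_sub' hs₂]
  have hmk : ∀ G : PowerSeries KFrac, PowerSeries.mk (fun p => coeff p G) = G := fun G => by
    ext1 p; rw [coeff_mk]
  have g1 : ∀ p, τ ^ (-2 * (s₁ + s₂)) * coeff p (factorSeries α₁ β₁ * factorSeries α₂ β₂) =
      (if p = 0 then 1 else 0) + poleRes₂ τ s₁ a₁ s₂ a₂ * α₁ ^ p +
        poleRes₂ τ s₂ a₂ s₁ a₁ * α₂ ^ p := by
    intro p
    have e : PowerSeries.C (τ ^ (-2 * (s₁ + s₂))) * (factorSeries α₁ β₁ * factorSeries α₂ β₂) =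
        (PowerSeries.C 1 + PowerSeries.C ρ₁ * geo α₁) *
        (PowerSeries.C 1 + PowerSeries.C ρ₂ * geo α₂) := by
      rw [hκ, map_mul, mul_mul_mul_comm, C_mul_factorSeries hα₁0 hβ₁0, C_mul_factorSeries hα₂0 hβ₂0,
        e₁, e₂, add_sub_cancel_left, add_sub_cancel_left]
    rw [← coeff_C_mul, e, coeff_mul_affine_geo hp']
    rw [poleRes₂, poleRes₂, mul_one]
  have g2 : ∀ p, 1 ≤ p → coeff p (factorSeries α₁⁻¹ β₁⁻¹ * factorSeries α₂⁻¹ β₂⁻¹) =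
      -(poleRes₂ τ s₁ a₁ s₂ a₂ * α₁⁻¹ ^ p + poleRes₂ τ s₂ a₂ s₁ a₁ * α₂⁻¹ ^ p) := by
    intro p hp1
    have hp2 : -ρ₁ = 0 ∨ -ρ₂ = 0 ∨ α₁⁻¹ ≠ α₂⁻¹ := by
      simpa only [neg_eq_zero, ne_eq, inv_inj] using hp'
    rw [factorSeries_eq (inv_ne_zero hα₁0), factorSeries_eq (inv_ne_zero hα₂0), inv_div_inv,
      inv_div_inv, e₁, e₂, coeff_mul_affine_geo (by simpa using hp2), if_neg (by omega), poleRes₂,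
      poleRes₂, ← hρ₁, ← hρ₂, ← hα₁, ← hα₂]
    rcases hp' with h0 | h0 | h0
    · rw [h0]; ring
    · rw [h0]; ring
    -- Inverting the poles replaces `α / (α - β)` by its complement `1 - α / (α - β)`, which is what
    -- makes the coefficients at `∞` the negatives of the residues found at `0`.
    · have e3 := inv_div_inv_sub_inv hα₁0 hα₂0 h0
      have e4 := inv_div_inv_sub_inv hα₂0 hα₁0 h0.symm
      linear_combination ρ₁ * ρ₂ * α₁⁻¹ ^ p * e3 + ρ₁ * ρ₂ * α₂⁻¹ ^ p * e4
  have := normalExp_commutator (g := g) (Finset.univ : Finset (Fin 2))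
    ![poleRes₂ τ s₁ a₁ s₂ a₂, poleRes₂ τ s₂ a₂ s₁ a₁] ![α₁⁻¹, α₂⁻¹]
    (by intro e; fin_cases e <;> simp [hα₁0, hα₂0])
    (f := fun p => coeff p (factorSeries α₁ β₁ * factorSeries α₂ β₂))
    (f' := fun p => coeff p (factorSeries α₁⁻¹ β₁⁻¹ * factorSeries α₂⁻¹ β₂⁻¹))
    (κ := τ ^ (-2 * (s₁ + s₂))) (by rw [hmk]; exact f1) (by rw [hmk]; exact f2)
    (by rw [g1]; simp [Fin.sum_univ_two]; ring) (fun p hp => by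
      rw [g1, if_neg (by omega)]; simp [Fin.sum_univ_two]) (fun p hp => by
      rw [g2 p hp]; simp [Fin.sum_univ_two]) n v
  rw [this, Fin.sum_univ_two]
  rfl

end Commutator

end
end DeformedW

namespace DeformedW
noncomputable section
open PowerSeries Finset.HasAntidiagonal

/-! ### Zero modes -/

section ZeroModes

variable {l : ℕ}

/-- The additive map sending `Y_{i,a}` to `f a` and `Y_{j,a}`, `j ≠ i`, to `0`. -/
def nodeHom {A : Type*} [AddCommGroup A] (i : Fin l) (f : Spec → A) : Mon l →+ A :=
  Finsupp.liftAddHom fun p => if p.1 = i then zmultiplesHom A (f p.2) else 0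

theorem nodeHom_single {A : Type*} [AddCommGroup A] (i : Fin l) (f : Spec → A) (p : Fin l × Spec)
    (e : ℤ) : nodeHom i f (Finsupp.single p e) = if p.1 = i then e • f p.2 else 0 := by
  rw [nodeHom, Finsupp.liftAddHom_apply_single]
  split_ifs <;> simp

theorem nodeHom_eq_zero {A : Type*} [AddCommGroup A] {i : Fin l} {M : Mon l}
    (h : ∀ a, M (i, a) = 0) (f : Spec → A) : nodeHom i f M = 0 := by
  rw [nodeHom, Finsupp.liftAddHom_apply]
  refine Finset.sum_eq_zero fun p hp => ?_
  dsimp only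
  rw [if_neg]
  · rfl
  · rintro rfl
    exact (Finsupp.mem_support_iff.1 hp) (h p.2)

theorem addMonoidHom_ext_mon {A : Type*} [AddCommGroup A] {f f' : Mon l →+ A}
    (h : ∀ j a, f (Finsupp.single (j, a) 1) = f' (Finsupp.single (j, a) 1)) : f = f' := by
  refine Finsupp.addHom_ext' fun p => ?_
  refine AddMonoidHom.ext_int ?_
  exact h p.1 p.2

/-- The total degree of a monomial at a node. -/
def degAt (i : Fin l) : Mon l →+ ℤ := nodeHom i fun _ => (1 : ℤ)

/-- The exponent of `q` by which the zero mode of a monomial acts on `π_μ`. -/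
def zeroExp (g : CartanData l) (μ : Weights l) : Mon l →+ Polynomial ℂ :=
  Finsupp.liftAddHom fun p => zmultiplesHom _ (yConst g p.1 + 2 * pairFund g μ p.1)

/-- The scalar by which the zero mode of a monomial acts on `π_μ`. -/
def zeroVal (g : CartanData l) (μ : Weights l) (M : Mon l) : KFrac :=
  qPowF (zeroExp g μ M : PowerSeries ℂ)

theorem zeroVal_add (g : CartanData l) (μ : Weights l) (M N : Mon l) :
    zeroVal g μ (M + N) = zeroVal g μ M * zeroVal g μ N := by
  rw [zeroVal, map_add, Polynomial.coe_add, qPowF_add, zeroVal, zeroVal]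

theorem zeroVal_ne_zero (g : CartanData l) (μ : Weights l) (M : Mon l) : zeroVal g μ M ≠ 0 :=
  qPowF_ne_zero _

theorem field_single (g : CartanData l) (M : Mon l) (n : ℤ) (μ : Weights l) (v : Fock l) :
    M.field g n (Finsupp.single μ v) =
      Finsupp.single μ (zeroVal g μ M • normalExp g (monFam g M) n v) := by
  rw [Mon.field, ← monFam_eq, Module.End.mul_apply, onAll, Finsupp.mapRange.linearMap_apply,
    Finsupp.mapRange_single, qZeroMode, Finsupp.lsum_single, LinearMap.smul_apply,
    Finsupp.lsingle_apply, Finsupp.smul_single]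
  rfl

theorem cartan_mul_cartanInv (hl : 2 ≤ l) (i j : Fin l) :
    ∑ k, ((typeC l).A i k : ℂ) * cartanInv (typeC l) k j = if i = j then 1 else 0 := by
  have h := Matrix.mul_nonsing_inv _ (isUnit_det_cartan hl)
  have := congrFun (congrFun h i) j
  rwa [Matrix.mul_apply, Matrix.one_apply] at this

theorem cartanInv_mul_cartan (hl : 2 ≤ l) (i j : Fin l) :
    ∑ k, cartanInv (typeC l) i k * ((typeC l).A k j : ℂ) = if i = j then 1 else 0 := by
  have h := Matrix.nonsing_inv_mul _ (isUnit_det_cartan hl)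
  have := congrFun (congrFun h i) j
  rwa [Matrix.mul_apply, Matrix.one_apply] at this

theorem pairFund_zero (g : CartanData l) (j : Fin l) : pairFund g 0 j = 0 := by
  simp [pairFund, pairRoot]

theorem pairFund_single (hl : 2 ≤ l) (i j : Fin l) (b : Polynomial ℂ) :
    pairFund (typeC l) (Pi.single i (b * Polynomial.C ((typeC l).r : ℂ))) j =
      if i = j then b * Polynomial.C ((typeC l).d i : ℂ) else 0 := by
  have h1 : ∀ k, pairRoot (typeC l) (Pi.single i (b * Polynomial.C ((typeC l).r : ℂ))) k =
      b * Polynomial.C ((typeC l).d i * (typeC l).A i k : ℂ) := by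
    intro k
    rw [pairRoot, Finset.sum_eq_single i]
    · rw [Pi.single_eq_same, mul_left_comm, ← Polynomial.C_mul, div_mul_cancel₀]
      simp [typeC]
    · intro j _ hj
      rw [Pi.single_eq_of_ne hj, mul_zero]
    · simp
  have h2 : pairFund (typeC l) (Pi.single i (b * Polynomial.C ((typeC l).r : ℂ))) j =
      b * Polynomial.C ((typeC l).d i *
        ∑ k, ((typeC l).A i k : ℂ) * cartanInv (typeC l) k j) := by
    rw [pairFund, Finset.mul_sum, map_sum, Finset.mul_sum]
    refine Finset.sum_congr rfl fun k _ => ?_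
    rw [h1, mul_left_comm, ← Polynomial.C_mul]
    congr 2
    ring
  rw [h2, cartan_mul_cartanInv hl]
  split_ifs <;> simp

theorem zeroExp_single (hl : 2 ≤ l) (i : Fin l) (b : Polynomial ℂ) (M : Mon l) :
    zeroExp (typeC l) (Pi.single i (b * Polynomial.C ((typeC l).r : ℂ))) M =
      zeroExp (typeC l) 0 M + degAt i M • (2 * (b * Polynomial.C ((typeC l).d i : ℂ))) := by
  have : zeroExp (typeC l) (Pi.single i (b * Polynomial.C ((typeC l).r : ℂ))) =
      zeroExp (typeC l) 0 +
        (zmultiplesHom _ (2 * (b * Polynomial.C ((typeC l).d i : ℂ)))).comp (degAt i) := by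
    refine addMonoidHom_ext_mon fun j a => ?_
    rw [AddMonoidHom.add_apply, AddMonoidHom.comp_apply, degAt, nodeHom_single, zeroExp, zeroExp,
      Finsupp.liftAddHom_apply_single, Finsupp.liftAddHom_apply_single]
    simp only [zmultiplesHom_apply, one_smul, pairFund_zero, mul_zero, add_zero,
      pairFund_single hl]
    by_cases h : i = j
    · subst h; simp
    · simp [h, Ne.symm h]
  rw [this]; rfl

/-- Fundamental weights are dual to coroots, so a shift along `α_i` is seen only by the variables at
`i`, and only through their total degree. -/
theorem zeroVal_single (hl : 2 ≤ l) (i : Fin l) (b : Polynomial ℂ) (M : Mon l) {τ : KFrac}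
    (h : qPowF ((b * Polynomial.C ((typeC l).d i : ℂ) : Polynomial ℂ) : PowerSeries ℂ) = τ⁻¹) :
    zeroVal (typeC l) (Pi.single i (b * Polynomial.C ((typeC l).r : ℂ))) M =
      zeroVal (typeC l) 0 M * τ ^ (-2 * degAt i M) := by
  have e : ((degAt i M • (2 * (b * Polynomial.C ((typeC l).d i : ℂ))) : Polynomial ℂ) :
      PowerSeries ℂ) = (2 * degAt i M) •
        ((b * Polynomial.C ((typeC l).d i : ℂ) : Polynomial ℂ) : PowerSeries ℂ) := by
    rw [mul_comm (2 : ℤ), mul_smul]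
    rw [show (2 : ℤ) • ((b * Polynomial.C ((typeC l).d i : ℂ) : Polynomial ℂ) : PowerSeries ℂ) =
      ((2 * (b * Polynomial.C ((typeC l).d i : ℂ)) : Polynomial ℂ) : PowerSeries ℂ) by
        rw [two_smul, two_mul, Polynomial.coe_add]]
    exact map_zsmul (Polynomial.coeToPowerSeries.ringHom (R := ℂ)).toAddMonoidHom _ _
  rw [zeroVal, zeroExp_single hl, Polynomial.coe_add, qPowF_add, e, qPowF_zsmul, h, inv_zpow,
    ← zpow_neg, neg_mul, zeroVal]

/-- At `μ = 0` only the constants in front of the `Y_i` act. Summed against a column of the Cartan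
matrix they turn `ω_i` into `α_j`, where `(ρ^∨, α_j) = 1` and `r (ρ, α_j) = d_j`. This normalisation
is the one for which the residues of `M` and `M A⁻¹` balance. -/
theorem zeroVal_aMon (hl : 2 ≤ l) (j : Fin l) (a : Spec) :
    zeroVal (typeC l) 0 (aMon (typeC l) j a) = (q ^ (-((typeC l).d j : ℤ)) * t) ^ 2 := by
  have h1 : ∀ i b, zeroExp (typeC l) 0 (Finsupp.single (i, b) 1) = yConst (typeC l) i := by
    intro i b
    rw [zeroExp, Finsupp.liftAddHom_apply_single, zmultiplesHom_apply, one_smul, pairFund_zero,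
      mul_zero, add_zero]
  have h2 : zeroExp (typeC l) 0 (aMon (typeC l) j a) =
      ∑ i, Polynomial.C ((typeC l).A i j : ℂ) * yConst (typeC l) i := by
    rw [aMon, map_sub, map_add, map_sum, h1, h1]
    simp only [map_sum, h1, Finset.sum_const, Finset.card_range]
    have h3 : ∀ i : Fin l, (incidence (typeC l) i j).toNat • yConst (typeC l) i =
        (if i = j then (2 : Polynomial ℂ) * yConst (typeC l) j else 0) -
          Polynomial.C ((typeC l).A i j : ℂ) * yConst (typeC l) i := by
      intro i
      have e1 : ((incidence (typeC l) i j).toNat : ℤ) = (if i = j then 2 else 0) -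
          (typeC l).A i j := by
        rw [Int.toNat_of_nonneg]
        · rfl
        · rcases incidence_cases i j with h | h | h <;> rw [h] <;> norm_num
      have e2 : ((incidence (typeC l) i j).toNat : Polynomial ℂ) =
          (if i = j then 2 else 0) - Polynomial.C ((typeC l).A i j : ℂ) := by
        have := congrArg (Int.cast : ℤ → Polynomial ℂ) e1
        push_cast at this
        rw [this]
        split_ifs <;> simp
      rw [nsmul_eq_mul, e2, sub_mul]
      split_ifs with h
      · rw [h]
      · rw [zero_mul]
    rw [Finset.sum_congr rfl fun i _ => h3 i, Finset.sum_sub_distrib, Finset.sum_ite_eq',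
      if_pos (Finset.mem_univ _)]
    ring
  have h3 : zeroExp (typeC l) 0 (aMon (typeC l) j a) =
      Polynomial.C 2 * Polynomial.X - Polynomial.C (2 * ((typeC l).d j : ℂ)) := by
    rw [h2]
    have e1 : ∀ f : Fin l → ℂ, ∑ i, ((typeC l).A i j : ℂ) * (2 * ∑ k, cartanInv (typeC l) k i * f k)
        = 2 * f j := by
      intro f
      have : ∀ i, ((typeC l).A i j : ℂ) * (2 * ∑ k, cartanInv (typeC l) k i * f k) =
          ∑ k, 2 * f k * (cartanInv (typeC l) k i * ((typeC l).A i j : ℂ)) := by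
        intro i
        rw [Finset.mul_sum, Finset.mul_sum]
        refine Finset.sum_congr rfl fun k _ => by ring
      rw [Finset.sum_congr rfl fun i _ => this i, Finset.sum_comm]
      simp only [← Finset.mul_sum, cartanInv_mul_cartan hl]
      simp
    have e2 := e1 fun _ => 1
    have e3 := e1 fun k => ((typeC l).d k : ℂ)
    simp only [mul_one] at e2
    have e4 : ∀ i, Polynomial.C ((typeC l).A i j : ℂ) * yConst (typeC l) i =
        Polynomial.C (((typeC l).A i j : ℂ) * (2 * ∑ k, cartanInv (typeC l) k i)) * Polynomial.X -
        Polynomial.C (((typeC l).A i j : ℂ) *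
          (2 * ∑ k, cartanInv (typeC l) k i * ((typeC l).d k : ℂ))) := by
      intro i
      rw [yConst, mul_sub, ← mul_assoc, ← Polynomial.C_mul, ← Polynomial.C_mul]
    rw [Finset.sum_congr rfl fun i _ => e4 i, Finset.sum_sub_distrib, ← Finset.sum_mul, ← map_sum,
      ← map_sum, e2, e3]
  have e : ((zeroExp (typeC l) 0 (aMon (typeC l) j a) : Polynomial ℂ) : PowerSeries ℂ) =
      (-2 * ((typeC l).d j : ℤ)) • (1 : PowerSeries ℂ) + (2 : ℤ) • betaVar := by
    rw [h3, Polynomial.coe_sub, Polynomial.coe_mul, Polynomial.coe_C, Polynomial.coe_C,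
      Polynomial.coe_X, betaVar, zsmul_eq_mul, zsmul_eq_mul]
    push_cast
    simp only [map_mul, map_natCast, map_ofNat]
    ring
  rw [zeroVal, e, ← q_zpow_mul_t_zpow, mul_pow, ← zpow_natCast, ← zpow_natCast t, ← zpow_mul,
    show (-2 * ((typeC l).d j : ℤ)) = -((typeC l).d j : ℤ) * (2 : ℕ) by push_cast; ring]
  rfl

end ZeroModes

/-! ### Screening operators -/

section ScreeningOperators

variable {l : ℕ}

/-- The properties of the screening operators that enter the commutation relations. -/
structure IsScreening (i : Fin l) (σ τ : KFrac) (μ : Weights l)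
    (S : Module.End KFrac (TotalFock l)) : Prop where
  pair : IsScreenPair ((typeC l).d i) σ τ
  apply_single : ∀ v, S (Finsupp.single 0 v) =
    Finsupp.single μ (normalExp (typeC l) (screenFam σ i) (-1) v)
  zeroVal_eq : ∀ M, zeroVal (typeC l) μ M = zeroVal (typeC l) 0 M * τ ^ (-2 * degAt i M)

theorem shiftOp_onAll_single (g : CartanData l) (b : Polynomial ℂ) (i : Fin l)
    (T : Module.End KFrac (Fock l)) (v : Fock l) :
    (shiftOp g b i * onAll T) (Finsupp.single 0 v) =
      Finsupp.single (Pi.single i (b * Polynomial.C (g.r : ℂ))) (T v) := by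
  rw [Module.End.mul_apply, onAll, Finsupp.mapRange.linearMap_apply, Finsupp.mapRange_single,
    shiftOp, Finsupp.lmapDomain_apply, Finsupp.mapDomain_single, zero_add]

theorem isScreening_screenPlus (hl : 2 ≤ l) (i : Fin l) :
    ∃ μ, IsScreening i (q ^ (-((typeC l).d i : ℤ))) t μ (screenPlus (typeC l) i) := by
  refine ⟨Pi.single i (-(Polynomial.C (((typeC l).d i : ℂ)⁻¹) * Polynomial.X) *
    Polynomial.C ((typeC l).r : ℂ)), Or.inl ⟨rfl, rfl⟩, fun v => ?_,
    fun M => zeroVal_single hl i _ M ?_⟩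
  · rw [screenPlus, shiftOp_onAll_single, sPlusFam_eq]
  · have hd : ((typeC l).d i : ℂ) ≠ 0 := by exact_mod_cast (typeC_d_pos i).ne'
    rw [t, ← qPowF, ← qPowF_neg, neg_mul, mul_right_comm, ← Polynomial.C_mul, inv_mul_cancel₀ hd,
      Polynomial.C_1, one_mul, Polynomial.coe_neg, Polynomial.coe_X, betaVar]

theorem isScreening_screenMinus (hl : 2 ≤ l) (i : Fin l) :
    ∃ μ, IsScreening i t (q ^ (-((typeC l).d i : ℤ))) μ (screenMinus (typeC l) i) := by
  refine ⟨Pi.single i (1 * Polynomial.C ((typeC l).r : ℂ)), Or.inr ⟨rfl, rfl⟩, fun v => ?_,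
    fun M => zeroVal_single hl i _ M ?_⟩
  · rw [screenMinus, shiftOp_onAll_single, neg_sMinusFam_eq]
  · rw [← zpow_neg, neg_neg, q, ← qPowF, ← qPowF_zsmul, one_mul, Polynomial.coe_C]
    congr 1
    simp

variable {i : Fin l} {σ τ : KFrac} {μ : Weights l} {S : Module.End KFrac (TotalFock l)}

theorem bracket_monFam_screenFam (hl : 2 ≤ l) (h : IsScreenPair ((typeC l).d i) σ τ) (M : Mon l)
    (m : ℤ) : bracket (typeC l) (monFam (typeC l) M) (screenFam σ i) m =
      nodeHom i (fun a => a.val ^ (-m) * ((τ ^ (-m) - τ ^ m) / m)) M := by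
  have : (AddMonoidHom.mk' (fun c : ModeFamily l => bracket (typeC l) c (screenFam σ i) m)
      fun c c' => bracket_add_left _ c c' _ m).comp (monFam (typeC l)) =
      nodeHom i (fun a => a.val ^ (-m) * ((τ ^ (-m) - τ ^ m) / m)) := by
    refine addMonoidHom_ext_mon fun j a => ?_
    rw [nodeHom_single, AddMonoidHom.comp_apply, monFam_single, AddMonoidHom.mk'_apply]
    rw [show scaleFam a.val (yFam (typeC l) j) = fun m => a.val ^ (-m) • yFam (typeC l) j m from rfl,
      bracket_smul_left, bracket_yFam_screenFam hl h]
    by_cases hj : i = j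
    · simp [hj]
    · simp [hj, Ne.symm hj]
  exact DFunLike.congr_fun this M

theorem bracket_screenFam_monFam (hl : 2 ≤ l) (h : IsScreenPair ((typeC l).d i) σ τ) (M : Mon l)
    (m : ℤ) : bracket (typeC l) (screenFam σ i) (monFam (typeC l) M) m =
      nodeHom i (fun a => a.val ^ m * ((τ ^ m - τ ^ (-m)) / m)) M := by
  have : (AddMonoidHom.mk' (fun c : ModeFamily l => bracket (typeC l) (screenFam σ i) c m)
      fun c c' => bracket_add_right _ c c' _ m).comp (monFam (typeC l)) =
      nodeHom i (fun a => a.val ^ m * ((τ ^ m - τ ^ (-m)) / m)) := by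
    refine addMonoidHom_ext_mon fun j a => ?_
    rw [nodeHom_single, AddMonoidHom.comp_apply, monFam_single, AddMonoidHom.mk'_apply]
    rw [show scaleFam a.val (yFam (typeC l) j) = fun m => a.val ^ (-m) • yFam (typeC l) j m from rfl,
      bracket_smul_right, bracket_screenFam_yFam hl h]
    by_cases hj : i = j
    · simp [hj]
    · simp [hj, Ne.symm hj]
  exact DFunLike.congr_fun this M

theorem field_commutator (hl : 2 ≤ l) (hS : IsScreening i σ τ μ S) {M M₀ : Mon l} {s₁ s₂ : ℤ}
    (hs₁ : s₁ = -1 ∨ s₁ = 0 ∨ s₁ = 1) (hs₂ : s₂ = -1 ∨ s₂ = 0 ∨ s₂ = 1) {a₁ a₂ : Spec}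
    (hM₀ : ∀ a, M₀ (i, a) = 0)
    (hM : M = M₀ + Finsupp.single (i, a₁) s₁ + Finsupp.single (i, a₂) s₂)
    (hp : s₁ = 0 ∨ s₂ = 0 ∨ poleInv τ s₁ a₁.val ≠ poleInv τ s₂ a₂.val) (n : ℤ) (v : Fock l) :
    M.field (typeC l) n (S (Finsupp.single 0 v)) - S (M.field (typeC l) n (Finsupp.single 0 v)) =
      Finsupp.single μ (zeroVal (typeC l) 0 M •
        ((poleRes₂ τ s₁ a₁.val s₂ a₂.val * (poleInv τ s₁ a₁.val)⁻¹) •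
          normalExp (typeC l) (monFam (typeC l) M +
            scaleFam (poleInv τ s₁ a₁.val)⁻¹ (screenFam σ i)) (n - 1) v +
        (poleRes₂ τ s₂ a₂.val s₁ a₁.val * (poleInv τ s₂ a₂.val)⁻¹) •
          normalExp (typeC l) (monFam (typeC l) M +
            scaleFam (poleInv τ s₂ a₂.val)⁻¹ (screenFam σ i)) (n - 1) v)) := by
  have hnode : ∀ f : Spec → KFrac, nodeHom i f M = (s₁ : KFrac) * f a₁ + (s₂ : KFrac) * f a₂ := by
    intro f
    rw [hM, map_add, map_add, nodeHom_eq_zero hM₀, nodeHom_single, nodeHom_single, if_pos rfl,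
      if_pos rfl, zero_add, zsmul_eq_mul, zsmul_eq_mul]
  have hdeg : degAt i M = s₁ + s₂ := by
    rw [degAt, hM, map_add, map_add, nodeHom_eq_zero hM₀, nodeHom_single, nodeHom_single,
      if_pos rfl, if_pos rfl, zero_add, smul_eq_mul, smul_eq_mul, mul_one, mul_one]
  rw [← normalExp_commutator_two (typeC l) hS.pair.ne_zero.2 hs₁ hs₂ a₁.val_ne_zero a₂.val_ne_zero hp
    (fun m => by rw [bracket_monFam_screenFam hl hS.pair, hnode])
    (fun m => by rw [bracket_screenFam_monFam hl hS.pair, hnode]), hS.apply_single, field_single,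
    field_single, hS.apply_single, hS.zeroVal_eq, hdeg, ← Finsupp.single_sub, map_smul, smul_sub,
    smul_smul]

end ScreeningOperators

end
end DeformedW

namespace DeformedW
noncomputable section
open PowerSeries Finset.HasAntidiagonal

/-! ### Occupation numbers and positions -/

section Configurations

variable {l i : ℕ}

/-- The number of times the box `x` occurs. -/
def occ (j : Fin i → ℕ) (x : ℕ) : ℤ := ∑ α, if j α = x then 1 else 0

/-- The number of boxes below `x`. -/
def pos (j : Fin i → ℕ) (x : ℕ) : ℤ := ∑ α, if j α < x then 1 else 0

/-- The box `x` is moved to `x + 1` and conversely. -/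
def flip (x : ℕ) (j : Fin i → ℕ) : Fin i → ℕ := fun α =>
  if j α = x then x + 1 else if j α = x + 1 then x else j α

/-- The degree of the variable attached to the transition between the boxes `x` and `x + 1`. -/
def sgn (j : Fin i → ℕ) (x : ℕ) : ℤ := occ j x - occ j (x + 1)

theorem pos_succ (j : Fin i → ℕ) (x : ℕ) : pos j (x + 1) = pos j x + occ j x := by
  rw [pos, pos, occ, ← Finset.sum_add_distrib]
  refine Finset.sum_congr rfl fun α _ => ?_
  split_ifs <;> omega

theorem occ_cases {j : Fin i → ℕ} (hj : Function.Injective j) (x : ℕ) :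
    occ j x = 0 ∨ occ j x = 1 := by
  by_cases h : ∃ α, j α = x
  · obtain ⟨α, rfl⟩ := h
    right
    rw [occ, Finset.sum_eq_single α]
    · simp
    · intro β _ hβ
      rw [if_neg fun h => hβ (hj h)]
    · simp
  · left
    push Not at h
    exact Finset.sum_eq_zero fun α _ => if_neg (h α)

theorem occ_apply {j : Fin i → ℕ} (hj : Function.Injective j) (α : Fin i) : occ j (j α) = 1 := by
  rw [occ, Finset.sum_eq_single α]
  · simp
  · intro β _ hβ
    rw [if_neg fun h => hβ (hj h)]
  · simp

theorem exists_of_occ {j : Fin i → ℕ} {x : ℕ} (h : occ j x ≠ 0) : ∃ α, j α = x := by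
  by_contra h'
  push Not at h'
  exact h (Finset.sum_eq_zero fun α _ => if_neg (h' α))

theorem pos_apply {j : Fin i → ℕ} (hj : StrictMono j) (α : Fin i) : pos j (j α) = α := by
  have : pos j (j α) = ((Finset.univ.filter fun β : Fin i => β < α).card : ℤ) := by
    rw [pos, Finset.card_filter]
    push_cast
    refine Finset.sum_congr rfl fun β _ => ?_
    simp only [hj.lt_iff_lt]
  rw [this, show (Finset.univ.filter fun β : Fin i => β < α) = Finset.Iio α by ext β; simp,
    Fin.card_Iio]

theorem occ_eq_zero_of_lt {j : Fin i → ℕ} {x : ℕ} (h : ∀ α, j α ≠ x) : occ j x = 0 :=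
  Finset.sum_eq_zero fun α _ => if_neg (h α)

theorem occ_flip (x : ℕ) (j : Fin i → ℕ) (y : ℕ) : occ (flip x j) y =
    if y = x then occ j (x + 1) else if y = x + 1 then occ j x else occ j y := by
  split_ifs <;> refine Finset.sum_congr rfl fun α _ => ?_ <;> unfold flip <;> grind

theorem pos_flip (x : ℕ) (j : Fin i → ℕ) {y : ℕ} (h : y ≠ x + 1) :
    pos (flip x j) y = pos j y := by
  refine Finset.sum_congr rfl fun α _ => ?_
  unfold flip; grind

theorem flip_flip (x : ℕ) (j : Fin i → ℕ) : flip x (flip x j) = j := by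
  funext α
  unfold flip; grind

theorem flip_comm {x y : ℕ} (h : x + 1 < y ∨ y + 1 < x) (j : Fin i → ℕ) :
    flip x (flip y j) = flip y (flip x j) := by
  funext α
  unfold flip; grind

/-- A nonzero `sgn` excludes that both boxes are occupied, so no two entries are interchanged. -/
theorem strictMono_flip {j : Fin i → ℕ} (hj : StrictMono j) {x : ℕ} (h : sgn j x ≠ 0) :
    StrictMono (flip x j) := by
  intro α β hαβ
  have h1 := hj hαβ
  have h2 : ¬(j α = x ∧ j β = x + 1) := by
    rintro ⟨h2, h3⟩
    apply h
    rw [sgn, ← h3, ← h2, occ_apply hj.injective, occ_apply hj.injective, sub_self]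
  unfold flip
  split_ifs <;> omega

theorem sgn_flip_self (x : ℕ) (j : Fin i → ℕ) : sgn (flip x j) x = -sgn j x := by
  simp only [sgn, occ_flip]; grind

theorem sgn_flip_of_far {x y : ℕ} (h : x + 1 < y ∨ y + 1 < x) (j : Fin i → ℕ) :
    sgn (flip x j) y = sgn j y := by
  simp only [sgn, occ_flip]; grind

theorem height_flip (x : ℕ) (j : Fin i → ℕ) : height (flip x j) = height j + sgn j x := by
  rw [height, height, sgn, occ, occ, ← Finset.sum_sub_distrib, ← Finset.sum_add_distrib]
  refine Finset.sum_congr rfl fun α _ => ?_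
  unfold flip
  split_ifs <;> push_cast <;> omega

/-- In terms of `occ` and `pos` the condition is easy to follow under `flip`, which alters `pos`
only at `x + 1`. -/
theorem mem_indexSet {j : Fin i → ℕ} : j ∈ indexSet l i ↔
    (∀ α, 1 ≤ j α ∧ j α ≤ 2 * l) ∧ StrictMono j ∧ ∀ k : ℕ, 1 ≤ k → k ≤ l → occ j k = 1 →
      occ j (2 * l - k + 1) = 1 → (k : ℤ) - l + pos j (2 * l - k + 1) - pos j k ≠ 1 := by
  simp only [indexSet, Finset.mem_filter, Fintype.mem_piFinset, Finset.mem_Icc]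
  refine and_congr_right fun _ => and_congr_right fun hm => ?_
  constructor
  · intro h k h1 h2 h3 h4
    obtain ⟨α, hα⟩ := exists_of_occ (h3.trans_ne one_ne_zero)
    obtain ⟨β, hβ⟩ := exists_of_occ (h4.trans_ne one_ne_zero)
    have := h k α β h1 h2 hα hβ
    rw [← hβ, pos_apply hm, ← hα, pos_apply hm]
    rw [← hα] at this
    omega
  · intro h k α β h1 h2 hα hβ
    have h3 := occ_apply hm.injective α
    have h4 := occ_apply hm.injective β
    have h5 := pos_apply hm α
    have h6 := pos_apply hm β
    rw [hα] at h3 h5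
    rw [hβ] at h4 h6
    have := h k h1 h2 h3 h4
    omega

theorem flip_mem_of {j : Fin i → ℕ} (hj : j ∈ indexSet l i) {x : ℕ} (h1 : 1 ≤ x)
    (h2 : x + 1 ≤ 2 * l) (hx : sgn j x ≠ 0)
    (h : ∀ k : ℕ, 1 ≤ k → k ≤ l → (k = x ∨ k = x + 1 ∨ 2 * l - k = x ∨ 2 * l - k + 1 = x) →
      occ (flip x j) k = 1 → occ (flip x j) (2 * l - k + 1) = 1 →
      (k : ℤ) - l + pos (flip x j) (2 * l - k + 1) - pos (flip x j) k ≠ 1) :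
    flip x j ∈ indexSet l i := by
  rw [mem_indexSet] at hj ⊢
  refine ⟨fun α => ?_, strictMono_flip hj.2.1 hx, fun k hk1 hk2 h3 h4 => ?_⟩
  · have := hj.1 α
    unfold flip
    split_ifs <;> omega
  · by_cases hk : k = x ∨ k = x + 1 ∨ 2 * l - k = x ∨ 2 * l - k + 1 = x
    · exact h k hk1 hk2 hk h3 h4
    · push Not at hk
      rw [occ_flip, if_neg (by omega), if_neg (by omega)] at h3 h4
      rw [pos_flip _ _ (by omega), pos_flip _ _ (by omega)]
      exact hj.2.2 k hk1 hk2 h3 h4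

/-- The local data at a node `k < l`. -/
theorem local_data {j : Fin i → ℕ} (hj : j ∈ indexSet l i) {k : ℕ} (h1 : 1 ≤ k) (h2 : k < l) :
    (occ j k = 1 → occ j (2 * l - k + 1) = 1 →
      (k : ℤ) - l + (pos j (2 * l - k) + occ j (2 * l - k)) - pos j k ≠ 1) ∧
    (occ j (k + 1) = 1 → occ j (2 * l - k) = 1 →
      (k : ℤ) + 1 - l + pos j (2 * l - k) - (pos j k + occ j k) ≠ 1) := by
  rw [mem_indexSet] at hj
  have a := hj.2.2 k h1 h2.le
  have b := hj.2.2 (k + 1) (by omega) h2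
  rw [pos_succ] at a
  rw [show 2 * l - (k + 1) + 1 = 2 * l - k by omega, pos_succ] at b
  push_cast at b
  exact ⟨a, b⟩

/-- Only the pairs of `k` and of `k + 1` with their conjugates are affected. Both are expressed
through the positions at `k` and `2 l - k`, which the move leaves alone. -/
theorem flip_left_mem_iff {j : Fin i → ℕ} (hj : j ∈ indexSet l i) {k : ℕ} (h1 : 1 ≤ k) (h2 : k < l)
    (hx : sgn j k ≠ 0) : flip k j ∈ indexSet l i ↔
    (occ j (k + 1) = 1 → occ j (2 * l - k + 1) = 1 →
      (k : ℤ) - l + (pos j (2 * l - k) + occ j (2 * l - k)) - pos j k ≠ 1) ∧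
    (occ j k = 1 → occ j (2 * l - k) = 1 →
      (k : ℤ) + 1 - l + pos j (2 * l - k) - (pos j k + occ j (k + 1)) ≠ 1) := by
  have e1 : occ (flip k j) k = occ j (k + 1) := by rw [occ_flip, if_pos rfl]
  have e2 : occ (flip k j) (k + 1) = occ j k := by rw [occ_flip, if_neg (by omega), if_pos rfl]
  have e3 : occ (flip k j) (2 * l - k) = occ j (2 * l - k) := by
    rw [occ_flip, if_neg (by omega), if_neg (by omega)]
  have e4 : occ (flip k j) (2 * l - k + 1) = occ j (2 * l - k + 1) := by
    rw [occ_flip, if_neg (by omega), if_neg (by omega)]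
  have e5 : pos (flip k j) k = pos j k := pos_flip _ _ (by omega)
  have e6 : pos (flip k j) (2 * l - k) = pos j (2 * l - k) := pos_flip _ _ (by omega)
  constructor
  · intro h
    have := local_data h h1 h2
    rwa [e1, e2, e3, e4, e5, e6] at this
  · rintro ⟨a, b⟩
    refine flip_mem_of hj h1 (by omega) hx fun k' h3 h4 hk h5 h6 => ?_
    obtain rfl | rfl : k' = k ∨ k' = k + 1 := by omega
    · rw [e1] at h5
      rw [e4] at h6
      rw [pos_succ, e5, e6, e3]
      exact a h5 h6
    · rw [show 2 * l - (k + 1) + 1 = 2 * l - k by omega] at h6 ⊢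
      rw [e2] at h5
      rw [e3] at h6
      rw [pos_succ, e5, e6, e1]
      push_cast
      exact b h5 h6

theorem flip_right_mem_iff {j : Fin i → ℕ} (hj : j ∈ indexSet l i) {k : ℕ} (h1 : 1 ≤ k) (h2 : k < l)
    (hx : sgn j (2 * l - k) ≠ 0) : flip (2 * l - k) j ∈ indexSet l i ↔
    (occ j k = 1 → occ j (2 * l - k) = 1 →
      (k : ℤ) - l + (pos j (2 * l - k) + occ j (2 * l - k + 1)) - pos j k ≠ 1) ∧
    (occ j (k + 1) = 1 → occ j (2 * l - k + 1) = 1 →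
      (k : ℤ) + 1 - l + pos j (2 * l - k) - (pos j k + occ j k) ≠ 1) := by
  set x := 2 * l - k with hxk
  have e1 : occ (flip x j) k = occ j k := by rw [occ_flip, if_neg (by omega), if_neg (by omega)]
  have e2 : occ (flip x j) (k + 1) = occ j (k + 1) := by
    rw [occ_flip, if_neg (by omega), if_neg (by omega)]
  have e3 : occ (flip x j) x = occ j (x + 1) := by rw [occ_flip, if_pos rfl]
  have e4 : occ (flip x j) (x + 1) = occ j x := by
    rw [occ_flip, if_neg (by omega), if_pos rfl]
  have e5 : pos (flip x j) k = pos j k := pos_flip _ _ (by omega)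
  have e6 : pos (flip x j) x = pos j x := pos_flip _ _ (by omega)
  constructor
  · intro h
    have := local_data h h1 h2
    rwa [← hxk, e1, e2, e3, e4, e5, e6] at this
  · rintro ⟨a, b⟩
    refine flip_mem_of hj (by omega) (by omega) hx fun k' h3 h4 hk h5 h6 => ?_
    obtain rfl | rfl : k' = k ∨ k' = k + 1 := by omega
    · rw [← hxk] at h6 ⊢
      rw [e1] at h5
      rw [e4] at h6
      rw [pos_succ, e5, e6, e3]
      exact a h5 h6
    · rw [show 2 * l - (k + 1) + 1 = x by omega] at h6 ⊢
      rw [e2] at h5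
      rw [e3] at h6
      rw [pos_succ, e5, e6, e1]
      push_cast
      exact b h5 h6

/-- The only pair involved is `l`, `l + 1`, of which exactly one box is occupied before and after
the move. -/
theorem flip_mid_mem {j : Fin i → ℕ} (hj : j ∈ indexSet l i) (hl : 2 ≤ l) (hx : sgn j l ≠ 0) :
    flip l j ∈ indexSet l i := by
  refine flip_mem_of hj (by omega) (by omega) hx fun k h3 h4 hk h5 h6 => ?_
  obtain rfl : k = l := by omega
  rw [show 2 * k - k + 1 = k + 1 by omega, occ_flip, if_neg (by omega), if_pos rfl] at h6
  rw [occ_flip, if_pos rfl] at h5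
  exact absurd (by rw [sgn, h5, h6, sub_self]) hx

end Configurations

end
end DeformedW

namespace DeformedW
noncomputable section
open PowerSeries Finset.HasAntidiagonal

/-! ### The exponents of the explicit monomials -/

section Exponents

variable {l i : ℕ}

/-- The transitions `x → x + 1` at which the node `κ` enters. -/
def nodeSlots (κ : Fin l) : Finset ℕ := {(κ : ℕ) + 1, 2 * l - ((κ : ℕ) + 1)}

/-- The parameter of the variable with exponent `1` produced by the box `x` at the position `p`. -/
def slot (l i x : ℕ) (p : ℤ) : Spec :=
  (1, -((x : ℤ) + i - 2 - 2 * p) - (if l < x then 2 else 0), (x : ℤ) + i - 2 - 2 * p)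

/-- The parameter of the variable with exponent `-1` produced by the box `x + 1` at the
position `p`. -/
def slotNeg (l i x : ℕ) (p : ℤ) : Spec :=
  (1, -((x : ℤ) + i - 2 - 2 * p) - (if l < x then 2 else 0) - (if x = l then 4 else 2),
    (x : ℤ) + i - 2 - 2 * p + 2)

/-- The parameter of the variable attached to the transition `x → x + 1`. -/
def slotSpec (l : ℕ) (j : Fin i → ℕ) (x : ℕ) : Spec :=
  (1, -((x : ℤ) + i - 2 - 2 * pos j x) - (if l < x then 2 else 0)
    - (if x = l then 4 else 2) * (1 - occ j x), (x : ℤ) + i - 2 - 2 * pos j x + 2 * (1 - occ j x))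

theorem spec_eq_iff (c c' : ℂˣ) (m m' n n' : ℤ) :
    ((c, m, n) : Spec) = (c', m', n') ↔ c = c' ∧ m = m' ∧ n = n' := by simp

theorem yMon_apply (k : ℕ) (a : Spec) (m n : ℤ) (κ : Fin l) (b : Spec) :
    yMon l k a m n (κ, b) = if k = (κ : ℕ) + 1 ∧ b = a.shift m n then 1 else 0 := by
  have := κ.2
  unfold yMon
  split_ifs with h1 h2 h2
  · obtain ⟨h3, rfl⟩ := h2
    have : (⟨k - 1, by omega⟩ : Fin l) = κ := by ext; simp; omega
    rw [this, Finsupp.single_eq_same]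
  · rw [Finsupp.single_apply, if_neg]
    rintro h
    simp only [Prod.mk.injEq, Fin.ext_iff] at h
    exact h2 ⟨by omega, h.2.symm⟩
  · omega
  · rfl

theorem sum_nodeSlots {A : Type*} [AddCommMonoid A] (κ : Fin l) (f : ℕ → A) :
    ∑ x ∈ nodeSlots κ, f x =
      f ((κ : ℕ) + 1) + if (κ : ℕ) + 1 = l then 0 else f (2 * l - ((κ : ℕ) + 1)) := by
  unfold nodeSlots
  split_ifs with h
  · rw [show 2 * l - ((κ : ℕ) + 1) = (κ : ℕ) + 1 by omega]; simp
  · rw [Finset.sum_pair (by have := κ.2; omega)]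

theorem lambdaBox_apply {y : ℕ} (h1 : 1 ≤ y) (h2 : y ≤ 2 * l) (α : ℤ) (κ : Fin l) (b : Spec) :
    lambdaBox l y (1, -((i : ℤ) - 1 - 2 * α), (i : ℤ) - 1 - 2 * α) (κ, b) =
      ∑ x ∈ nodeSlots κ, ((if y = x ∧ b = slot l i x α then 1 else 0) -
        (if y = x + 1 ∧ b = slotNeg l i x α then 1 else 0)) := by
  obtain ⟨c, m, n⟩ := b
  have hκ := κ.2
  rw [sum_nodeSlots, lambdaBox]
  have key : ∀ {P Q P' Q' R R' : Prop} [Decidable P] [Decidable Q] [Decidable P'] [Decidable Q']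
      [Decidable R] [Decidable R'], (P ↔ P' ∨ R) → (Q ↔ Q' ∨ R') → ¬(P' ∧ R) → ¬(Q' ∧ R') →
      ((if P then 1 else 0) - (if Q then 1 else 0) : ℤ) = ((if P' then 1 else 0) -
        (if Q' then 1 else 0)) + ((if R then 1 else 0) - (if R' then 1 else 0)) := by
    intro P Q P' Q' R R' _ _ _ _ _ _ h1 h2 h3 h4
    by_cases P' <;> by_cases Q' <;> by_cases R <;> by_cases R' <;> simp_all
  -- At the last node the two slots coincide, and the second one must not be counted.
  have e : (if (κ : ℕ) + 1 = l then (0 : ℤ) else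
      (if y = 2 * l - ((κ : ℕ) + 1) ∧ (c, m, n) = slot l i (2 * l - ((κ : ℕ) + 1)) α then 1 else 0) -
      (if y = 2 * l - ((κ : ℕ) + 1) + 1 ∧ (c, m, n) = slotNeg l i (2 * l - ((κ : ℕ) + 1)) α
        then 1 else 0)) =
      (if (κ : ℕ) + 1 ≠ l ∧ y = 2 * l - ((κ : ℕ) + 1) ∧
        (c, m, n) = slot l i (2 * l - ((κ : ℕ) + 1)) α then 1 else 0) -
      (if (κ : ℕ) + 1 ≠ l ∧ y = 2 * l - ((κ : ℕ) + 1) + 1 ∧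
        (c, m, n) = slotNeg l i (2 * l - ((κ : ℕ) + 1)) α then 1 else 0) := by
    by_cases h : (κ : ℕ) + 1 = l
    · rw [if_pos h, if_neg (by tauto), if_neg (by tauto), sub_zero]
    · rw [if_neg h]
      simp only [ne_eq, h, not_false_eq_true, true_and]
  rw [e]
  by_cases hy : y ≤ l
  · rw [if_pos hy, Finsupp.sub_apply, yMon_apply, yMon_apply]
    simp only [slot, slotNeg, spec_eq_iff, Spec.shift]
    refine key ⟨?_, ?_⟩ ⟨?_, ?_⟩ ?_ ?_
    · rintro ⟨h3, h4, h5, h6⟩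
      exact Or.inl ⟨h3, h4, by split_ifs <;> omega, by omega⟩
    · rintro (⟨h3, h4, h5, h6⟩ | ⟨h0, h3, h4, h5, h6⟩)
      · exact ⟨h3, h4, by split_ifs at h5 <;> omega, by omega⟩
      · omega
    · rintro ⟨h3, h4, h5, h6⟩
      exact Or.inl ⟨by omega, h4, by split_ifs <;> omega, by omega⟩
    · rintro (⟨h3, h4, h5, h6⟩ | ⟨h0, h3, h4, h5, h6⟩)
      · exact ⟨by omega, h4, by split_ifs at h5 <;> omega, by omega⟩
      · omega
    · omega
    · omega
  · rw [if_neg hy]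
    dsimp only
    rw [Finsupp.sub_apply, yMon_apply, yMon_apply]
    simp only [slot, slotNeg, spec_eq_iff, Spec.shift]
    refine key ⟨?_, ?_⟩ ⟨?_, ?_⟩ ?_ ?_
    · rintro ⟨h3, h4, h5, h6⟩
      exact Or.inr ⟨by omega, by omega, h4, by split_ifs <;> omega, by omega⟩
    · rintro (⟨h3, h4, h5, h6⟩ | ⟨h0, h3, h4, h5, h6⟩)
      · omega
      · exact ⟨by omega, h4, by split_ifs at h5 <;> omega, by omega⟩
    · rintro ⟨h3, h4, h5, h6⟩
      by_cases h : (κ : ℕ) + 1 = l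
      · exact Or.inl ⟨by omega, h4, by split_ifs <;> omega, by omega⟩
      · exact Or.inr ⟨by omega, by omega, h4, by split_ifs <;> omega, by omega⟩
    · rintro (⟨h3, h4, h5, h6⟩ | ⟨h0, h3, h4, h5, h6⟩)
      · exact ⟨by omega, h4, by split_ifs at h5 <;> omega, by omega⟩
      · exact ⟨by omega, h4, by split_ifs at h5 <;> omega, by omega⟩
    · omega
    · omega

/-- Each transition carries at most one variable. If `x` and `x + 1` are both occupied, they are at
consecutive positions and the two variables cancel, provided `x ≠ l`. For `x = l` the parameters
would differ, but this pair is excluded from `S`: it has value `1`. -/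
theorem lambdaMon_apply {j : Fin i → ℕ} (hl : 2 ≤ l) (hj : j ∈ indexSet l i) (κ : Fin l)
    (b : Spec) : lambdaMon l i j (κ, b) =
      ∑ x ∈ nodeSlots κ, if b = slotSpec l j x then sgn j x else 0 := by
  have hj' := mem_indexSet.1 hj
  have hκ := κ.2
  have hinj := hj'.2.1.injective
  rw [lambdaMon, Finsupp.finsetSum_apply,
    Finset.sum_congr rfl fun α _ => lambdaBox_apply (hj'.1 α).1 (hj'.1 α).2 (α : ℤ) κ b,
    Finset.sum_comm]
  refine Finset.sum_congr rfl fun x hx => ?_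
  have hx' : 1 ≤ x ∧ x ≤ 2 * l - 1 := by
    simp only [nodeSlots, Finset.mem_insert, Finset.mem_singleton] at hx
    omega
  have e1 : ∑ α, (if j α = x ∧ b = slot l i x (α : ℕ) then (1 : ℤ) else 0) =
      if b = slot l i x (pos j x) then occ j x else 0 := by
    have : ∀ α, (if j α = x ∧ b = slot l i x (α : ℕ) then (1 : ℤ) else 0) =
        if b = slot l i x (pos j x) then (if j α = x then 1 else 0) else 0 := by
      intro α
      by_cases h : j α = x
      · rw [← pos_apply hj'.2.1 α, h]; simp
      · simp [h]
    rw [Finset.sum_congr rfl fun α _ => this α, occ]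
    split_ifs <;> simp
  have e2 : ∑ α, (if j α = x + 1 ∧ b = slotNeg l i x (α : ℕ) then (1 : ℤ) else 0) =
      if b = slotNeg l i x (pos j (x + 1)) then occ j (x + 1) else 0 := by
    have : ∀ α, (if j α = x + 1 ∧ b = slotNeg l i x (α : ℕ) then (1 : ℤ) else 0) =
        if b = slotNeg l i x (pos j (x + 1)) then (if j α = x + 1 then 1 else 0) else 0 := by
      intro α
      by_cases h : j α = x + 1
      · rw [← pos_apply hj'.2.1 α, h]; simp
      · simp [h]
    rw [Finset.sum_congr rfl fun α _ => this α, occ]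
    split_ifs <;> simp
  rw [Finset.sum_sub_distrib, e1, e2, pos_succ]
  obtain ⟨c, m, n⟩ := b
  simp only [slot, slotNeg, slotSpec, spec_eq_iff, sgn]
  by_cases hc : c = 1
  · have h3 : x = l → ¬(occ j x = 1 ∧ occ j (x + 1) = 1) := by
      rintro rfl ⟨h, h'⟩
      have := hj'.2.2 x (by omega) le_rfl h (by rwa [show 2 * x - x + 1 = x + 1 by omega])
      rw [show 2 * x - x + 1 = x + 1 by omega, pos_succ, h] at this
      omega
    simp only [hc, true_and]
    generalize pos j x = p at *
    rcases occ_cases hinj x with h | h <;> rcases occ_cases hinj (x + 1) with h' | h' <;>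
      simp only [h, h', ite_self] at h3 ⊢
    · simp
    · by_cases hxl : x = l
      · simp only [hxl, if_true]; split_ifs <;> omega
      · simp only [hxl, if_false]; split_ifs <;> omega
    · split_ifs <;> omega
    · by_cases hxl : x = l
      · simp [hxl] at h3
      · simp only [hxl, if_false]; split_ifs <;> omega
  · simp [hc]

/-- The sum of the exponents of `q` and `t` of the variable attached to a transition determines the
transition among those at the same node. -/
theorem lambdaMon_apply_slot {j : Fin i → ℕ} (hl : 2 ≤ l) (hj : j ∈ indexSet l i) {κ : Fin l}
    {x : ℕ} (hx : x ∈ nodeSlots κ) {b : Spec}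
    (hb : x ≠ l → b.2.1 + b.2.2 = if l < x then -2 else 0) :
    lambdaMon l i j (κ, b) = if b = slotSpec l j x then sgn j x else 0 := by
  have hκ := κ.2
  rw [lambdaMon_apply hl hj, Finset.sum_eq_single x]
  · intro y hy hyx
    rw [if_neg]
    rintro rfl
    simp only [nodeSlots, Finset.mem_insert, Finset.mem_singleton] at hx hy
    simp only [slotSpec] at hb
    have h1 : x ≠ l := by omega
    have h2 : y ≠ l := by omega
    have hb := hb h1
    rw [if_neg h2] at hb
    split_ifs at hb <;> omega
  · exact fun h => absurd hx h

end Exponents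

end
end DeformedW

namespace DeformedW
noncomputable section
open PowerSeries Finset.HasAntidiagonal

/-! ### Moving a box -/

section Moves

variable {l i : ℕ}

theorem aMon_apply (g : CartanData l) (κ κ' : Fin l) (a b : Spec) : aMon g κ a (κ', b) =
    (if κ' = κ ∧ b = a.shift (g.d κ) (-1) then 1 else 0) +
    (if κ' = κ ∧ b = a.shift (-(g.d κ : ℤ)) 1 then 1 else 0) -
    ∑ s ∈ Finset.range (incidence g κ' κ).toNat,
      if b = a.shift (incidence g κ' κ - 1 - 2 * s) 0 then 1 else 0 := by
  rw [aMon, Finsupp.sub_apply, Finsupp.add_apply, Finsupp.finsetSum_apply,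
    Finset.sum_eq_single κ']
  · rw [Finsupp.finsetSum_apply]
    simp only [Finsupp.single_apply, Prod.mk.injEq, true_and, eq_comm]
  · intro i _ hi
    rw [Finsupp.finsetSum_apply]
    refine Finset.sum_eq_zero fun s _ => ?_
    rw [Finsupp.single_apply, if_neg]
    intro h
    exact hi (Prod.mk.injEq .. ▸ h).1
  · simp

theorem aMon_eq_of_lt {κ : Fin l} (h : (κ : ℕ) + 1 < l) (a : Spec) : aMon (typeC l) κ a =
    yMon l (κ + 1) a 1 (-1) + yMon l (κ + 1) a (-1) 1 - yMon l κ a 0 0 - yMon l (κ + 2) a 0 0 := by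
  refine Finsupp.ext fun ⟨κ', b⟩ => ?_
  have hd : (typeC l).d κ = 1 := by rw [typeC_d, if_neg (by omega)]
  have hκ' := κ'.2
  rw [aMon_apply, hd, typeC_incidence, Finsupp.sub_apply, Finsupp.sub_apply, Finsupp.add_apply,
    yMon_apply, yMon_apply, yMon_apply, yMon_apply]
  simp only [Fin.ext_iff]
  by_cases h1 : (κ : ℕ) = κ'
  · simp [h1]
  by_cases h2 : (κ : ℕ) = κ' + 1
  · rw [if_neg h1, if_pos h2, if_neg (by omega : ¬(κ : ℕ) + 1 = l), if_neg (by omega), show (1 : ℤ).toNat = 1 from rfl,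
      Finset.sum_range_one]
    simp [h2]
  by_cases h3 : (κ : ℕ) + 1 = κ'
  · rw [if_neg h1, if_neg h2, if_pos h3, show (1 : ℤ).toNat = 1 from rfl, Finset.sum_range_one]
    simp [← h3]
    omega
  · rw [if_neg h1, if_neg h2, if_neg h3]
    rw [if_neg (by omega), if_neg (by omega), if_neg (by omega), if_neg (by omega),
      if_neg (by omega), if_neg (by omega)]
    rfl

theorem aMon_eq_of_eq {κ : Fin l} (hl : 2 ≤ l) (h : (κ : ℕ) + 1 = l) (a : Spec) :
    aMon (typeC l) κ a = yMon l l a 2 (-1) + yMon l l a (-2) 1 - yMon l (l - 1) a 1 0 -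
      yMon l (l - 1) a (-1) 0 := by
  refine Finsupp.ext fun ⟨κ', b⟩ => ?_
  have hd : (typeC l).d κ = 2 := by rw [typeC_d, if_pos h]
  have hκ' := κ'.2
  rw [aMon_apply, hd, typeC_incidence, Finsupp.sub_apply, Finsupp.sub_apply, Finsupp.add_apply,
    yMon_apply, yMon_apply, yMon_apply, yMon_apply]
  simp only [Fin.ext_iff]
  by_cases h1 : (κ : ℕ) = κ'
  · rw [if_pos h1, if_neg (c := l - 1 = _ ∧ _) (by omega), if_neg (c := l - 1 = _ ∧ _) (by omega)]
    simp [← h1, h]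
  by_cases h2 : (κ : ℕ) = κ' + 1
  · have e : l - 1 = (κ' : ℕ) + 1 := by omega
    have e' : l ≠ (κ' : ℕ) + 1 := by omega
    rw [if_neg h1, if_pos h2, if_pos h, show (2 : ℤ).toNat = 2 from rfl, Finset.sum_range_succ,
      Finset.sum_range_one]
    simp [e, e', Ne.symm h1]
    ring
  · rw [if_neg h1, if_neg h2, if_neg (by omega : ¬ (κ : ℕ) + 1 = κ')]
    rw [if_neg (by omega), if_neg (by omega), if_neg (by omega), if_neg (by omega),
      if_neg (by omega), if_neg (by omega)]
    rfl

theorem yMon_congr {k k' : ℕ} {c : ℂˣ} {m n m' n' u v u' v' : ℤ} (hk : k = k')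
    (h : m + u = m' + u') (h' : n + v = n' + v') :
    yMon l k (c, m, n) u v = yMon l k' (c, m', n') u' v' := by
  subst hk
  simp only [yMon, Spec.shift, h, h']

theorem nodeSlots_iff {κ : Fin l} {x : ℕ} :
    x ∈ nodeSlots κ ↔ x = (κ : ℕ) + 1 ∨ x = 2 * l - ((κ : ℕ) + 1) := by
  simp [nodeSlots]

/-- Consecutive boxes differ by one `A`; the shifts in the definition of `Λ_x` are chosen for this.
-/
theorem lambdaBox_sub_succ (hl : 2 ≤ l) {κ : Fin l} {x : ℕ} (hx : x ∈ nodeSlots κ) (α : ℤ) :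
    lambdaBox l x (1, -((i : ℤ) - 1 - 2 * α), (i : ℤ) - 1 - 2 * α) -
      lambdaBox l (x + 1) (1, -((i : ℤ) - 1 - 2 * α), (i : ℤ) - 1 - 2 * α) =
    aMon (typeC l) κ ((slot l i x α).shift (-((typeC l).d κ : ℤ)) 1) := by
  have hκ := κ.2
  rw [nodeSlots_iff] at hx
  have key : ∀ {a b c d a' b' c' d' : Mon l}, a = a' → b = b' → c = c' → d = d' →
      a - b - (c - d) = a' + d' - b' - c' := by
    rintro a b c d _ _ _ _ rfl rfl rfl rfl
    abel
  by_cases hk : (κ : ℕ) + 1 = l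
  · have hxl : x = l := by omega
    subst hxl
    rw [aMon_eq_of_eq hl hk, lambdaBox, lambdaBox, if_pos le_rfl, if_neg (by omega), typeC_d,
      if_pos hk, slot, if_neg (lt_irrefl _), Spec.shift]
    dsimp only
    exact key (yMon_congr (by omega) (by omega) (by omega))
      (yMon_congr (by omega) (by omega) (by omega))
      (yMon_congr (by omega) (by push_cast; omega) (by push_cast; omega))
      (yMon_congr (by omega) (by push_cast; omega) (by push_cast; omega))
  · rw [aMon_eq_of_lt (by omega), lambdaBox, lambdaBox, typeC_d, if_neg hk, slot, Spec.shift]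
    rcases hx with hx | hx
    · rw [if_pos (by omega), if_pos (by omega), if_neg (by omega)]
      dsimp only
      exact key (yMon_congr (by omega) (by omega) (by omega))
        (yMon_congr (by omega) (by omega) (by omega))
        (yMon_congr (by omega) (by push_cast; omega) (by push_cast; omega))
        (yMon_congr (by omega) (by push_cast; omega) (by push_cast; omega))
    · rw [if_neg (by omega), if_neg (by omega), if_pos (by omega)]
      dsimp only
      rw [sub_right_comm (_ + _)]
      exact key (yMon_congr (by omega) (by push_cast; omega) (by push_cast; omega))
        (yMon_congr (by omega) (by push_cast; omega) (by push_cast; omega))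
        (yMon_congr (by omega) (by push_cast; omega) (by push_cast; omega))
        (yMon_congr (by omega) (by push_cast; omega) (by push_cast; omega))

theorem lambdaMon_flip (hl : 2 ≤ l) {j : Fin i → ℕ} (hj : StrictMono j) {κ : Fin l} {x : ℕ}
    (hx : x ∈ nodeSlots κ) (h : sgn j x = 1) :
    lambdaMon l i (flip x j) = expand (typeC l) (lambdaMon l i j) κ (slotSpec l j x) := by
  have h1 : occ j x = 1 ∧ occ j (x + 1) = 0 := by
    have := occ_cases hj.injective x
    have := occ_cases hj.injective (x + 1)
    unfold sgn at h
    omega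
  obtain ⟨α, hα⟩ := exists_of_occ (h1.1.trans_ne one_ne_zero)
  have hp : pos j x = α := by rw [← hα, pos_apply hj]
  have hs : slotSpec l j x = slot l i x α := by
    rw [slotSpec, slot, hp, h1.1, sub_self, mul_zero, mul_zero, sub_zero, add_zero]
  rw [expand, hs, ← lambdaBox_sub_succ hl hx, lambdaMon, lambdaMon, eq_sub_iff_add_eq,
    ← Finset.add_sum_erase _ _ (Finset.mem_univ α), ← Finset.add_sum_erase _ _ (Finset.mem_univ α)]
  have h2 : flip x j α = x + 1 := by rw [flip, if_pos hα]
  have h3 : ∀ β ∈ Finset.univ.erase α, flip x j β = j β := by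
    intro β hβ
    have hne : j β ≠ x := fun e => (Finset.mem_erase.1 hβ).1 (hj.injective (e.trans hα.symm))
    have hne' : j β ≠ x + 1 := by
      intro e
      have := occ_apply hj.injective β
      rw [e, h1.2] at this
      omega
    rw [flip, if_neg hne, if_neg hne']
  rw [Finset.sum_congr rfl fun β hβ => by rw [h3 β hβ], h2, hα]
  abel

end Moves

end
end DeformedW

namespace DeformedW
noncomputable section
open PowerSeries Finset.HasAntidiagonal

/-! ### The variables at one node -/

section LocalStructure

variable {l i : ℕ}

theorem slotSpec_left {k : ℕ} (h : k < l) (j : Fin i → ℕ) : slotSpec l j k =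
    (1, -((k : ℤ) + i - 2 - 2 * pos j k) - 2 * (1 - occ j k),
      (k : ℤ) + i - 2 - 2 * pos j k + 2 * (1 - occ j k)) := by
  rw [slotSpec, if_neg (by omega), if_neg (by omega), sub_zero]

theorem slotSpec_right {k : ℕ} (h : k < l) (j : Fin i → ℕ) : slotSpec l j (2 * l - k) =
    (1, -(2 * (l : ℤ) - k + i - 2 - 2 * pos j (2 * l - k)) - 2 - 2 * (1 - occ j (2 * l - k)),
      2 * (l : ℤ) - k + i - 2 - 2 * pos j (2 * l - k) + 2 * (1 - occ j (2 * l - k))) := by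
  rw [slotSpec, if_pos (by omega), if_neg (by omega), show ((2 * l - k : ℕ) : ℤ) = 2 * l - k by omega]

theorem occ_of_sgn {j : Fin i → ℕ} (hj : Function.Injective j) {x : ℕ} :
    (sgn j x = 1 → occ j x = 1 ∧ occ j (x + 1) = 0) ∧
    (sgn j x = -1 → occ j x = 0 ∧ occ j (x + 1) = 1) ∧
    (sgn j x = 1 ∨ sgn j x = 0 ∨ sgn j x = -1) := by
  have := occ_cases hj x
  have := occ_cases hj (x + 1)
  unfold sgn
  omega

theorem slotSpec_flip_self (j : Fin i → ℕ) {κ : Fin l} {x : ℕ} (hx : x ∈ nodeSlots κ)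
    (h : occ j x = 1 ∧ occ j (x + 1) = 0) :
    slotSpec l (flip x j) x = (slotSpec l j x).shift (-2 * (typeC l).d κ) 2 := by
  have hκ := κ.2
  rw [nodeSlots_iff] at hx
  rw [slotSpec, slotSpec, pos_flip _ _ (by omega), occ_flip, if_pos rfl, h.1, h.2, typeC_d,
    Spec.shift, spec_eq_iff]
  refine ⟨rfl, ?_, by ring⟩
  by_cases hxl : x = l
  · rw [if_pos hxl, if_pos (by omega : (κ : ℕ) + 1 = l)]; push_cast; ring
  · rw [if_neg hxl, if_neg (by omega : ¬(κ : ℕ) + 1 = l)]; push_cast; ring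

theorem slotSpec_flip_of_far (j : Fin i → ℕ) {x y : ℕ} (h : x + 1 < y ∨ y + 1 < x) :
    slotSpec l (flip x j) y = slotSpec l j y := by
  have : occ (flip x j) y = occ j y := by rw [occ_flip, if_neg (by omega), if_neg (by omega)]
  rw [slotSpec, slotSpec, pos_flip _ _ (by omega), this]

/-- The move can create the pair `k + 1`, `2 l - k`. If `2 l - k + 1` is occupied too, the new pair
only replaces `k`, `2 l - k + 1` and has the same value, hence is allowed. What remains is a newly
created pair of value `1`. The three companion statements have the same proof. -/
theorem flip_mem_left_iff_of_sgn {j : Fin i → ℕ} (hj : j ∈ indexSet l i) {k : ℕ} (h1 : 1 ≤ k)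
    (h2 : k < l) (hx : sgn j k = 1) : flip k j ∈ indexSet l i ↔
    ¬(sgn j (2 * l - k) = 1 ∧ (k : ℤ) - l + pos j (2 * l - k) - pos j k = 0) := by
  have hinj := (mem_indexSet.1 hj).2.1.injective
  rw [flip_left_mem_iff hj h1 h2 (by omega)]
  have := (occ_of_sgn hinj).1 hx
  have := occ_cases hinj (2 * l - k)
  have := occ_cases hinj (2 * l - k + 1)
  have := local_data hj h1 h2
  unfold sgn at *
  omega

theorem flip_mem_right_iff_of_sgn {j : Fin i → ℕ} (hj : j ∈ indexSet l i) {k : ℕ} (h1 : 1 ≤ k)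
    (h2 : k < l) (hx : sgn j (2 * l - k) = 1) : flip (2 * l - k) j ∈ indexSet l i ↔
    ¬(sgn j k = 1 ∧ (k : ℤ) - l + pos j (2 * l - k) - pos j k = 1) := by
  have hinj := (mem_indexSet.1 hj).2.1.injective
  rw [flip_right_mem_iff hj h1 h2 (by omega)]
  have := (occ_of_sgn hinj).1 hx
  have := occ_cases hinj k
  have := occ_cases hinj (k + 1)
  have := local_data hj h1 h2
  unfold sgn at *
  omega

theorem flip_mem_left_iff_of_sgn_neg {j : Fin i → ℕ} (hj : j ∈ indexSet l i) {k : ℕ} (h1 : 1 ≤ k)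
    (h2 : k < l) (hx : sgn j k = -1) : flip k j ∈ indexSet l i ↔
    ¬(sgn j (2 * l - k) = -1 ∧ (k : ℤ) - l + pos j (2 * l - k) - pos j k = 1) := by
  have hinj := (mem_indexSet.1 hj).2.1.injective
  rw [flip_left_mem_iff hj h1 h2 (by omega)]
  have := (occ_of_sgn hinj).2.1 hx
  have := occ_cases hinj (2 * l - k)
  have := occ_cases hinj (2 * l - k + 1)
  have := local_data hj h1 h2
  unfold sgn at *
  omega

theorem flip_mem_right_iff_of_sgn_neg {j : Fin i → ℕ} (hj : j ∈ indexSet l i) {k : ℕ} (h1 : 1 ≤ k)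
    (h2 : k < l) (hx : sgn j (2 * l - k) = -1) : flip (2 * l - k) j ∈ indexSet l i ↔
    ¬(sgn j k = -1 ∧ (k : ℤ) - l + pos j (2 * l - k) - pos j k = 0) := by
  have hinj := (mem_indexSet.1 hj).2.1.injective
  rw [flip_right_mem_iff hj h1 h2 (by omega)]
  have := (occ_of_sgn hinj).2.1 hx
  have := occ_cases hinj k
  have := occ_cases hinj (k + 1)
  have := local_data hj h1 h2
  unfold sgn at *
  omega

/-- Opposite signs at a node are subject to a condition. -/
theorem ne_of_sgn {j : Fin i → ℕ} (hj : j ∈ indexSet l i) {k : ℕ} (h1 : 1 ≤ k) (h2 : k < l) :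
    (sgn j k = 1 → sgn j (2 * l - k) = -1 → (k : ℤ) - l + pos j (2 * l - k) - pos j k ≠ 1) ∧
    (sgn j k = -1 → sgn j (2 * l - k) = 1 → (k : ℤ) - l + pos j (2 * l - k) - pos j k ≠ 0) := by
  have hinj := (mem_indexSet.1 hj).2.1.injective
  have := occ_cases hinj k
  have := occ_cases hinj (k + 1)
  have := occ_cases hinj (2 * l - k)
  have := occ_cases hinj (2 * l - k + 1)
  have := local_data hj h1 h2
  unfold sgn at *
  omega

/-- If a box cannot be moved, both boxes at the node can be moved simultaneously. -/
theorem flip_flip_mem {j : Fin i → ℕ} (hj : j ∈ indexSet l i) {x : ℕ} (h1 : 1 ≤ x)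
    (h2 : x + 1 ≤ 2 * l) (h0 : sgn j x ≠ 0) (h : flip x j ∉ indexSet l i) :
    x ≠ l ∧ sgn j (2 * l - x) = sgn j x ∧ flip (2 * l - x) j ∈ indexSet l i ∧
      flip x (flip (2 * l - x) j) ∈ indexSet l i := by
  have hinj := (mem_indexSet.1 hj).2.1.injective
  have hl : 2 ≤ l ∨ l = 1 := by omega
  have hxl : x ≠ l := by
    rintro rfl
    rcases hl with hl | rfl
    · exact h (flip_mid_mem hj hl h0)
    · refine h (flip_mem_of hj (by omega) (by omega) h0 fun k h3 h4 hk h5 h6 => ?_)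
      obtain rfl : k = 1 := by omega
      rw [show 2 * 1 - 1 + 1 = 1 + 1 by omega, occ_flip, if_neg (by omega), if_pos rfl] at h6
      rw [occ_flip, if_pos rfl] at h5
      exact absurd (by rw [sgn, h5, h6, sub_self]) h0
  refine ⟨hxl, ?_⟩
  have hs := (occ_of_sgn hinj (x := x)).2.2
  -- A blocked slot forces equal signs at the node. The obstructions at the two slots require
  -- different values, `0` and `1`, of one integer, so the other box is free. Moving it reverses its
  -- sign and thereby removes the obstruction at the first slot.
  have key : ∀ k, 1 ≤ k → k < l → (flip k j ∉ indexSet l i → sgn j k ≠ 0 →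
      sgn j (2 * l - k) = sgn j k ∧ flip (2 * l - k) j ∈ indexSet l i ∧
      flip k (flip (2 * l - k) j) ∈ indexSet l i) ∧ (flip (2 * l - k) j ∉ indexSet l i →
      sgn j (2 * l - k) ≠ 0 → sgn j k = sgn j (2 * l - k) ∧ flip k j ∈ indexSet l i ∧
      flip (2 * l - k) (flip k j) ∈ indexSet l i) := by
    intro k h1 h2
    have s1 := (occ_of_sgn hinj (x := k)).2.2
    have s2 := (occ_of_sgn hinj (x := 2 * l - k)).2.2
    have e1 : sgn (flip (2 * l - k) j) k = sgn j k := sgn_flip_of_far (by omega) j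
    have e2 : sgn (flip k j) (2 * l - k) = sgn j (2 * l - k) := sgn_flip_of_far (by omega) j
    have e3 := sgn_flip_self k j
    have e4 := sgn_flip_self (2 * l - k) j
    have p1 : pos (flip k j) k = pos j k := pos_flip _ _ (by omega)
    have p2 : pos (flip (2 * l - k) j) k = pos j k := pos_flip _ _ (by omega)
    have p3 : pos (flip k j) (2 * l - k) = pos j (2 * l - k) := pos_flip _ _ (by omega)
    have p4 : pos (flip (2 * l - k) j) (2 * l - k) = pos j (2 * l - k) := pos_flip _ _ (by omega)
    constructor
    · intro hn h0
      rcases s1 with s1 | s1 | s1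
      · rw [flip_mem_left_iff_of_sgn hj h1 h2 s1, not_not] at hn
        have h3 : flip (2 * l - k) j ∈ indexSet l i := by
          rw [flip_mem_right_iff_of_sgn hj h1 h2 hn.1]; omega
        refine ⟨by omega, h3, ?_⟩
        rw [flip_mem_left_iff_of_sgn h3 h1 h2 (by omega)]
        omega
      · omega
      · rw [flip_mem_left_iff_of_sgn_neg hj h1 h2 s1, not_not] at hn
        have h3 : flip (2 * l - k) j ∈ indexSet l i := by
          rw [flip_mem_right_iff_of_sgn_neg hj h1 h2 hn.1]; omega
        refine ⟨by omega, h3, ?_⟩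
        rw [flip_mem_left_iff_of_sgn_neg h3 h1 h2 (by omega)]
        omega
    · intro hn h0
      rcases s2 with s2 | s2 | s2
      · rw [flip_mem_right_iff_of_sgn hj h1 h2 s2, not_not] at hn
        have h3 : flip k j ∈ indexSet l i := by
          rw [flip_mem_left_iff_of_sgn hj h1 h2 hn.1]; omega
        refine ⟨by omega, h3, ?_⟩
        rw [flip_mem_right_iff_of_sgn h3 h1 h2 (by omega)]
        omega
      · omega
      · rw [flip_mem_right_iff_of_sgn_neg hj h1 h2 s2, not_not] at hn
        have h3 : flip k j ∈ indexSet l i := by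
          rw [flip_mem_left_iff_of_sgn_neg hj h1 h2 hn.1]; omega
        refine ⟨by omega, h3, ?_⟩
        rw [flip_mem_right_iff_of_sgn_neg h3 h1 h2 (by omega)]
        omega
  rcases lt_or_gt_of_ne hxl with hlt | hgt
  · exact (key x h1 hlt).1 h h0
  · have := (key (2 * l - x) (by omega) (by omega)).2
    rw [show 2 * l - (2 * l - x) = x by omega] at this
    exact this h h0

end LocalStructure

end
end DeformedW

namespace DeformedW
noncomputable section
open PowerSeries Finset.HasAntidiagonal

/-! ### The combinatorial properties of the explicit monomials -/

section Combinatorics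

variable {l i : ℕ}

theorem slotSpec_sum (j : Fin i → ℕ) {x : ℕ} (hx : x ≠ l) :
    (slotSpec l j x).2.1 + (slotSpec l j x).2.2 = if l < x then -2 else 0 := by
  simp only [slotSpec, if_neg hx]
  split_ifs <;> ring

theorem lambdaMon_slotSpec (hl : 2 ≤ l) {j : Fin i → ℕ} (hj : j ∈ indexSet l i) {κ : Fin l} {x : ℕ}
    (hx : x ∈ nodeSlots κ) : lambdaMon l i j (κ, slotSpec l j x) = sgn j x := by
  rw [lambdaMon_apply_slot hl hj hx fun h => slotSpec_sum j h, if_pos rfl]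

theorem exists_slot_of_ne_zero (hl : 2 ≤ l) {j : Fin i → ℕ} (hj : j ∈ indexSet l i) {κ : Fin l}
    {b : Spec} (h : lambdaMon l i j (κ, b) ≠ 0) :
    ∃ x ∈ nodeSlots κ, b = slotSpec l j x ∧ sgn j x = lambdaMon l i j (κ, b) := by
  obtain ⟨x, hx, h'⟩ := Finset.exists_ne_zero_of_sum_ne_zero ((lambdaMon_apply hl hj κ b).symm ▸ h)
  have hb : b = slotSpec l j x := by
    by_contra hb
    exact h' (if_neg hb)
  exact ⟨x, hx, hb, by rw [hb, lambdaMon_slotSpec hl hj hx]⟩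

theorem isGeneric_lambdaMon (hl : 2 ≤ l) {j : Fin i → ℕ} (hj : j ∈ indexSet l i) :
    IsGeneric (lambdaMon l i j) := by
  intro κ b
  by_cases h : lambdaMon l i j (κ, b) = 0
  · exact Or.inr (Or.inl h)
  · obtain ⟨x, _, _, h'⟩ := exists_slot_of_ne_zero hl hj h
    have := (occ_of_sgn (mem_indexSet.1 hj).2.1.injective (x := x)).2.2
    omega

/-- For `k < l` the sum of the exponents of `q` and `t` is `0` at the left slot and `-2` at the
right one, while this shift preserves the sum; a single slot carries a single parameter.
Consequently the second clause of regularity is never put to use. -/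
theorem not_two_shifts (hl : 2 ≤ l) {j : Fin i → ℕ} (hj : j ∈ indexSet l i) {κ : Fin l}
    {b : Spec} (h : lambdaMon l i j (κ, b) ≠ 0)
    (h' : lambdaMon l i j (κ, b.shift (-2 * (typeC l).d κ) 2) ≠ 0) : False := by
  obtain ⟨x, hx, rfl, _⟩ := exists_slot_of_ne_zero hl hj h
  obtain ⟨y, hy, e, _⟩ := exists_slot_of_ne_zero hl hj h'
  have hκ := κ.2
  have h1 := congrArg (fun b : Spec => b.2.1) e
  have h2 := congrArg (fun b : Spec => b.2.2) e
  simp only [Spec.shift] at h1 h2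
  by_cases hxy : x = y
  · subst hxy
    omega
  · rw [nodeSlots_iff] at hx hy
    have hx' : x ≠ l := by omega
    have hy' : y ≠ l := by omega
    have h3 := slotSpec_sum j hx'
    have h4 := slotSpec_sum j hy'
    rw [typeC_d, if_neg (by omega)] at h1
    split_ifs at h3 h4 <;> push_cast at h1 <;> omega

/-- The values that decide whether a box can be moved up. -/
theorem shift_values (hl : 2 ≤ l) {j : Fin i → ℕ} (hj : j ∈ indexSet l i) {κ : Fin l} {x : ℕ}
    (hx : x ∈ nodeSlots κ) (hs : sgn j x = 1) :
    0 ≤ lambdaMon l i j (κ, (slotSpec l j x).shift (-2 * (typeC l).d κ) 0) ∧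
    0 ≤ lambdaMon l i j (κ, (slotSpec l j x).shift 0 2) ∧
    (flip x j ∈ indexSet l i ↔
      lambdaMon l i j (κ, (slotSpec l j x).shift (-2 * (typeC l).d κ) 0) = 0 ∧
      lambdaMon l i j (κ, (slotSpec l j x).shift 0 2) = 0) := by
  have hκ := κ.2
  have hinj := (mem_indexSet.1 hj).2.1.injective
  have hx0 := hx
  rw [nodeSlots_iff] at hx
  have ho := (occ_of_sgn hinj).1 hs
  by_cases hk : (κ : ℕ) + 1 = l
  · have hxl : x = l := by omega
    subst hxl
    have e1 : lambdaMon x i j (κ, (slotSpec x j x).shift (-2 * (typeC x).d κ) 0) = 0 := by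
      rw [lambdaMon_apply_slot hl hj hx0 fun h => absurd rfl h, if_neg]
      intro h
      have := congrArg (fun b : Spec => b.2.1) h
      simp only [Spec.shift] at this
      have := typeC_d_pos κ
      omega
    have e2 : lambdaMon x i j (κ, (slotSpec x j x).shift 0 2) = 0 := by
      rw [lambdaMon_apply_slot hl hj hx0 fun h => absurd rfl h, if_neg]
      intro h
      have := congrArg (fun b : Spec => b.2.2) h
      simp only [Spec.shift] at this
      omega
    rw [e1, e2]
    exact ⟨le_rfl, le_rfl, fun _ => ⟨rfl, rfl⟩, fun _ => flip_mid_mem hj hl (by omega)⟩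
  · have hd : (typeC l).d κ = 1 := by rw [typeC_d, if_neg hk]
    set k := (κ : ℕ) + 1 with hkdef
    have hkl : k < l := by omega
    have m1 : k ∈ nodeSlots κ := nodeSlots_iff.2 (Or.inl rfl)
    have m2 : 2 * l - k ∈ nodeSlots κ := nodeSlots_iff.2 (Or.inr rfl)
    have hne := ne_of_sgn hj (by omega) hkl
    have s1 := (occ_of_sgn hinj (x := k))
    have s2 := (occ_of_sgn hinj (x := 2 * l - k))
    rw [hd]
    rcases hx with rfl | rfl
    · rw [flip_mem_left_iff_of_sgn hj (by omega) hkl hs]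
      -- From the left slot, with exponent sum `0`, the shift by `q^{-2}` lands on the sum `-2` of
      -- the right slot, where a variable may stand.
      have e1 := lambdaMon_apply_slot hl hj m2 (b := (slotSpec l j k).shift (-2 * (1 : ℕ)) 0)
        (by intro _; rw [if_pos (by omega), slotSpec_left hkl]; simp only [Spec.shift]; push_cast; ring)
      -- The shift by `t²` would give the exponent sum `2`, which no slot has.
      have e3 : lambdaMon l i j (κ, (slotSpec l j k).shift 0 2) = 0 := by
        by_contra h0
        obtain ⟨y, hy, e, _⟩ := exists_slot_of_ne_zero hl hj h0
        have h1 := congrArg (fun b : Spec => b.2.1) e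
        have h2 := congrArg (fun b : Spec => b.2.2) e
        rw [nodeSlots_iff] at hy
        have h3 := slotSpec_sum j (show k ≠ l by omega)
        have h4 := slotSpec_sum j (show y ≠ l by omega)
        simp only [Spec.shift] at h1 h2
        split_ifs at h3 h4 <;> omega
      rw [e3, e1, slotSpec_left hkl, slotSpec_right hkl]
      simp only [Spec.shift, spec_eq_iff, true_and, and_true, ho.1]
      split_ifs with h <;> omega
    · rw [flip_mem_right_iff_of_sgn hj (by omega) hkl hs]
      have e1 := lambdaMon_apply_slot hl hj m1 (b := (slotSpec l j (2 * l - k)).shift 0 2)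
        (by intro _; rw [if_neg (by omega), slotSpec_right hkl]; simp only [Spec.shift]; ring)
      -- From the right slot the roles are reversed: `t²` leads to the left slot, and `q^{-2}` to
      -- the impossible sum `-4`.
      have e3 : lambdaMon l i j (κ, (slotSpec l j (2 * l - k)).shift (-2 * (1 : ℕ)) 0) = 0 := by
        by_contra h0
        obtain ⟨y, hy, e, _⟩ := exists_slot_of_ne_zero hl hj h0
        have h1 := congrArg (fun b : Spec => b.2.1) e
        have h2 := congrArg (fun b : Spec => b.2.2) e
        rw [nodeSlots_iff] at hy
        have h3 := slotSpec_sum j (show 2 * l - k ≠ l by omega)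
        have h4 := slotSpec_sum j (show y ≠ l by omega)
        simp only [Spec.shift] at h1 h2
        push_cast at h1
        split_ifs at h3 h4 <;> omega
      rw [e3, e1, slotSpec_left hkl, slotSpec_right hkl]
      simp only [Spec.shift, spec_eq_iff, true_and, ho.1]
      split_ifs with h <;> omega

theorem isRegular_lambdaMon (hl : 2 ≤ l) {j : Fin i → ℕ} (hj : j ∈ indexSet l i) :
    IsRegular (typeC l) (lambdaMon l i j) := by
  intro κ b
  refine ⟨fun h => ?_, fun h h' => (not_two_shifts hl hj h.ne' h'.ne').elim,
    fun h h' => (not_two_shifts hl hj h.ne h'.ne).elim⟩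
  obtain ⟨x, hx, rfl, hs⟩ := exists_slot_of_ne_zero hl hj h.ne'
  have := (occ_of_sgn (mem_indexSet.1 hj).2.1.injective (x := x)).2.2
  have := shift_values hl hj hx (by omega)
  exact ⟨this.1, this.2.1⟩

theorem isAdmissible_lambdaMon_iff (hl : 2 ≤ l) {j : Fin i → ℕ} (hj : j ∈ indexSet l i)
    (κ : Fin l) (b : Spec) : IsAdmissible (typeC l) (lambdaMon l i j) κ b ↔
      ∃ x ∈ nodeSlots κ, b = slotSpec l j x ∧ sgn j x = 1 ∧ flip x j ∈ indexSet l i := by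
  constructor
  · rintro ⟨h1, h2⟩
    obtain ⟨x, hx, rfl, hs⟩ := exists_slot_of_ne_zero hl hj h1.ne'
    have := (occ_of_sgn (mem_indexSet.1 hj).2.1.injective (x := x)).2.2
    exact ⟨x, hx, rfl, by omega, (shift_values hl hj hx (by omega)).2.2.2 h2⟩
  · rintro ⟨x, hx, rfl, hs, hf⟩
    refine ⟨by rw [lambdaMon_slotSpec hl hj hx, hs]; exact one_pos, ?_⟩
    exact (shift_values hl hj hx hs).2.2.1 hf

/-! ### Distinctness of the monomials, moves downwards and the dominant monomial -/

theorem exists_node {x : ℕ} (h1 : 1 ≤ x) (h2 : x + 1 ≤ 2 * l) :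
    ∃ κ : Fin l, x ∈ nodeSlots κ := by
  by_cases h : x ≤ l
  · exact ⟨⟨x - 1, by omega⟩, nodeSlots_iff.2 (Or.inl (by simp; omega))⟩
  · exact ⟨⟨2 * l - x - 1, by omega⟩, nodeSlots_iff.2 (Or.inr (by simp; omega))⟩

/-- The exponent sum identifies the slot, so each monomial can be read off at the parameter of the
other. Either the parameters agree, and then so do the signs, or both signs are zero. -/
theorem sgn_eq_of_lambdaMon_eq (hl : 2 ≤ l) {j j' : Fin i → ℕ} (hj : j ∈ indexSet l i)
    (hj' : j' ∈ indexSet l i) (h : lambdaMon l i j = lambdaMon l i j') {x : ℕ} (h1 : 1 ≤ x)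
    (h2 : x + 1 ≤ 2 * l) : sgn j x = sgn j' x := by
  obtain ⟨κ, hx⟩ := exists_node h1 h2
  have e1 := lambdaMon_slotSpec hl hj hx
  rw [h, lambdaMon_apply_slot hl hj' hx fun h => slotSpec_sum j h] at e1
  have e2 := lambdaMon_slotSpec hl hj' hx
  rw [← h, lambdaMon_apply_slot hl hj hx fun h => slotSpec_sum j' h] at e2
  split_ifs at e1 e2 <;> omega

theorem pos_zero (j : Fin i → ℕ) : pos j 0 = 0 := by simp [pos]

theorem pos_of_lt {j : Fin i → ℕ} {y : ℕ} (h : ∀ α, j α < y) : pos j y = i := by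
  simp [pos, h]

theorem eq_of_occ_eq {j j' : Fin i → ℕ} (hj : StrictMono j) (hj' : StrictMono j')
    (h : ∀ x, occ j x = occ j' x) : j = j' := by
  have hpos : ∀ x, pos j x = pos j' x := by
    intro x
    induction x with
    | zero => rw [pos_zero, pos_zero]
    | succ x ih => rw [pos_succ, pos_succ, ih, h]
  funext α
  have h1 := occ_apply hj.injective α
  rw [h] at h1
  obtain ⟨β, hβ⟩ := exists_of_occ (h1.trans_ne one_ne_zero)
  have h2 := pos_apply hj α
  rw [hpos, ← hβ, pos_apply hj'] at h2
  have : β = α := by ext; exact_mod_cast h2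
  rw [← hβ, this]

/-- The monomial determines all differences of consecutive occupation numbers. Two indices with the
same monomial thus have occupation numbers differing by a constant on `1, …, 2 l`, and this constant
is zero because both indices have `i` boxes. -/
theorem injOn_lambdaMon (hl : 2 ≤ l) : Set.InjOn (lambdaMon l i) (indexSet l i) := by
  intro j hj j' hj' h
  have hj := Finset.mem_coe.1 hj
  have hj' := Finset.mem_coe.1 hj'
  have mj := mem_indexSet.1 hj
  have mj' := mem_indexSet.1 hj'
  have hconst : ∀ n, n + 1 ≤ 2 * l →
      occ j (n + 1) - occ j' (n + 1) = occ j 1 - occ j' 1 := by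
    intro n
    induction n with
    | zero => intro _; rfl
    | succ n ih =>
      intro hn
      have h1 := ih (by omega)
      have h2 := sgn_eq_of_lambdaMon_eq hl hj hj' h (x := n + 1) (by omega) hn
      unfold sgn at h2
      omega
  have hp1 : ∀ {j : Fin i → ℕ}, j ∈ indexSet l i → pos j 1 = 0 := by
    intro j hj
    have h0 : occ j 0 = 0 := occ_eq_zero_of_lt fun α h => by
      have := (mem_indexSet.1 hj).1 α
      omega
    rw [show 1 = 0 + 1 from rfl, pos_succ, pos_zero, h0, add_zero]
  have hpos : ∀ n : ℕ, n ≤ 2 * l →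
      pos j (n + 1) - pos j' (n + 1) = n * (occ j 1 - occ j' 1) := by
    intro n
    induction n with
    | zero => intro _; rw [zero_add, hp1 hj, hp1 hj']; simp
    | succ n ih =>
      intro hn
      rw [pos_succ j (n + 1), pos_succ j' (n + 1)]
      have h1 := ih (by omega)
      have h2 := hconst n hn
      push_cast
      linear_combination h1 + h2
  have h3 := hpos (2 * l) le_rfl
  rw [pos_of_lt fun α => Nat.lt_succ_of_le (mj.1 α).2,
    pos_of_lt fun α => Nat.lt_succ_of_le (mj'.1 α).2, sub_self] at h3
  have h4 : occ j 1 - occ j' 1 = 0 := by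
    rcases mul_eq_zero.1 h3.symm with h | h
    · have : (2 * l : ℕ) = 0 := by exact_mod_cast h
      omega
    · exact h
  refine eq_of_occ_eq mj.2.1 mj'.2.1 fun x => ?_
  by_cases hx : 1 ≤ x ∧ x ≤ 2 * l
  · obtain ⟨n, rfl⟩ : ∃ n, x = n + 1 := ⟨x - 1, by omega⟩
    have := hconst n hx.2
    omega
  · rw [occ_eq_zero_of_lt fun α h => hx (by rw [← h]; exact mj.1 α),
      occ_eq_zero_of_lt fun α h => hx (by rw [← h]; exact mj'.1 α)]

theorem le_apply {j : Fin i → ℕ} (hj : j ∈ indexSet l i) (α : Fin i) : (α : ℕ) + 1 ≤ j α := by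
  obtain ⟨h1, h2, -⟩ := mem_indexSet.1 hj
  obtain ⟨n, hn⟩ := α
  induction n with
  | zero => exact (h1 _).1
  | succ n ih =>
    have h3 := ih (by omega)
    have h4 := h2 (show (⟨n, by omega⟩ : Fin i) < ⟨n + 1, hn⟩ by simp)
    simp only at h3 ⊢
    omega

/-- The first entry that is not minimal has an empty box below it. If moving it down leaves `S`,
then `flip_flip_mem` supplies a permitted downward move at the conjugate slot. -/
theorem exists_move_down {j : Fin i → ℕ} (hj : j ∈ indexSet l i) (h : j ≠ initialIndex i) :
    ∃ x, 1 ≤ x ∧ x + 1 ≤ 2 * l ∧ sgn j x = -1 ∧ flip x j ∈ indexSet l i := by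
  obtain ⟨h1, h2, -⟩ := mem_indexSet.1 hj
  have hex : ∃ n, ∃ h : n < i, j ⟨n, h⟩ ≠ n + 1 := by
    by_contra h'
    push Not at h'
    exact h (funext fun α => h' α α.2)
  classical
  obtain ⟨n, ⟨hn, hne⟩, hmin⟩ : ∃ n, (∃ h : n < i, j ⟨n, h⟩ ≠ n + 1) ∧
      ∀ m < n, ¬∃ h : m < i, j ⟨m, h⟩ ≠ m + 1 :=
    ⟨Nat.find hex, Nat.find_spec hex, fun _ => Nat.find_min hex⟩
  have hlt : ∀ m (hm : m < i), m < n → j ⟨m, hm⟩ = m + 1 := by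
    intro m hm hmn
    by_contra h'
    exact hmin m hmn ⟨hm, h'⟩
  have h3 := le_apply hj ⟨n, hn⟩
  have h4 := h1 ⟨n, hn⟩
  simp only at h3
  obtain ⟨x, hx⟩ : ∃ x, j ⟨n, hn⟩ = x + 1 := ⟨j ⟨n, hn⟩ - 1, by omega⟩
  have hs : sgn j x = -1 := by
    have e1 := occ_apply h2.injective ⟨n, hn⟩
    rw [hx] at e1
    have e2 : occ j x = 0 := occ_eq_zero_of_lt fun α hα => by
      rcases lt_or_ge (α : ℕ) n with hαn | hαn
      · have := hlt α α.2 hαn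
        rw [Fin.eta] at this
        omega
      · have : j ⟨n, hn⟩ ≤ j α := h2.monotone hαn
        omega
    rw [sgn, e1, e2]; rfl
  by_cases hf : flip x j ∈ indexSet l i
  · exact ⟨x, by omega, by omega, hs, hf⟩
  · have := flip_flip_mem hj (by omega) (by omega) (by omega) hf
    exact ⟨2 * l - x, by omega, by omega, by omega, this.2.2.1⟩

theorem eq_initialIndex_of_isDominant (hl : 2 ≤ l) {j : Fin i → ℕ} (hj : j ∈ indexSet l i)
    (h : IsDominant (lambdaMon l i j)) : j = initialIndex i := by
  by_contra hne
  obtain ⟨x, h1, h2, hs, -⟩ := exists_move_down hj hne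
  obtain ⟨κ, hx⟩ := exists_node h1 h2
  have := h κ (slotSpec l j x)
  rw [lambdaMon_slotSpec hl hj hx] at this
  omega

theorem occ_initialIndex (x : ℕ) : occ (initialIndex i) x = if 1 ≤ x ∧ x ≤ i then 1 else 0 := by
  have hinj : Function.Injective (initialIndex i) := fun α β h => by
    simp only [initialIndex] at h
    ext; omega
  split_ifs with h
  · have := occ_apply hinj ⟨x - 1, by omega⟩
    simpa only [initialIndex, Nat.sub_add_cancel h.1] using this
  · refine occ_eq_zero_of_lt fun α hα => ?_
    simp only [initialIndex] at hα
    have := α.2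
    omega

theorem strictMono_initialIndex : StrictMono (initialIndex i) := fun α β h => by
  simp only [initialIndex]
  exact Nat.succ_lt_succ h

theorem initialIndex_mem (hil : i ≤ l) : initialIndex i ∈ indexSet l i := by
  rw [mem_indexSet]
  refine ⟨fun α => ?_, strictMono_initialIndex, fun k h1 h2 h3 h4 => ?_⟩
  · have := α.2
    simp only [initialIndex]
    omega
  · rw [occ_initialIndex, if_neg (by omega)] at h4
    omega

theorem lambdaMon_initialIndex (hl : 2 ≤ l) (hi : 1 ≤ i) (hil : i ≤ l) :
    lambdaMon l i (initialIndex i) = yMon l i (1, 0, 0) 0 0 := by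
  refine Finsupp.ext fun ⟨κ, b⟩ => ?_
  have hκ := κ.2
  have hs : ∀ x, 1 ≤ x → sgn (initialIndex i) x = if x = i then 1 else 0 := by
    intro x hx
    rw [sgn, occ_initialIndex, occ_initialIndex]
    split_ifs <;> omega
  have hp : pos (initialIndex i) i = (i : ℤ) - 1 := by
    have := pos_apply (strictMono_initialIndex (i := i)) ⟨i - 1, by omega⟩
    simp only [initialIndex, Nat.sub_add_cancel hi] at this
    rw [this]; omega
  have hsp : slotSpec l (initialIndex i) i = (1, 0, 0) := by
    have ho : occ (initialIndex i) i = 1 := by rw [occ_initialIndex, if_pos ⟨hi, le_rfl⟩]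
    rw [slotSpec, hp, ho, if_neg (by omega : ¬l < i), spec_eq_iff]
    refine ⟨rfl, by ring, by ring⟩
  rw [lambdaMon_apply hl (initialIndex_mem hil), sum_nodeSlots, hs _ (by omega), hs _ (by omega),
    yMon_apply]
  have e : Spec.shift (1, 0, 0) 0 0 = (1, 0, 0) := rfl
  rw [e]
  by_cases hκi : (κ : ℕ) + 1 = i
  · rw [hκi, hsp, if_pos rfl]
    have : (if i = l then (0 : ℤ) else if b = slotSpec l (initialIndex i) (2 * l - i) then
        (if 2 * l - i = i then 1 else 0) else 0) = 0 := by
      split_ifs <;> omega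
    rw [this, add_zero]
    simp only [true_and]
  · rw [if_neg hκi, ite_self, zero_add, if_neg (c := i = (κ : ℕ) + 1 ∧ _) (by omega)]
    split_ifs <;> omega

end Combinatorics

end
end DeformedW

namespace DeformedW
noncomputable section
open PowerSeries Finset.HasAntidiagonal

/-! ### The coefficients -/

section Coefficients

variable {l i : ℕ}

/-- The factor contributed by the pair of boxes `k` and `2 l - k + 1`. -/
def pairWeight (l : ℕ) (j : Fin i → ℕ) (k : ℕ) : KFrac :=
  if occ j k = 1 ∧ occ j (2 * l - k + 1) = 1 then
    pairFactor ((k : ℤ) - l + pos j (2 * l - k + 1) - pos j k) else 1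

/-- The coefficient of the monomial `Λ_j`. -/
def boxCoeff (l : ℕ) (j : Fin i → ℕ) : KRing :=
  ∏ k ∈ Finset.Icc 1 l, if occ j k = 1 ∧ occ j (2 * l - k + 1) = 1 then
    Classical.choose (exists_pairFactor ((k : ℤ) - l + pos j (2 * l - k + 1) - pos j k)) else 1

theorem algebraMap_boxCoeff (j : Fin i → ℕ) :
    algebraMap KRing KFrac (boxCoeff l j) = ∏ k ∈ Finset.Icc 1 l, pairWeight l j k := by
  rw [boxCoeff, map_prod]
  refine Finset.prod_congr rfl fun k _ => ?_
  rw [pairWeight]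
  split_ifs
  · exact Classical.choose_spec (exists_pairFactor _)
  · exact map_one _

/-- The condition defining `S` says precisely that no pair has the value `n = 1` at which
`pairFactor` vanishes. -/
theorem boxCoeff_ne_zero {j : Fin i → ℕ} (hj : j ∈ indexSet l i) : boxCoeff l j ≠ 0 := by
  intro h
  have h1 := algebraMap_boxCoeff (l := l) j
  rw [h, map_zero] at h1
  obtain ⟨k, hk, h2⟩ := Finset.prod_eq_zero_iff.1 h1.symm
  rw [Finset.mem_Icc] at hk
  rw [pairWeight] at h2
  split_ifs at h2 with h3
  · exact pairFactor_ne_zero ((mem_indexSet.1 hj).2.2 k hk.1 hk.2 h3.1 h3.2) h2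
  · exact one_ne_zero h2

theorem boxCoeff_initialIndex (hil : i ≤ l) : boxCoeff l (initialIndex i) = 1 := by
  refine Finset.prod_eq_one fun k hk => if_neg ?_
  rw [Finset.mem_Icc] at hk
  rintro ⟨_, h⟩
  rw [occ_initialIndex, if_neg (by omega)] at h
  omega

theorem pairWeight_local (j : Fin i → ℕ) {k : ℕ} (h : k < l) :
    pairWeight l j k = (if occ j k = 1 ∧ occ j (2 * l - k + 1) = 1 then
      pairFactor ((k : ℤ) - l + (pos j (2 * l - k) + occ j (2 * l - k)) - pos j k) else 1) ∧
    pairWeight l j (k + 1) = (if occ j (k + 1) = 1 ∧ occ j (2 * l - k) = 1 then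
      pairFactor ((k : ℤ) + 1 - l + pos j (2 * l - k) - (pos j k + occ j k)) else 1) := by
  refine ⟨by rw [pairWeight, pos_succ], ?_⟩
  rw [pairWeight, show 2 * l - (k + 1) + 1 = 2 * l - k by omega, pos_succ j k]
  push_cast
  rfl

theorem prod_pairWeight_flip (j : Fin i → ℕ) {k x : ℕ} (h1 : 1 ≤ k) (h2 : k < l)
    (hx : x = k ∨ x = 2 * l - k) : ∃ R : KFrac,
    ∏ k ∈ Finset.Icc 1 l, pairWeight l j k = R * (pairWeight l j k * pairWeight l j (k + 1)) ∧
    ∏ k ∈ Finset.Icc 1 l, pairWeight l (flip x j) k =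
      R * (pairWeight l (flip x j) k * pairWeight l (flip x j) (k + 1)) := by
  have e : ∀ f : ℕ → KFrac, ∏ k ∈ Finset.Icc 1 l, f k =
      (∏ k ∈ ((Finset.Icc 1 l).erase k).erase (k + 1), f k) * (f k * f (k + 1)) := by
    intro f
    rw [← Finset.mul_prod_erase _ f (show k ∈ Finset.Icc 1 l by rw [Finset.mem_Icc]; omega),
      ← Finset.mul_prod_erase ((Finset.Icc 1 l).erase k) f (a := k + 1)
        (by rw [Finset.mem_erase, Finset.mem_Icc]; omega)]
    ring
  refine ⟨_, e _, ?_⟩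
  rw [e]
  congr 1
  refine Finset.prod_congr rfl fun k' hk' => ?_
  rw [Finset.mem_erase, Finset.mem_erase, Finset.mem_Icc] at hk'
  have a1 : occ (flip x j) k' = occ j k' := by
    rw [occ_flip, if_neg (by omega), if_neg (by omega)]
  have a2 : occ (flip x j) (2 * l - k' + 1) = occ j (2 * l - k' + 1) := by
    rw [occ_flip, if_neg (by omega), if_neg (by omega)]
  rw [pairWeight, pairWeight, a1, a2, pos_flip _ _ (by omega), pos_flip _ _ (by omega)]

theorem prod_pairWeight_flip_mid (j : Fin i → ℕ) (hl : 1 ≤ l) (hs : sgn j l ≠ 0) :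
    ∏ k ∈ Finset.Icc 1 l, pairWeight l (flip l j) k = ∏ k ∈ Finset.Icc 1 l, pairWeight l j k := by
  refine Finset.prod_congr rfl fun k hk => ?_
  rw [Finset.mem_Icc] at hk
  by_cases hkl : k = l
  · subst hkl
    unfold sgn at hs
    rw [pairWeight, pairWeight, show 2 * k - k + 1 = k + 1 by omega, occ_flip, occ_flip, if_pos rfl,
      if_neg (by omega), if_neg (by omega)]
  · have a1 : occ (flip l j) k = occ j k := by
      rw [occ_flip, if_neg (by omega), if_neg (by omega)]
    have a2 : occ (flip l j) (2 * l - k + 1) = occ j (2 * l - k + 1) := by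
      rw [occ_flip, if_neg (by omega), if_neg (by omega)]
    rw [pairWeight, pairWeight, a1, a2, pos_flip _ _ (by omega), pos_flip _ _ (by omega)]

theorem block_eq_pairFactor (n : ℤ) :
    block 1 (q ^ (4 - 2 * n) * t ^ (2 * n - 2)) = pairFactor n := by
  have hq := q_ne_zero
  have ht := t_ne_zero
  have e : ∀ a b c d : ℤ, q ^ a * t ^ b * (q ^ c * t ^ d) = q ^ (a + c) * t ^ (b + d) := by
    intro a b c d
    rw [zpow_add₀ hq, zpow_add₀ ht]; ring
  have e1 := e (-2) 0 (4 - 2 * n) (2 * n - 2)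
  have e2 := e 0 2 (4 - 2 * n) (2 * n - 2)
  have e3 := e (-2) 2 (4 - 2 * n) (2 * n - 2)
  rw [zpow_zero, mul_one, show (-2 + (4 - 2 * n)) = 2 - 2 * n by ring, zero_add] at e1
  rw [zpow_zero, one_mul, zero_add, show (2 + (2 * n - 2)) = 2 * n by ring] at e2
  rw [show (-2 + (4 - 2 * n)) = 2 - 2 * n by ring, show (2 + (2 * n - 2)) = 2 * n by ring] at e3
  rw [block, pairFactor, show (-2 * ((1 : ℕ) : ℤ)) = -2 by norm_num, ← zpow_natCast t 2,
    show ((2 : ℕ) : ℤ) = 2 by norm_num, e1, e2, e3]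

theorem cross_ratio_inv {F : Type*} [Field F] {x w u v : F} (hx : x ≠ 0) (hw : w ≠ 0)
    (hu : u ≠ 0) (hv : v ≠ 0) (h : x * w = u * v) :
    (1 - x⁻¹) * (1 - w⁻¹) / ((1 - u⁻¹) * (1 - v⁻¹)) = (1 - w) * (1 - x) / ((1 - v) * (1 - u)) := by
  have e : ∀ {a b : F}, a ≠ 0 → b ≠ 0 →
      (1 - a⁻¹) * (1 - b⁻¹) = (1 - b) * (1 - a) * (a * b)⁻¹ := by
    intro a b ha hb
    field_simp
    ring
  rw [e hx hw, e hu hv, h, mul_div_mul_right _ _ (inv_ne_zero (mul_ne_zero hu hv))]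

/-- The argument is the image of the one in `block_eq_pairFactor` under `x ↦ (q^{-2} t² x)⁻¹`, which
preserves `block`. Hence a pair contributes the same factor from whichever side it is formed. -/
theorem block_eq_pairFactor' (n : ℤ) :
    block 1 (q ^ (2 * n - 2) * t ^ (-(2 * n))) = pairFactor n := by
  have hq := q_ne_zero
  have ht := t_ne_zero
  have h0 : ∀ a b : ℤ, q ^ a * t ^ b ≠ 0 := fun a b =>
    mul_ne_zero (zpow_ne_zero _ hq) (zpow_ne_zero _ ht)
  have e : ∀ a b c d : ℤ, q ^ a * t ^ b * (q ^ c * t ^ d) = q ^ (a + c) * t ^ (b + d) := by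
    intro a b c d
    rw [zpow_add₀ hq, zpow_add₀ ht]; ring
  have hinv : ∀ a b c d : ℤ, a = -c → b = -d → q ^ a * t ^ b = (q ^ c * t ^ d)⁻¹ := by
    rintro a b c d rfl rfl
    rw [mul_inv, zpow_neg, zpow_neg]
  have e1 := e (-2) 0 (2 * n - 2) (-(2 * n))
  have e2 := e 0 2 (2 * n - 2) (-(2 * n))
  have e3 := e (-2) 2 (2 * n - 2) (-(2 * n))
  rw [zpow_zero, mul_one, zero_add,
    hinv (-2 + (2 * n - 2)) _ (4 - 2 * n) (2 * n) (by ring) (by ring)] at e1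
  rw [zpow_zero, one_mul, zero_add,
    hinv (2 * n - 2) (2 + -(2 * n)) (2 - 2 * n) (2 * n - 2) (by ring) (by ring)]
    at e2
  rw [hinv (-2 + (2 * n - 2)) _ (4 - 2 * n) (2 * n - 2) (by ring) (by ring)] at e3
  rw [block, pairFactor, show (-2 * ((1 : ℕ) : ℤ)) = -2 by norm_num, ← zpow_natCast t 2,
    show ((2 : ℕ) : ℤ) = 2 by norm_num, e1, e2, e3,
    hinv (2 * n - 2) _ (2 - 2 * n) (2 * n) (by ring) (by ring)]
  refine cross_ratio_inv (h0 _ _) (h0 _ _) (h0 _ _) (h0 _ _) ?_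
  rw [e, e]
  congr 2
  ring

/-- The ratio of the parameters of the two variables at the node of `x`. -/
def slotRatio (l : ℕ) (j : Fin i → ℕ) (x : ℕ) : KFrac :=
  (slotSpec l j x).val / (slotSpec l j (2 * l - x)).val

theorem slotRatio_eq {j : Fin i → ℕ} {x : ℕ} {m n m' n' : ℤ} (h : slotSpec l j x = (1, m, n))
    (h' : slotSpec l j (2 * l - x) = (1, m', n')) :
    slotRatio l j x = q ^ (m - m') * t ^ (n - n') := by
  rw [slotRatio, h, h', spec_val_one, spec_val_one, zpow_sub₀ q_ne_zero, zpow_sub₀ t_ne_zero,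
    mul_div_mul_comm]

/-- Moving a box up when there is no other variable at its node. -/
theorem prod_pairWeight_flip_of_sgn_eq_zero {j : Fin i → ℕ} (hj : j ∈ indexSet l i) {x : ℕ}
    (h1 : 1 ≤ x) (h2 : x + 1 ≤ 2 * l) (hs : sgn j x = 1) (h : x = l ∨ sgn j (2 * l - x) = 0) :
    ∏ k ∈ Finset.Icc 1 l, pairWeight l (flip x j) k = ∏ k ∈ Finset.Icc 1 l, pairWeight l j k := by
  have hinj := (mem_indexSet.1 hj).2.1.injective
  by_cases hxl : x = l
  · subst hxl
    exact prod_pairWeight_flip_mid j h1 (by omega)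
  replace h := h.resolve_left hxl
  have ho := (occ_of_sgn hinj).1 hs
  rcases lt_or_gt_of_ne hxl with hlt | hgt
  · obtain ⟨R, e, e'⟩ := prod_pairWeight_flip j h1 hlt (Or.inl rfl)
    have a1 : occ (flip x j) x = 0 := by rw [occ_flip, if_pos rfl, ho.2]
    have a2 : occ (flip x j) (x + 1) = 1 := by rw [occ_flip, if_neg (by omega), if_pos rfl, ho.1]
    have a3 : occ (flip x j) (2 * l - x) = occ j (2 * l - x) := by
      rw [occ_flip, if_neg (by omega), if_neg (by omega)]
    rw [e, e', (pairWeight_local j hlt).1, (pairWeight_local j hlt).2,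
      (pairWeight_local (flip x j) hlt).1, (pairWeight_local (flip x j) hlt).2, a1, a2, a3, ho.1,
      ho.2, pos_flip _ _ (by omega), pos_flip _ _ (by omega)]
    have c := occ_cases hinj (2 * l - x)
    unfold sgn at h
    have h' : occ j (2 * l - x + 1) = occ j (2 * l - x) := by omega
    rw [h']
    rcases c with c | c
    · simp [c]
    -- The pair `x`, `2 l - x + 1` becomes `x + 1`, `2 l - x`: the label rises by one, the
    -- difference of positions falls by one, and the value is unchanged.
    · simp only [c]
      norm_num
      left
      congr 1
      ring
  · obtain ⟨k, hk⟩ : ∃ k, k = 2 * l - x := ⟨_, rfl⟩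
    obtain rfl : x = 2 * l - k := by omega
    rw [← hk] at h
    have hkl : k < l := by omega
    obtain ⟨R, e, e'⟩ := prod_pairWeight_flip j (x := 2 * l - k) (by omega) hkl (Or.inr rfl)
    have a1 : occ (flip (2 * l - k) j) k = occ j k := by
      rw [occ_flip, if_neg (by omega), if_neg (by omega)]
    have a2 : occ (flip (2 * l - k) j) (k + 1) = occ j (k + 1) := by
      rw [occ_flip, if_neg (by omega), if_neg (by omega)]
    have a3 : occ (flip (2 * l - k) j) (2 * l - k) = 0 := by rw [occ_flip, if_pos rfl, ho.2]
    have a4 : occ (flip (2 * l - k) j) (2 * l - k + 1) = 1 := by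
      rw [occ_flip, if_neg (by omega), if_pos rfl, ho.1]
    rw [e, e', (pairWeight_local j hkl).1, (pairWeight_local j hkl).2,
      (pairWeight_local (flip (2 * l - k) j) hkl).1, (pairWeight_local (flip (2 * l - k) j) hkl).2,
      a1, a2, a3, a4, ho.1, ho.2, pos_flip _ _ (by omega), pos_flip _ _ (by omega)]
    have c := occ_cases hinj k
    unfold sgn at h
    have h' : occ j (k + 1) = occ j k := by omega
    rw [h']
    rcases c with c | c
    · simp [c]
    · simp only [c]
      norm_num
      left
      congr 1
      ring

/-- Moving a box up when there is another variable at its node. -/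
theorem exists_flip_data {j : Fin i → ℕ} (hj : j ∈ indexSet l i) {x : ℕ}
    (h1 : 1 ≤ x) (h2 : x + 1 ≤ 2 * l) (hs : sgn j x = 1) (hxl : x ≠ l)
    (h : sgn j (2 * l - x) ≠ 0) : ∃ n : ℤ,
    ∏ k ∈ Finset.Icc 1 l, pairWeight l (flip x j) k =
      (∏ k ∈ Finset.Icc 1 l, pairWeight l j k) * pairFactor n ^ sgn j (2 * l - x) ∧
    (slotRatio l j x = q ^ (4 - 2 * n) * t ^ (2 * n - 2) ∨
      slotRatio l j x = q ^ (2 * n - 2) * t ^ (-(2 * n))) ∧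
    (flip x j ∈ indexSet l i ↔ n ≠ 1) ∧ (n = 1 → sgn j (2 * l - x) = 1) := by
  have hinj := (mem_indexSet.1 hj).2.1.injective
  have ho := (occ_of_sgn hinj).1 hs
  have hs' := occ_of_sgn hinj (x := 2 * l - x)
  rcases lt_or_gt_of_ne hxl with hlt | hgt
  · obtain ⟨R, e, e'⟩ := prod_pairWeight_flip j h1 hlt (Or.inl rfl)
    have a1 : occ (flip x j) x = 0 := by rw [occ_flip, if_pos rfl, ho.2]
    have a2 : occ (flip x j) (x + 1) = 1 := by rw [occ_flip, if_neg (by omega), if_pos rfl, ho.1]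
    have a3 : occ (flip x j) (2 * l - x) = occ j (2 * l - x) := by
      rw [occ_flip, if_neg (by omega), if_neg (by omega)]
    rw [e, e', (pairWeight_local j hlt).1, (pairWeight_local j hlt).2,
      (pairWeight_local (flip x j) hlt).1, (pairWeight_local (flip x j) hlt).2, a1, a2, a3, ho.1,
      ho.2, pos_flip _ _ (by omega), pos_flip _ _ (by omega),
      slotRatio_eq (slotSpec_left hlt j) (slotSpec_right hlt j), ho.1,
      flip_mem_left_iff_of_sgn hj h1 hlt hs]
    have hne := (ne_of_sgn hj h1 hlt).1 hs
    rcases hs'.2.2 with c | c | c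
    · have c' := hs'.1 c
      -- The value of the pair `x + 1`, `2 l - x` created by the move.
      refine ⟨(x : ℤ) - l + pos j (2 * l - x) - pos j x + 1, ?_, Or.inl ?_, by omega, fun _ => c⟩
      · rw [c, c'.1, c'.2]
        norm_num
        left
        congr 1
        ring
      · rw [c'.1]
        congr 2 <;> ring
    · exact absurd c h
    · have c' := hs'.2.1 c
      have hne := hne c
      -- The value of the pair `x`, `2 l - x + 1` destroyed by the move; it differs from `1` since
      -- that pair occurs in an element of `S`.
      refine ⟨(x : ℤ) - l + pos j (2 * l - x) - pos j x, ?_, Or.inl ?_, by omega,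
        fun h => absurd h hne⟩
      · rw [c, c'.1, c'.2]
        norm_num
        rw [mul_assoc, mul_inv_cancel₀ (pairFactor_ne_zero hne), mul_one]
      · rw [c'.1]
        congr 2 <;> ring
  · obtain ⟨k, hk⟩ : ∃ k, k = 2 * l - x := ⟨_, rfl⟩
    obtain rfl : x = 2 * l - k := by omega
    rw [← hk] at h hs' ⊢
    have hkl : k < l := by omega
    obtain ⟨R, e, e'⟩ := prod_pairWeight_flip j (x := 2 * l - k) (by omega) hkl (Or.inr rfl)
    have a1 : occ (flip (2 * l - k) j) k = occ j k := by
      rw [occ_flip, if_neg (by omega), if_neg (by omega)]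
    have a2 : occ (flip (2 * l - k) j) (k + 1) = occ j (k + 1) := by
      rw [occ_flip, if_neg (by omega), if_neg (by omega)]
    have a3 : occ (flip (2 * l - k) j) (2 * l - k) = 0 := by rw [occ_flip, if_pos rfl, ho.2]
    have a4 : occ (flip (2 * l - k) j) (2 * l - k + 1) = 1 := by
      rw [occ_flip, if_neg (by omega), if_pos rfl, ho.1]
    have hsl : slotSpec l j (2 * l - (2 * l - k)) = slotSpec l j k := by rw [← hk]
    rw [e, e', (pairWeight_local j hkl).1, (pairWeight_local j hkl).2,
      (pairWeight_local (flip (2 * l - k) j) hkl).1, (pairWeight_local (flip (2 * l - k) j) hkl).2,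
      a1, a2, a3, a4, ho.1, ho.2, pos_flip _ _ (by omega), pos_flip _ _ (by omega),
      slotRatio_eq (slotSpec_right hkl j) (hsl.trans (slotSpec_left hkl j)), ho.1,
      flip_mem_right_iff_of_sgn hj (by omega) hkl hs]
    have hne := (ne_of_sgn hj (by omega) hkl).2
    rcases hs'.2.2 with c | c | c
    · have c' := hs'.1 c
      -- At the right slot the created pair is `k`, `2 l - k + 1`, and the destroyed one, in the
      -- last case below, is `k + 1`, `2 l - k`.
      refine ⟨(k : ℤ) - l + pos j (2 * l - k) - pos j k, ?_, Or.inr ?_, by omega, fun _ => c⟩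
      · rw [c, c'.1, c'.2]
        norm_num
      · rw [c'.1]
        congr 2 <;> ring
    · exact absurd c h
    · have c' := hs'.2.1 c
      have hne := hne c hs
      refine ⟨(k : ℤ) - l + pos j (2 * l - k) - pos j k + 1, ?_, Or.inr ?_, by omega,
        fun h => by omega⟩
      · rw [c, c'.1, c'.2]
        norm_num
        rw [mul_assoc, show (k : ℤ) + 1 - l + pos j (2 * l - k) - pos j k =
          (k : ℤ) - l + pos j (2 * l - k) - pos j k + 1 by ring,
          mul_inv_cancel₀ (pairFactor_ne_zero (by omega)), mul_one]
      · rw [c'.1]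
        congr 2 <;> ring

end Coefficients

end
end DeformedW

namespace DeformedW
noncomputable section
open PowerSeries Finset.HasAntidiagonal

/-! ### The algorithm -/

section Algorithm

variable {l i : ℕ}

theorem other_mem_nodeSlots {κ : Fin l} {x : ℕ} (hx : x ∈ nodeSlots κ) :
    2 * l - x ∈ nodeSlots κ := by
  have := κ.2
  rw [nodeSlots_iff] at hx ⊢
  omega

/-- The product over the remaining variables at the node has at most one factor, from the other
slot, and none at the last node. -/
theorem coeffRatio_lambdaMon (hl : 2 ≤ l) {j : Fin i → ℕ} (hj : j ∈ indexSet l i) {κ : Fin l}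
    {x : ℕ} (hx : x ∈ nodeSlots κ) : coeffRatio (typeC l) (lambdaMon l i j) κ (slotSpec l j x) =
      if x = l then 1 else block 1 (slotRatio l j x) ^ sgn j (2 * l - x) := by
  have hκ := κ.2
  have hx' := nodeSlots_iff.1 hx
  have hval : ∀ b, b ≠ slotSpec l j x →
      (lambdaMon l i j).erase (κ, slotSpec l j x) (κ, b) = lambdaMon l i j (κ, b) := fun b hb =>
    Finsupp.erase_ne fun h => hb (Prod.mk.inj h).2
  rw [coeffRatio, Finsupp.prod]
  split_ifs with hxl
  · refine Finset.prod_eq_one fun p hp => ?_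
    rw [if_neg]
    rintro hpκ
    obtain ⟨p1, b⟩ := p
    simp only at hpκ
    subst hpκ
    have hb : b ≠ slotSpec l j x := by
      rintro rfl
      exact Finsupp.mem_support_iff.1 hp Finsupp.erase_same
    have h0 := Finsupp.mem_support_iff.1 hp
    rw [hval b hb] at h0
    obtain ⟨y, hy, e, -⟩ := exists_slot_of_ne_zero hl hj h0
    rw [nodeSlots_iff] at hy
    exact hb (e.trans (by rw [show y = x by omega]))
  · have hne : slotSpec l j (2 * l - x) ≠ slotSpec l j x := by
      intro h
      have h1 := slotSpec_sum j hxl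
      have h2 := slotSpec_sum j (show 2 * l - x ≠ l by omega)
      rw [h] at h2
      split_ifs at h1 h2 <;> omega
    rw [Finset.prod_eq_single (κ, slotSpec l j (2 * l - x))]
    · rw [if_pos rfl, hval _ hne, lambdaMon_slotSpec hl hj (other_mem_nodeSlots hx), typeC_d,
        if_neg (by omega), slotRatio]
    · intro p hp hp'
      rw [if_neg]
      rintro hpκ
      obtain ⟨p1, b⟩ := p
      simp only at hpκ
      subst hpκ
      have hb : b ≠ slotSpec l j x := by
        rintro rfl
        exact Finsupp.mem_support_iff.1 hp Finsupp.erase_same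
      have h0 := Finsupp.mem_support_iff.1 hp
      rw [hval b hb] at h0
      obtain ⟨y, hy, e, -⟩ := exists_slot_of_ne_zero hl hj h0
      rw [nodeSlots_iff] at hy
      obtain rfl | rfl : y = x ∨ y = 2 * l - x := by omega
      · exact hb e
      · exact hp' (by rw [e])
    · intro h0
      rw [Finsupp.notMem_support_iff] at h0
      rw [h0, zpow_zero, ite_self]

/-- The effect of moving a box up on the coefficients. -/
theorem algebraMap_boxCoeff_flip (hl : 2 ≤ l) {j : Fin i → ℕ} (hj : j ∈ indexSet l i) {κ : Fin l}
    {x : ℕ} (hx : x ∈ nodeSlots κ) (hs : sgn j x = 1) :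
    algebraMap KRing KFrac (boxCoeff l (flip x j)) = algebraMap KRing KFrac (boxCoeff l j) *
      if x = l then 1 else block 1 (slotRatio l j x) ^ sgn j (2 * l - x) := by
  have hκ := κ.2
  rw [nodeSlots_iff] at hx
  rw [algebraMap_boxCoeff, algebraMap_boxCoeff]
  by_cases h : x = l ∨ sgn j (2 * l - x) = 0
  · rw [prod_pairWeight_flip_of_sgn_eq_zero hj (by omega) (by omega) hs h]
    split_ifs with hxl
    · rw [mul_one]
    · rw [h.resolve_left hxl, zpow_zero, mul_one]
  · push Not at h
    obtain ⟨n, e, hr, -⟩ := exists_flip_data hj (by omega) (by omega) hs h.1 h.2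
    rw [if_neg h.1, e]
    rcases hr with hr | hr
    · rw [hr, block_eq_pairFactor]
    · rw [hr, block_eq_pairFactor']

theorem height_nonneg {j : Fin i → ℕ} (hj : j ∈ indexSet l i) : 0 ≤ height j :=
  Finset.sum_nonneg fun α _ => by
    have := le_apply hj α
    omega

theorem height_le {j : Fin i → ℕ} (hj : j ∈ indexSet l i) : height j ≤ i * (2 * l) := by
  refine (Finset.sum_le_card_nsmul _ _ (2 * l : ℤ) fun α _ => ?_).trans ?_
  · have := (mem_indexSet.1 hj).1 α
    omega
  · simp

theorem height_initialIndex : height (initialIndex i) = 0 :=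
  Finset.sum_eq_zero fun α _ => by simp [initialIndex]

theorem eq_initialIndex_of_height {j : Fin i → ℕ} (hj : j ∈ indexSet l i) (h : height j = 0) :
    j = initialIndex i := by
  funext α
  have h1 := (Finset.sum_eq_zero_iff_of_nonneg fun α _ => by
    have := le_apply hj α
    omega).1 h α (Finset.mem_univ α)
  simp only [initialIndex]
  omega

/-- Every expansion raises the height by one. Conversely an index of height `n + 1` can be moved
down inside `S`, so it arises from step `n`; by injectivity and its height it was not created
before. -/
theorem algState_eq (hl : 2 ≤ l) (hi : 1 ≤ i) (hil : i ≤ l) (n : ℕ) :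
    algState (typeC l) (yMon l i (1, 0, 0) 0 0) n =
      ({M | ∃ j ∈ indexSet l i, height j ≤ n ∧ lambdaMon l i j = M},
        {M | ∃ j ∈ indexSet l i, height j = n ∧ lambdaMon l i j = M}) := by
  induction n with
  | zero =>
    have key : ∀ j ∈ indexSet l i, height j ≤ (0 : ℕ) →
        lambdaMon l i j = yMon l i (1, 0, 0) 0 0 := by
      intro j hj h
      have := height_nonneg hj
      rw [eq_initialIndex_of_height hj (by push_cast at h; omega), lambdaMon_initialIndex hl hi hil]
    have hin := initialIndex_mem (l := l) hil
    have hlam := lambdaMon_initialIndex hl hi hil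
    rw [algState]
    refine Prod.ext (Set.ext fun M => ?_) (Set.ext fun M => ?_)
    · constructor
      · rintro rfl
        exact ⟨_, hin, by rw [height_initialIndex]; rfl, hlam⟩
      · rintro ⟨j, hj, h, rfl⟩
        exact key j hj h
    · constructor
      · rintro rfl
        exact ⟨_, hin, by rw [height_initialIndex]; rfl, hlam⟩
      · rintro ⟨j, hj, h, rfl⟩
        exact key j hj h.le
  | succ n ih =>
    have hnew : {M' | M' ∉ (algState (typeC l) (yMon l i (1, 0, 0) 0 0) n).1 ∧
        ∃ M ∈ (algState (typeC l) (yMon l i (1, 0, 0) 0 0) n).2, ∃ κ a,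
          IsAdmissible (typeC l) M κ a ∧ M' = expand (typeC l) M κ a} =
        {M | ∃ j ∈ indexSet l i, height j = (n + 1 : ℕ) ∧ lambdaMon l i j = M} := by
      rw [ih]
      ext M'
      constructor
      · rintro ⟨-, M, ⟨j, hj, hh, rfl⟩, κ, a, hadm, rfl⟩
        obtain ⟨x, hx, rfl, hs, hf⟩ := (isAdmissible_lambdaMon_iff hl hj κ a).1 hadm
        refine ⟨flip x j, hf, ?_, lambdaMon_flip hl (mem_indexSet.1 hj).2.1 hx hs⟩
        rw [height_flip, hh, hs]
        push_cast; ring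
      · rintro ⟨j, hj, hh, rfl⟩
        constructor
        · rintro ⟨j', hj', hh', e⟩
          have := injOn_lambdaMon hl (Finset.mem_coe.2 hj') (Finset.mem_coe.2 hj) e
          rw [this, hh] at hh'
          push_cast at hh'
          omega
        · have hne : j ≠ initialIndex i := by
            rintro rfl
            rw [height_initialIndex] at hh
            push_cast at hh
            omega
          obtain ⟨x, h1, h2, hs, hf⟩ := exists_move_down hj hne
          obtain ⟨κ, hx⟩ := exists_node h1 h2
          have hs' : sgn (flip x j) x = 1 := by rw [sgn_flip_self, hs, neg_neg]
          refine ⟨_, ⟨flip x j, hf, ?_, rfl⟩, κ, slotSpec l (flip x j) x, ?_, ?_⟩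
          · rw [height_flip, hh, hs]
            push_cast; ring
          · rw [isAdmissible_lambdaMon_iff hl hf]
            exact ⟨x, hx, rfl, hs', by rwa [flip_flip]⟩
          · rw [← lambdaMon_flip hl (mem_indexSet.1 hf).2.1 hx hs', flip_flip]
    rw [algState]
    simp only [hnew]
    refine Prod.ext ?_ rfl
    rw [ih]
    ext M
    constructor
    · rintro (⟨j, hj, h, rfl⟩ | ⟨j, hj, h, rfl⟩)
      · exact ⟨j, hj, by push_cast; omega, rfl⟩
      · exact ⟨j, hj, h.le, rfl⟩
    · rintro ⟨j, hj, h, rfl⟩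
      rcases h.lt_or_eq with h | h
      · exact Or.inl ⟨j, hj, by push_cast at h; omega, rfl⟩
      · exact Or.inr ⟨j, hj, h, rfl⟩

theorem algStep_eq (hl : 2 ≤ l) (hi : 1 ≤ i) (hil : i ≤ l) (n : ℕ) :
    algStep (typeC l) (yMon l i (1, 0, 0) 0 0) n =
      {M | ∃ j ∈ indexSet l i, height j = (n : ℤ) ∧ lambdaMon l i j = M} := by
  rw [algStep, algState_eq hl hi hil]

theorem algorithmWorks (hl : 2 ≤ l) (hi : 1 ≤ i) (hil : i ≤ l) :
    AlgorithmWorks (typeC l) (yMon l i (1, 0, 0) 0 0) := by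
  refine ⟨fun n M hM => ?_, i * (2 * l) + 1, ?_⟩
  · rw [algStep_eq hl hi hil] at hM
    obtain ⟨j, hj, -, rfl⟩ := hM
    exact ⟨isGeneric_lambdaMon hl hj, isRegular_lambdaMon hl hj⟩
  · rw [algStep_eq hl hi hil]
    refine Set.eq_empty_of_forall_notMem ?_
    rintro M ⟨j, hj, h, -⟩
    have := height_le hj
    rw [h] at this
    push_cast at this
    omega

open Classical in
/-- The coefficients as a function of the monomial. -/
def monCoeff (l i : ℕ) (M : Mon l) : KRing :=
  if h : ∃ j ∈ indexSet l i, lambdaMon l i j = M then boxCoeff l h.choose else 0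

theorem monCoeff_lambdaMon (hl : 2 ≤ l) {j : Fin i → ℕ} (hj : j ∈ indexSet l i) :
    monCoeff l i (lambdaMon l i j) = boxCoeff l j := by
  have h : ∃ j' ∈ indexSet l i, lambdaMon l i j' = lambdaMon l i j := ⟨j, hj, rfl⟩
  rw [monCoeff, dif_pos h, injOn_lambdaMon hl (Finset.mem_coe.2 h.choose_spec.1)
    (Finset.mem_coe.2 hj) h.choose_spec.2]

theorem isAlgorithmCoeff_monCoeff (hl : 2 ≤ l) (hi : 1 ≤ i) (hil : i ≤ l) :
    IsAlgorithmCoeff (typeC l) (yMon l i (1, 0, 0) 0 0) (monCoeff l i) := by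
  constructor
  · rw [← lambdaMon_initialIndex hl hi hil, monCoeff_lambdaMon hl (initialIndex_mem hil),
      boxCoeff_initialIndex hil]
  · intro n M hM κ a hadm
    rw [algStep_eq hl hi hil] at hM
    obtain ⟨j, hj, -, rfl⟩ := hM
    obtain ⟨x, hx, rfl, hs, hf⟩ := (isAdmissible_lambdaMon_iff hl hj κ a).1 hadm
    rw [← lambdaMon_flip hl (mem_indexSet.1 hj).2.1 hx hs, monCoeff_lambdaMon hl hf,
      monCoeff_lambdaMon hl hj, coeffRatio_lambdaMon hl hj hx, algebraMap_boxCoeff_flip hl hj hx hs]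

end Algorithm

end
end DeformedW

namespace DeformedW
noncomputable section
open PowerSeries Finset.HasAntidiagonal

/-! ### Residues at the poles of a product of two factors -/

section Residues

variable {F : Type*} [Field F]

theorem block_scalar_inv {p s x : F} (hp : p ≠ 0) (hs : s ≠ 0) (hx : x ≠ 0) :
    (1 - p * x⁻¹) * (1 - s * x⁻¹) / ((1 - x⁻¹) * (1 - p * s * x⁻¹)) =
    (1 - p * (x * (p * s)⁻¹)) * (1 - s * (x * (p * s)⁻¹)) /
      ((1 - x * (p * s)⁻¹) * (1 - p * s * (x * (p * s)⁻¹))) := by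
  rw [← mul_div_mul_left ((1 - p * (x * (p * s)⁻¹)) * (1 - s * (x * (p * s)⁻¹))) _
    (div_ne_zero (mul_ne_zero hp hs) (pow_ne_zero 2 hx))]
  congr 1 <;> field_simp <;> ring

theorem one_add_mul_div_div {r u D w N : F} (hD : D ≠ 0) (h : D + r * u * w = N) :
    1 + r * u / (D / w) = N / D := by
  rw [← h]
  by_cases hw : w = 0
  · simp [hw, hD]
  · field_simp

/-- Here `b` and `e` are the parameters of two positive variables. On the left is the influence of
`e` on the residue at the pole of `b`, on the right its influence after `b` has been moved; all
brackets are quotients of linear forms in `b` and `e`, and their ratio is the factor `block`. -/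
theorem pole_residue_plus {τ σ b e : F} (hτ : τ ≠ 0) (hσ : σ ≠ 0) (hb : b ≠ 0) (he : e ≠ 0)
    (h1 : e - b ≠ 0) (h2 : e - τ ^ 2 * σ ^ 2 * b ≠ 0) (h3 : e - σ ^ 2 * b ≠ 0) :
    1 + ((τ ^ 2)⁻¹ - 1) * (τ * b)⁻¹ / ((τ * b)⁻¹ - (τ * e)⁻¹) =
      ((1 - σ ^ 2 * (b / e)) * (1 - τ ^ 2 * (b / e))) /
        ((1 - b / e) * (1 - σ ^ 2 * τ ^ 2 * (b / e))) *
      (1 + ((τ ^ 2)⁻¹ - 1) * (τ * (b * (τ * σ) ^ 2)⁻¹) /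
        (τ * (b * (τ * σ) ^ 2)⁻¹ - (τ * e)⁻¹)) := by
  have e1 : (τ * b)⁻¹ - (τ * e)⁻¹ = (e - b) / (τ * b * e) := by field_simp
  have e2 : τ * (b * (τ * σ) ^ 2)⁻¹ - (τ * e)⁻¹ = (e - σ ^ 2 * b) / (τ * σ ^ 2 * b * e) := by
    field_simp
  have e3 : 1 - b / e = (e - b) / e := by field_simp
  have e4 : 1 - σ ^ 2 * τ ^ 2 * (b / e) = (e - τ ^ 2 * σ ^ 2 * b) / e := by field_simp
  have e5 : 1 - σ ^ 2 * (b / e) = (e - σ ^ 2 * b) / e := by field_simp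
  have e6 : 1 - τ ^ 2 * (b / e) = (e - τ ^ 2 * b) / e := by field_simp
  rw [e1, e2, e3, e4, e5, e6,
    one_add_mul_div_div (N := (e - τ ^ 2 * b) / τ ^ 2) h1 (by field_simp; ring),
    one_add_mul_div_div (N := (e - τ ^ 2 * σ ^ 2 * b) / τ ^ 2) h3 (by field_simp; ring)]
  generalize e - τ ^ 2 * σ ^ 2 * b = D at *
  generalize e - σ ^ 2 * b = D' at *
  generalize e - b = D'' at *
  field_simp

theorem pole_residue_minus {τ σ b e : F} (hτ : τ ≠ 0) (hσ : σ ≠ 0) (hb : b ≠ 0) (he : e ≠ 0)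
    (h1 : e - σ ^ 2 * b ≠ 0) (h2 : e - τ ^ 2 * σ ^ 2 * b ≠ 0) (h3 : e - τ ^ 2 * b ≠ 0) :
    1 + (τ ^ 2 - 1) * (τ * b)⁻¹ / ((τ * b)⁻¹ - τ * e⁻¹) =
      (((1 - σ ^ 2 * (b / e)) * (1 - τ ^ 2 * (b / e))) /
        ((1 - b / e) * (1 - σ ^ 2 * τ ^ 2 * (b / e))))⁻¹ *
      (1 + (τ ^ 2 - 1) * (τ * (b * (τ * σ) ^ 2)⁻¹) /
        (τ * (b * (τ * σ) ^ 2)⁻¹ - τ * e⁻¹)) := by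
  have e1 : (τ * b)⁻¹ - τ * e⁻¹ = (e - τ ^ 2 * b) / (τ * b * e) := by field_simp
  have e2 : τ * (b * (τ * σ) ^ 2)⁻¹ - τ * e⁻¹ =
      (e - τ ^ 2 * σ ^ 2 * b) / (τ * σ ^ 2 * b * e) := by
    field_simp
  have e3 : 1 - b / e = (e - b) / e := by field_simp
  have e4 : 1 - σ ^ 2 * τ ^ 2 * (b / e) = (e - τ ^ 2 * σ ^ 2 * b) / e := by field_simp
  have e5 : 1 - σ ^ 2 * (b / e) = (e - σ ^ 2 * b) / e := by field_simp
  have e6 : 1 - τ ^ 2 * (b / e) = (e - τ ^ 2 * b) / e := by field_simp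
  rw [e1, e2, e3, e4, e5, e6, inv_div,
    one_add_mul_div_div (N := τ ^ 2 * (e - b)) h3 (by field_simp; ring),
    one_add_mul_div_div (N := τ ^ 2 * (e - σ ^ 2 * b)) h2 (by field_simp; ring)]
  generalize e - τ ^ 2 * σ ^ 2 * b = D at *
  generalize e - σ ^ 2 * b = D' at *
  generalize e - τ ^ 2 * b = D'' at *
  field_simp

/-- The moved variable has residue `τ² - 1` in place of `τ⁻² - 1`, its pole is multiplied by `σ²`,
and the zero mode contributes `(τσ)⁻²`. These changes multiply to `-1`. -/
theorem residue_cancel {τ σ b C Z : F} (hτ : τ ≠ 0) (hσ : σ ≠ 0) (φ : F) :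
    C * (Z * ((((τ ^ 2)⁻¹ - 1) * φ) * (((τ * b)⁻¹)⁻¹))) =
     - (C * (Z * ((τ * σ) ^ 2)⁻¹ * (((τ ^ 2 - 1) * φ) * ((τ * (b * (τ * σ) ^ 2)⁻¹)⁻¹)))) := by
  simp only [mul_inv, inv_inv]
  field_simp
  ring

/-- The analogue after two moves, with zero mode `(τσ)⁻⁴`: the residue at the pole of `b` is
compared with that of the moved `e`, when `e = σ² b`. -/
theorem residue_cancel_double {τ σ b e C Z : F} (hτ : τ ≠ 0) (hσ : σ ≠ 0) (hb : b ≠ 0)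
   (h1 : e - b ≠ 0) (he : e = σ ^ 2 * b) :
    C * (Z * ((((τ ^ 2)⁻¹ - 1) * (1 + ((τ ^ 2)⁻¹ - 1) * (τ * b)⁻¹ / ((τ * b)⁻¹ - (τ * e)⁻¹))) * (((τ * b)⁻¹)⁻¹))) =
     - (C * (Z * ((τ * σ) ^ 4)⁻¹ * (((τ ^ 2 - 1) * (1 + (τ ^ 2 - 1) * (τ * (e * (τ * σ) ^ 2)⁻¹) /
        (τ * (e * (τ * σ) ^ 2)⁻¹ - τ * (b * (τ * σ) ^ 2)⁻¹))) * ((τ * (e * (τ * σ) ^ 2)⁻¹)⁻¹)))) := by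
  subst he
  have e1 : (τ * b)⁻¹ - (τ * (σ ^ 2 * b))⁻¹ = (σ ^ 2 - 1) / (τ * b * σ ^ 2) := by field_simp
  have e2 : τ * ((σ ^ 2 * b) * (τ * σ) ^ 2)⁻¹ - τ * (b * (τ * σ) ^ 2)⁻¹ =
      (1 - σ ^ 2) / (τ * σ ^ 4 * b) := by field_simp
  have h2 : σ ^ 2 - 1 ≠ 0 := fun h => h1 (by linear_combination b * h)
  have h3 : 1 - σ ^ 2 ≠ 0 := fun h => h1 (by linear_combination -b * h)
  rw [e1, e2]
  field_simp
  ring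

/-- The factor of `Y(ze)` has its zero at `w = (e / τ) z`, which for `e = τ² b` is the pole `w = τ b
z` of the factor of `Y(zb)`. -/
theorem residue_eq_zero {τ b e : F} (hτ : τ ≠ 0) (hb : b ≠ 0) 
   (h1 : e - b ≠ 0) (he : e = τ ^ 2 * b) :
   1 + ((τ ^ 2)⁻¹ - 1) * (τ * b)⁻¹ / ((τ * b)⁻¹ - (τ * e)⁻¹) = 0 := by
  subst he
  have h2 : τ ^ 2 - 1 ≠ 0 := fun h => h1 (by linear_combination b * h)
  have e1 : (τ * b)⁻¹ - (τ * (τ ^ 2 * b))⁻¹ = (τ ^ 2 - 1) / (τ * b * τ ^ 2) := by field_simp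
  rw [e1]
  field_simp
  ring

theorem residue_eq_zero' {τ c b e : F} (hτ : τ ≠ 0) (hb : b ≠ 0) (hc : c ≠ 0)
   (h1 : e - b ≠ 0) (he : e = τ ^ 2 * b) :
   1 + (τ ^ 2 - 1) * (τ * (e * c)⁻¹) / (τ * (e * c)⁻¹ - τ * (b * c)⁻¹) = 0 := by
  subst he
  have h2 : 1 - τ ^ 2 ≠ 0 := fun h => h1 (by linear_combination -b * h)
  have e1 : τ * (τ ^ 2 * b * c)⁻¹ - τ * (b * c)⁻¹ = (1 - τ ^ 2) / (τ * b * c) := by field_simp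
  rw [e1]
  field_simp
  ring

end Residues

variable {l i : ℕ}

/-! ### Ratios of spectral parameters at a node -/

/-- The ratio of the two spectral parameters at a node is nondegenerate. -/
theorem slotRatio_ne {j : Fin i → ℕ} (hj : j ∈ indexSet l i) {x : ℕ} (h1 : 1 ≤ x)
    (h2 : x + 1 ≤ 2 * l) (hs : sgn j x = 1) (hxl : x ≠ l) (h : sgn j (2 * l - x) ≠ 0) :
    slotRatio l j x ≠ 1 ∧ q ^ (-2 : ℤ) * t ^ 2 * slotRatio l j x ≠ 1 := by
  obtain ⟨n, -, h, -, -⟩ := exists_flip_data hj h1 h2 hs hxl h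
  rcases h with h | h <;> rw [h]
  · refine ⟨fun H => one_sub_qt_ne_zero (m := 4 - 2 * n) (n := 2 * n - 2) (by omega) (by rw [H, sub_self]),
      fun H => one_sub_qt_ne_zero (m := 2 - 2 * n) (n := 2 * n) (by omega) ?_⟩
    rw [show 2 - 2 * n = -2 + (4 - 2 * n) by ring, show 2 * n = 2 + (2 * n - 2) by ring,
      zpow_add₀ q_ne_zero, zpow_add₀ t_ne_zero, sub_eq_zero, ← H]
    simp only [zpow_ofNat]
    ring_nf
  · refine ⟨fun H => one_sub_qt_ne_zero (m := 2 * n - 2) (n := -(2 * n)) (by omega) (by rw [H, sub_self]),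
      fun H => one_sub_qt_ne_zero (m := 2 * n - 4) (n := 2 - 2 * n) (by omega) ?_⟩
    rw [show 2 * n - 4 = -2 + (2 * n - 2) by ring, show 2 - 2 * n = 2 + -(2 * n) by ring,
      zpow_add₀ q_ne_zero, zpow_add₀ t_ne_zero, sub_eq_zero, ← H]
    simp only [zpow_ofNat]
    ring

theorem slotRatio_ne_of_flip_mem {j : Fin i → ℕ} (hj : j ∈ indexSet l i) {x : ℕ} (h1 : 1 ≤ x)
    (h2 : x + 1 ≤ 2 * l) (hs : sgn j x = 1) (hxl : x ≠ l) (h : sgn j (2 * l - x) ≠ 0)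
    (hf : flip x j ∈ indexSet l i) :
    q ^ (-2 : ℤ) * slotRatio l j x ≠ 1 ∧ t ^ 2 * slotRatio l j x ≠ 1 := by
  obtain ⟨n, -, h, hn, -⟩ := exists_flip_data hj h1 h2 hs hxl h
  rw [hn] at hf
  have e1 : ∀ a b : ℤ, q ^ (-2 : ℤ) * (q ^ a * t ^ b) = q ^ (-2 + a) * t ^ b := fun a b => by
    rw [zpow_add₀ q_ne_zero, mul_assoc]
  have e2 : ∀ a b : ℤ, t ^ 2 * (q ^ a * t ^ b) = q ^ a * t ^ (2 + b) := fun a b => by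
    rw [zpow_add₀ t_ne_zero, mul_left_comm]; norm_cast
  have e3 : ∀ a b : ℤ, ¬(a = 0 ∧ b = 0) → q ^ a * t ^ b ≠ 1 := fun a b hab H =>
    one_sub_qt_ne_zero hab (by rw [H, sub_self])
  rcases h with h | h <;> rw [h, e1, e2] <;> exact ⟨e3 _ _ (by omega), e3 _ _ (by omega)⟩

theorem slotRatio_of_flip_not_mem {j : Fin i → ℕ} (hj : j ∈ indexSet l i) {x : ℕ} (h1 : 1 ≤ x)
    (h2 : x + 1 ≤ 2 * l) (hs : sgn j x = 1) (hxl : x ≠ l) (h : sgn j (2 * l - x) ≠ 0)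
    (hf : flip x j ∉ indexSet l i) :
    q ^ (-2 : ℤ) * slotRatio l j x = 1 ∨ t ^ 2 * slotRatio l j x = 1 := by
  obtain ⟨n, -, h, hn, -⟩ := exists_flip_data hj h1 h2 hs hxl h
  rw [hn, not_not] at hf
  subst hf
  rcases h with h | h <;> rw [h]
  · left
    rw [← mul_assoc, ← zpow_add₀ q_ne_zero]; norm_num
  · right
    rw [mul_left_comm]
    rw [show (-(2 * 1) : ℤ) = -(2 : ℕ) by norm_num, zpow_neg, zpow_natCast,
      mul_inv_cancel₀ (pow_ne_zero 2 t_ne_zero)]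
    norm_num

theorem block_inv (x : KFrac) (hx : x ≠ 0) :
    block 1 x⁻¹ = block 1 (x * (q ^ (-2 : ℤ) * t ^ 2)⁻¹) := by
  have hp : q ^ (-2 : ℤ) ≠ 0 := zpow_ne_zero _ q_ne_zero
  have ht : t ^ 2 ≠ 0 := pow_ne_zero _ t_ne_zero
  rw [block, block]
  simp only [Nat.cast_one, mul_one]
  exact block_scalar_inv hp ht hx

end

end DeformedW

namespace DeformedW
noncomputable section
open PowerSeries Finset.HasAntidiagonal

/-! ### Commutators with the screening operators -/

section Screening

variable {l i : ℕ} {σ τ : KFrac}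

theorem IsScreenPair.sq_eq (h : IsScreenPair 1 σ τ) :
    (q ^ (-2 : ℤ) = σ ^ 2 ∧ t ^ 2 = τ ^ 2) ∨ (q ^ (-2 : ℤ) = τ ^ 2 ∧ t ^ 2 = σ ^ 2) := by
  have e : q ^ (-2 : ℤ) = (q ^ (-((1 : ℕ) : ℤ))) ^ 2 := by
    rw [← zpow_natCast, ← zpow_mul]; norm_num
  rcases h with ⟨rfl, rfl⟩ | ⟨rfl, rfl⟩
  · exact Or.inl ⟨e, rfl⟩
  · exact Or.inr ⟨e, rfl⟩

/-- `block` is symmetric in `q^{-2}` and `t²`, so the coefficients favour neither kind of screening;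
this is why one field commutes with both. -/
theorem IsScreenPair.block_eq (h : IsScreenPair 1 σ τ) (y : KFrac) : block 1 y =
    ((1 - σ ^ 2 * y) * (1 - τ ^ 2 * y)) / ((1 - y) * (1 - σ ^ 2 * τ ^ 2 * y)) := by
  simp only [block, Nat.cast_one, mul_one]
  rcases h.sq_eq with ⟨h1, h2⟩ | ⟨h1, h2⟩ <;> rw [h1, h2]
  rw [mul_comm (1 - τ ^ 2 * y), mul_comm (τ ^ 2) (σ ^ 2)]

theorem IsScreenPair.product_eq (h : IsScreenPair 1 σ τ) : q ^ (-2 : ℤ) * t ^ 2 = τ ^ 2 * σ ^ 2 := by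
  rcases h.sq_eq with ⟨h1, h2⟩ | ⟨h1, h2⟩ <;> rw [h1, h2]
  rw [mul_comm]

theorem typeC_d_of_ne {κ : Fin l} {x : ℕ} (hx : x ∈ nodeSlots κ) (hxl : x ≠ l) :
    (typeC l).d κ = 1 := by
  have := κ.2
  rw [nodeSlots_iff] at hx
  rw [typeC_d, if_neg (by omega)]

theorem one_le_of_mem_nodeSlots {κ : Fin l} {x : ℕ} (hx : x ∈ nodeSlots κ) :
    1 ≤ x ∧ x + 1 ≤ 2 * l ∧ 2 * l - (2 * l - x) = x := by
  have := κ.2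
  rw [nodeSlots_iff] at hx
  omega

theorem slotSpec_val_flip {j : Fin i → ℕ} (hj : Function.Injective j) {κ : Fin l}
    (h : IsScreenPair ((typeC l).d κ) σ τ) {x : ℕ} (hx : x ∈ nodeSlots κ) (hs : sgn j x = 1) :
    (slotSpec l (flip x j) x).val = (slotSpec l j x).val * (τ * σ) ^ 2 := by
  rw [slotSpec_flip_self j hx ((occ_of_sgn hj).1 hs), Spec.val_shift, h.mul_eq, mul_pow,
    ← zpow_natCast (q ^ _), ← zpow_mul, ← zpow_natCast t]
  congr 3
  push_cast; ring

variable (l) in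
/-- The exponent of the other variable at the node. -/
def otherSgn (j : Fin i → ℕ) (x : ℕ) : ℤ := if x = l then 0 else sgn j (2 * l - x)

/-- The two spectral parameters at a node, in terms of a screening pair. -/
theorem slot_sub_ne {j : Fin i → ℕ} (hj : j ∈ indexSet l i) {κ : Fin l}
    (h : IsScreenPair ((typeC l).d κ) σ τ) {x : ℕ} (hx : x ∈ nodeSlots κ) (hs : sgn j x = 1)
    (hxl : x ≠ l) (h0 : sgn j (2 * l - x) ≠ 0) :
    (slotSpec l j (2 * l - x)).val - (slotSpec l j x).val ≠ 0 ∧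
    (slotSpec l j (2 * l - x)).val - τ ^ 2 * σ ^ 2 * (slotSpec l j x).val ≠ 0 ∧
    (flip x j ∈ indexSet l i →
      (slotSpec l j (2 * l - x)).val - σ ^ 2 * (slotSpec l j x).val ≠ 0 ∧
      (slotSpec l j (2 * l - x)).val - τ ^ 2 * (slotSpec l j x).val ≠ 0) ∧
    (flip x j ∉ indexSet l i →
      (slotSpec l j (2 * l - x)).val = σ ^ 2 * (slotSpec l j x).val ∨
      (slotSpec l j (2 * l - x)).val = τ ^ 2 * (slotSpec l j x).val) := by
  obtain ⟨h1, h2, -⟩ := one_le_of_mem_nodeSlots hx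
  rw [typeC_d_of_ne hx hxl] at h
  have A := slotRatio_ne hj h1 h2 hs hxl h0
  have B := slotRatio_ne_of_flip_mem hj h1 h2 hs hxl h0
  have C := slotRatio_of_flip_not_mem hj h1 h2 hs hxl h0
  have he := (slotSpec l j (2 * l - x)).val_ne_zero
  rw [h.product_eq] at A
  unfold slotRatio at A B C
  have key : ∀ c : KFrac, c * ((slotSpec l j x).val / (slotSpec l j (2 * l - x)).val) = 1 ↔
      (slotSpec l j (2 * l - x)).val = c * (slotSpec l j x).val := fun c => by
    rw [← mul_div_assoc, div_eq_one_iff_eq he, eq_comm]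
  have key1 := key 1
  simp only [one_mul] at key1
  simp only [Ne, sub_eq_zero]
  rw [Ne, key1, Ne, key] at A
  rw [Ne, key, Ne, key] at B
  rw [key, key] at C
  refine ⟨A.1, A.2, fun H => ?_, fun H => ?_⟩
  · rcases h.sq_eq with ⟨h3, h4⟩ | ⟨h3, h4⟩ <;> rw [h3, h4] at B
    · exact B H
    · exact (B H).symm
  · rcases h.sq_eq with ⟨h3, h4⟩ | ⟨h3, h4⟩ <;> rw [h3, h4] at C
    · exact C H
    · exact (C H).symm

theorem poleInv_one (a : KFrac) : poleInv τ 1 a = (τ * a)⁻¹ := if_pos rfl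

theorem poleInv_neg_one (a : KFrac) : poleInv τ (-1) a = τ * a⁻¹ := by
  rw [poleInv, if_neg (by decide), if_pos rfl]

theorem poleRes_one : poleRes τ 1 = (τ ^ 2)⁻¹ - 1 := if_pos rfl

theorem poleRes_neg_one : poleRes τ (-1) = τ ^ 2 - 1 := by
  rw [poleRes, if_neg (by decide), if_pos rfl]

theorem poleRes_zero : poleRes τ 0 = 0 := by
  rw [poleRes, if_neg (by decide), if_neg (by decide)]

theorem far_other {x : ℕ} (h : x + 1 ≤ 2 * l) (hxl : x ≠ l) :
    (x + 1 < 2 * l - x ∨ 2 * l - x + 1 < x) := by omega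

theorem poleInv_ne_of_one {j : Fin i → ℕ} (hj : j ∈ indexSet l i) {κ : Fin l}
    (h : IsScreenPair ((typeC l).d κ) σ τ) {x : ℕ} (hx : x ∈ nodeSlots κ) (hs : sgn j x = 1)
    (hxl : x ≠ l) (h0 : sgn j (2 * l - x) ≠ 0) :
    poleInv τ (sgn j x) (slotSpec l j x).val ≠
      poleInv τ (sgn j (2 * l - x)) (slotSpec l j (2 * l - x)).val := by
  obtain ⟨h1, h2, -⟩ := one_le_of_mem_nodeSlots hx
  have hb := (slotSpec l j x).val_ne_zero
  have he := (slotSpec l j (2 * l - x)).val_ne_zero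
  have hτ := h.ne_zero.2
  obtain ⟨A, -, B, -⟩ := slot_sub_ne hj h hx hs hxl h0
  have hf := flip_flip_mem hj h1 h2 (by omega)
  have := (occ_of_sgn (mem_indexSet.1 hj).2.1.injective (x := 2 * l - x)).2.2
  rw [hs, poleInv_one]
  rcases this with h3 | h3 | h3
  · rw [h3, poleInv_one]
    intro H
    exact A (sub_eq_zero.2 (mul_left_cancel₀ hτ (inv_injective H)).symm)
  · exact absurd h3 h0
  · rw [h3, poleInv_neg_one]
    intro H
    -- With opposite signs at the node the move must stay in `S`, since a blocked move would force
    -- equal signs.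
    refine (B ?_).2 (sub_eq_zero.2 ?_)
    · by_contra hn
      have := (hf hn).2.1
      omega
    · field_simp at H
      exact H

theorem sgn_flip_flip {x y : ℕ} (far : x + 1 < y ∨ y + 1 < x) (j : Fin i → ℕ) :
    sgn (flip x (flip y j)) x = -sgn j x ∧ sgn (flip x (flip y j)) y = -sgn j y := by
  rw [sgn_flip_self, sgn_flip_of_far far.symm, sgn_flip_of_far far, sgn_flip_self]
  exact ⟨rfl, rfl⟩

theorem slotSpec_val_flip_flip {j : Fin i → ℕ} (hj : Function.Injective j) {κ : Fin l}
    (h : IsScreenPair ((typeC l).d κ) σ τ) {x : ℕ} (hx : x ∈ nodeSlots κ) (hxl : x ≠ l)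
    (hs : sgn j x = 1) (hs' : sgn j (2 * l - x) = 1) :
    (slotSpec l (flip x (flip (2 * l - x) j)) x).val = (slotSpec l j x).val * (τ * σ) ^ 2 ∧
    (slotSpec l (flip x (flip (2 * l - x) j)) (2 * l - x)).val =
      (slotSpec l j (2 * l - x)).val * (τ * σ) ^ 2 := by
  have far := far_other (one_le_of_mem_nodeSlots hx).2.1 hxl
  constructor
  · rw [flip_comm far, slotSpec_flip_of_far _ far.symm, slotSpec_val_flip hj h hx hs]
  · rw [slotSpec_flip_of_far _ far, slotSpec_val_flip hj h (other_mem_nodeSlots hx) hs']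

/-- If one variable is positive this is the previous case. If both are negative, moving one box
down, or both when a single move is blocked, turns a coincidence of poles into one excluded by
`slot_sub_ne`. -/
theorem poleInv_ne {j : Fin i → ℕ} (hj : j ∈ indexSet l i) {κ : Fin l}
    (h : IsScreenPair ((typeC l).d κ) σ τ) {x : ℕ} (hx : x ∈ nodeSlots κ) (hs : sgn j x ≠ 0)
    (hxl : x ≠ l) (h0 : sgn j (2 * l - x) ≠ 0) :
    poleInv τ (sgn j x) (slotSpec l j x).val ≠
      poleInv τ (sgn j (2 * l - x)) (slotSpec l j (2 * l - x)).val := by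
  obtain ⟨h1, h2, h3⟩ := one_le_of_mem_nodeSlots hx
  have hinj := (mem_indexSet.1 hj).2.1.injective
  rcases (occ_of_sgn hinj (x := x)).2.2 with hs1 | hs1 | hs1
  · exact poleInv_ne_of_one hj h hx hs1 hxl h0
  · exact absurd hs1 hs
  rcases (occ_of_sgn hinj (x := 2 * l - x)).2.2 with hs2 | hs2 | hs2
  · have := poleInv_ne_of_one hj h (other_mem_nodeSlots hx) hs2 (by omega) (by rwa [h3])
    rw [h3] at this
    exact this.symm
  · exact absurd hs2 h0
  have hb := (slotSpec l j x).val_ne_zero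
  have he := (slotSpec l j (2 * l - x)).val_ne_zero
  have hτ := h.ne_zero.2
  have hσ := h.ne_zero.1
  have far := far_other h2 hxl
  rw [hs1, hs2, poleInv_neg_one, poleInv_neg_one]
  intro H
  have H := inv_injective (mul_left_cancel₀ hτ H)
  by_cases hf : flip x j ∈ indexSet l i
  · have hs' : sgn (flip x j) x = 1 := by rw [sgn_flip_self, hs1]; rfl
    have h4 := slotSpec_val_flip (mem_indexSet.1 hf).2.1.injective h hx hs'
    rw [flip_flip] at h4
    obtain ⟨-, A, -, -⟩ := slot_sub_ne hf h hx hs' hxl (by rwa [sgn_flip_of_far far])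
    rw [slotSpec_flip_of_far _ far, ← H, h4] at A
    exact A (by ring)
  · obtain ⟨-, -, -, hf⟩ := flip_flip_mem hj h1 h2 hs hf
    obtain ⟨j₀, rfl⟩ : ∃ j₀, j = flip x (flip (2 * l - x) j₀) :=
      ⟨flip x (flip (2 * l - x) j), by rw [flip_comm far, flip_flip, flip_flip]⟩
    rw [flip_comm far, flip_flip, flip_flip] at hf
    have hinj₀ := (mem_indexSet.1 hf).2.1.injective
    have e := sgn_flip_flip far j₀
    have hs1' : sgn j₀ x = 1 := by omega
    have hs2' : sgn j₀ (2 * l - x) = 1 := by omega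
    have e' := slotSpec_val_flip_flip hinj₀ h hx hxl hs1' hs2'
    rw [e'.1, e'.2] at H
    exact (slot_sub_ne hf h hx hs1' hxl (by omega)).1
      (sub_eq_zero.2 (mul_right_cancel₀ (pow_ne_zero 2 (mul_ne_zero hτ hσ)) H).symm)

end Screening

end

end DeformedW

/-! ### Cancellation of the residues -/

namespace DeformedW
noncomputable section
open PowerSeries Finset.HasAntidiagonal

section ScreeningSum

variable {l i : ℕ} {σ τ : KFrac}

variable (l) in
/-- The scalar attached to the slot `x` in the commutator of `Λ_𝐣` with a screening operator. -/
def slotRes (τ : KFrac) (j : Fin i → ℕ) (x : ℕ) : KFrac :=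
  poleRes₂ τ (sgn j x) (slotSpec l j x).val (otherSgn l j x) (slotSpec l j (2 * l - x)).val *
    (poleInv τ (sgn j x) (slotSpec l j x).val)⁻¹

/-- The modes of the vertex operator attached to the slot `x` in this commutator. -/
def slotFam (σ τ : KFrac) (κ : Fin l) (j : Fin i → ℕ) (x : ℕ) : ModeFamily l :=
  monFam (typeC l) (lambdaMon l i j) +
    scaleFam (poleInv τ (sgn j x) (slotSpec l j x).val)⁻¹ (screenFam σ κ)

theorem slotRes_eq_zero {j : Fin i → ℕ} {x : ℕ} (h : sgn j x = 0) : slotRes l τ j x = 0 := by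
  rw [slotRes, poleRes₂, h, poleRes_zero, zero_mul, zero_mul]

theorem lambdaMon_commutator (hl : 2 ≤ l) {κ : Fin l} {μ : Weights l}
    {S : Module.End KFrac (TotalFock l)} (hS : IsScreening κ σ τ μ S) {j : Fin i → ℕ}
    (hj : j ∈ indexSet l i) (n : ℤ) (v : Fock l) :
    (lambdaMon l i j).field (typeC l) n (S (Finsupp.single 0 v)) -
      S ((lambdaMon l i j).field (typeC l) n (Finsupp.single 0 v)) =
    Finsupp.single μ (zeroVal (typeC l) 0 (lambdaMon l i j) • ∑ x ∈ nodeSlots κ,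
      slotRes l τ j x • normalExp (typeC l) (slotFam σ τ κ j x) (n - 1) v) := by
  have hinj := (mem_indexSet.1 hj).2.1.injective
  have hκ := κ.2
  have hx : (κ : ℕ) + 1 ∈ nodeSlots κ := nodeSlots_iff.2 (Or.inl rfl)
  have hs : ∀ x, sgn j x = -1 ∨ sgn j x = 0 ∨ sgn j x = 1 := fun x => by
    have := (occ_of_sgn hinj (x := x)).2.2
    omega
  have hs' : otherSgn l j (κ + 1) = -1 ∨ otherSgn l j (κ + 1) = 0 ∨ otherSgn l j (κ + 1) = 1 := by
    rw [otherSgn]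
    split_ifs
    · exact Or.inr (Or.inl rfl)
    · exact hs _
  rw [field_commutator hl hS (hs (κ + 1)) hs'
    (M₀ := lambdaMon l i j - Finsupp.single (κ, slotSpec l j (κ + 1)) (sgn j (κ + 1)) -
      Finsupp.single (κ, slotSpec l j (2 * l - (κ + 1))) (otherSgn l j (κ + 1)))
    (a₁ := slotSpec l j (κ + 1)) (a₂ := slotSpec l j (2 * l - (κ + 1))) ?_ ?_ ?_ n v]
  · congr 2
    rw [sum_nodeSlots]
    refine congrArg₂ (· + ·) rfl ?_
    split_ifs with hκl
    · rw [otherSgn, if_pos hκl, poleRes₂, poleRes_zero, zero_mul, zero_mul, zero_smul]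
    · have e1 : otherSgn l j (κ + 1) = sgn j (2 * l - (κ + 1)) := if_neg hκl
      have e2 : otherSgn l j (2 * l - (κ + 1)) = sgn j (κ + 1) := by
        rw [otherSgn, if_neg (by omega)]
        congr 1; omega
      rw [slotRes, slotFam, e1, e2, show 2 * l - (2 * l - ((κ : ℕ) + 1)) = κ + 1 by omega]
  · intro a
    rw [Finsupp.sub_apply, Finsupp.sub_apply, lambdaMon_apply hl hj, sum_nodeSlots,
      Finsupp.single_apply, Finsupp.single_apply, otherSgn]
    simp only [Prod.mk.injEq, true_and]
    grind
  · rw [sub_add_eq_add_sub, sub_add_cancel, sub_add_cancel]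
  · by_cases h1 : sgn j (κ + 1) = 0
    · exact Or.inl h1
    by_cases h2 : otherSgn l j (κ + 1) = 0
    · exact Or.inr (Or.inl h2)
    refine Or.inr (Or.inr ?_)
    rw [otherSgn] at h2 ⊢
    split_ifs at h2 ⊢ with h3
    · exact absurd rfl h2
    · exact poleInv_ne hj hS.pair hx h1 h3 h2

theorem monFam_flip (hl : 2 ≤ l) {κ : Fin l} (h : IsScreenPair ((typeC l).d κ) σ τ)
    {j : Fin i → ℕ} (hj : StrictMono j) {x : ℕ} (hx : x ∈ nodeSlots κ) (hs : sgn j x = 1) :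
    monFam (typeC l) (lambdaMon l i (flip x j)) +
        scaleFam ((slotSpec l j x).val * τ * σ ^ 2) (screenFam σ κ) =
      monFam (typeC l) (lambdaMon l i j) +
        scaleFam ((slotSpec l j x).val * τ) (screenFam σ κ) := by
  rw [lambdaMon_flip hl hj hx hs, expand, monFam_sub_aMon hl h]

theorem zeroVal_flip (hl : 2 ≤ l) {κ : Fin l} (h : IsScreenPair ((typeC l).d κ) σ τ)
    {j : Fin i → ℕ} (hj : StrictMono j) {x : ℕ} (hx : x ∈ nodeSlots κ) (hs : sgn j x = 1) :
    zeroVal (typeC l) 0 (lambdaMon l i (flip x j)) =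
      zeroVal (typeC l) 0 (lambdaMon l i j) * ((τ * σ) ^ 2)⁻¹ := by
  rw [h.mul_eq, ← zeroVal_aMon hl κ ((slotSpec l j x).shift (-((typeC l).d κ : ℤ)) 1),
    eq_mul_inv_iff_mul_eq₀ (zeroVal_ne_zero _ _ _), ← zeroVal_add, lambdaMon_flip hl hj hx hs,
    expand, sub_add_cancel]

/-- The total scalar attached to `(𝐣, x)` in the commutator of the field with a screening
operator. -/
def slotCoeff (τ : KFrac) (j : Fin i → ℕ) (x : ℕ) : KFrac :=
  algebraMap KRing KFrac (boxCoeff l j) *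
    (zeroVal (typeC l) 0 (lambdaMon l i j) * slotRes l τ j x)

theorem slotFam_flip (hl : 2 ≤ l) {κ : Fin l} (h : IsScreenPair ((typeC l).d κ) σ τ)
    {j : Fin i → ℕ} (hj : j ∈ indexSet l i) {x : ℕ} (hx : x ∈ nodeSlots κ) (hs : sgn j x = 1) :
    slotFam σ τ κ (flip x j) x = slotFam σ τ κ j x := by
  have hm := (mem_indexSet.1 hj).2.1
  have hb := (slotSpec l j x).val_ne_zero
  have hτ := h.ne_zero.2
  rw [slotFam, slotFam, sgn_flip_self, hs, poleInv_one, poleInv_neg_one, inv_inv,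
    slotSpec_val_flip hm.injective h hx hs, mul_comm τ (slotSpec l j x).val,
    ← monFam_flip hl h hm hx hs]
  congr 2
  field_simp

theorem otherSgn_flip (j : Fin i → ℕ) {κ : Fin l} {x : ℕ} (hx : x ∈ nodeSlots κ) :
    otherSgn l (flip x j) x = otherSgn l j x := by
  rw [otherSgn, otherSgn]
  split_ifs with h
  · rfl
  · exact sgn_flip_of_far (far_other (one_le_of_mem_nodeSlots hx).2.1 h) j

/-- The coefficient changes by the power of `block` prescribed by the algorithm, and the influence
of the other variable on the residue changes by the inverse of that power. What is left is the
one-variable identity `residue_cancel`. -/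
theorem slotCoeff_flip (hl : 2 ≤ l) {κ : Fin l} (h : IsScreenPair ((typeC l).d κ) σ τ)
    {j : Fin i → ℕ} (hj : j ∈ indexSet l i) {x : ℕ} (hx : x ∈ nodeSlots κ) (hs : sgn j x = 1)
    (hf : flip x j ∈ indexSet l i) :
    slotCoeff (l := l) τ j x = -slotCoeff (l := l) τ (flip x j) x := by
  have hm := (mem_indexSet.1 hj).2.1
  have hb := (slotSpec l j x).val_ne_zero
  have he := (slotSpec l j (2 * l - x)).val_ne_zero
  obtain ⟨hσ, hτ⟩ := h.ne_zero
  have hneg : sgn (flip x j) x = -1 := by rw [sgn_flip_self, hs]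
  by_cases h0 : otherSgn l j x = 0
  · have hC : algebraMap KRing KFrac (boxCoeff l (flip x j)) =
        algebraMap KRing KFrac (boxCoeff l j) := by
      rw [algebraMap_boxCoeff_flip hl hj hx hs]
      rw [otherSgn] at h0
      split_ifs at h0 ⊢ with hxl
      · rw [mul_one]
      · rw [h0, zpow_zero, mul_one]
    rw [slotCoeff, slotCoeff, slotRes, slotRes, otherSgn_flip j hx, h0, hC, zeroVal_flip hl h hm hx hs,
      hneg, hs, poleRes₂, poleRes₂, poleRes_zero, zero_mul, zero_div, zero_mul, zero_div, poleRes_one,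
      poleRes_neg_one, poleInv_one, poleInv_neg_one, slotSpec_val_flip hm.injective h hx hs]
    exact residue_cancel hτ hσ _
  have hxl : x ≠ l := fun hxl => h0 (if_pos hxl)
  have ho : otherSgn l j x = sgn j (2 * l - x) := if_neg hxl
  have far := far_other (one_le_of_mem_nodeSlots hx).2.1 hxl
  rw [ho] at h0
  obtain ⟨A, B, D, -⟩ := slot_sub_ne hj h hx hs hxl h0
  obtain ⟨D, E⟩ := D hf
  have hC := algebraMap_boxCoeff_flip hl hj hx hs
  rw [if_neg hxl] at hC
  have hC' := hC
  have hblock := h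
  rw [typeC_d_of_ne hx hxl] at hblock
  rw [hblock.block_eq, slotRatio] at hC
  have hne : algebraMap KRing KFrac (boxCoeff l (flip x j)) ≠ 0 := by
    rw [Ne, FaithfulSMul.algebraMap_eq_zero_iff]
    exact boxCoeff_ne_zero hf
  rw [slotCoeff, slotCoeff, slotRes, slotRes, otherSgn_flip j hx, ho, zeroVal_flip hl h hm hx hs,
    hneg, hs, poleRes₂, poleRes₂, poleRes_one, poleRes_neg_one, poleInv_one, poleInv_neg_one,
    slotSpec_val_flip hm.injective h hx hs, slotSpec_flip_of_far _ far]
  rcases (occ_of_sgn hm.injective (x := 2 * l - x)).2.2 with h3 | h3 | h3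
  · rw [h3, zpow_one] at hC
    rw [h3, poleRes_one, poleInv_one, pole_residue_plus hτ hσ hb he A B D, hC]
    generalize (_ / _ : KFrac) = P
    rw [residue_cancel hτ hσ]
    ring
  · exact absurd h3 h0
  · rw [h3, zpow_neg_one] at hC
    rw [h3, poleRes_neg_one, poleInv_neg_one, pole_residue_minus hτ hσ hb he D B E, hC]
    rw [residue_cancel hτ hσ]
    ring

/-- The box at `2 l - x` is moved first, which multiplies by `block` of the inverse ratio; the
second move divides by `block` of the ratio shifted by `(q^{-2} t²)⁻¹`. By `block_inv` the two
values agree. -/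
theorem boxCoeff_flip_flip (hl : 2 ≤ l) {j : Fin i → ℕ} (hj : j ∈ indexSet l i) {κ : Fin l}
    {x : ℕ} (hx : x ∈ nodeSlots κ) (hs : sgn j x = 1) (hf : flip x j ∉ indexSet l i) :
    algebraMap KRing KFrac (boxCoeff l (flip x (flip (2 * l - x) j))) =
      algebraMap KRing KFrac (boxCoeff l j) := by
  obtain ⟨h1, h2, h3⟩ := one_le_of_mem_nodeSlots hx
  obtain ⟨hxl, hs', hf', -⟩ := flip_flip_mem hj h1 h2 (by omega) hf
  rw [hs] at hs'
  have far := far_other h2 hxl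
  have hb := (slotSpec l j x).val_ne_zero
  have he := (slotSpec l j (2 * l - x)).val_ne_zero
  -- The statement involves no screening operator; either pair would serve to compute the moved
  -- parameter.
  have hpair : IsScreenPair ((typeC l).d κ) (q ^ (-((typeC l).d κ : ℤ))) t := Or.inl ⟨rfl, rfl⟩
  have hpair' := hpair
  rw [typeC_d_of_ne hx hxl] at hpair'
  have hval := slotSpec_val_flip (mem_indexSet.1 hj).2.1.injective hpair (other_mem_nodeSlots hx) hs'
  have hpos : (t * q ^ (-((typeC l).d κ : ℤ))) ^ 2 = q ^ (-2 : ℤ) * t ^ 2 := by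
    rw [mul_pow, hpair'.product_eq, typeC_d_of_ne hx hxl]
  have e1 := algebraMap_boxCoeff_flip hl hj (other_mem_nodeSlots hx) hs'
  rw [if_neg (by omega), h3, hs, zpow_one] at e1
  have e2 := algebraMap_boxCoeff_flip hl hf' hx (by rw [sgn_flip_of_far far.symm, hs])
  rw [if_neg hxl, sgn_flip_self, hs', zpow_neg_one, e1] at e2
  have hne : algebraMap KRing KFrac (boxCoeff l (flip (2 * l - x) j)) ≠ 0 := by
    rw [Ne, FaithfulSMul.algebraMap_eq_zero_iff]
    exact boxCoeff_ne_zero hf'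
  rw [e1] at hne
  have e3 : slotRatio l (flip (2 * l - x) j) x = slotRatio l j x * (q ^ (-2 : ℤ) * t ^ 2)⁻¹ := by
    rw [slotRatio, slotRatio, slotSpec_flip_of_far _ far.symm, hval, hpos, div_mul_eq_div_div,
      div_eq_mul_inv (_ / _)]
  have e4 : slotRatio l j (2 * l - x) = (slotRatio l j x)⁻¹ := by
    rw [slotRatio, slotRatio, h3, inv_div]
  rw [e2, e3, ← block_inv (slotRatio l j x) (div_ne_zero hb he), ← e4, mul_assoc, mul_inv_cancel₀, mul_one]
  exact right_ne_zero_of_mul hne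

/-- With `e = σ² b` the two difference equations chain: they relate the currents at `τb`, `τσ²b` and
at `τσ²b`, `τσ⁴b`, and the middle terms cancel. -/
theorem slotFam_flip_flip (hl : 2 ≤ l) {κ : Fin l} (h : IsScreenPair ((typeC l).d κ) σ τ)
    {j : Fin i → ℕ} (hj : j ∈ indexSet l i) {x : ℕ} (hx : x ∈ nodeSlots κ) (hxl : x ≠ l)
    (hs : sgn j x = 1) (hs' : sgn j (2 * l - x) = 1) (hf : flip (2 * l - x) j ∈ indexSet l i)
    (he : (slotSpec l j (2 * l - x)).val = σ ^ 2 * (slotSpec l j x).val) :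
    slotFam σ τ κ (flip x (flip (2 * l - x) j)) (2 * l - x) = slotFam σ τ κ j x := by
  have hm := (mem_indexSet.1 hj).2.1
  have far := far_other (one_le_of_mem_nodeSlots hx).2.1 hxl
  have hb := (slotSpec l j x).val_ne_zero
  obtain ⟨hσ, hτ⟩ := h.ne_zero
  have hsf : sgn (flip (2 * l - x) j) x = 1 := by rw [sgn_flip_of_far far.symm, hs]
  have e1 := monFam_flip hl h (mem_indexSet.1 hf).2.1 hx hsf
  have e2 := monFam_flip hl h hm (other_mem_nodeSlots hx) hs'
  rw [slotSpec_flip_of_far _ far.symm] at e1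
  rw [he] at e2
  rw [slotFam, slotFam, (sgn_flip_flip far j).2, hs, hs', poleInv_neg_one, poleInv_one, inv_inv,
    (slotSpec_val_flip_flip hm.injective h hx hxl hs hs').2, he]
  rw [show (slotSpec l j x).val * τ * σ ^ 2 = σ ^ 2 * (slotSpec l j x).val * τ by ring] at e1
  rw [show (τ * (σ ^ 2 * (slotSpec l j x).val * (τ * σ) ^ 2)⁻¹)⁻¹ =
    σ ^ 2 * (slotSpec l j x).val * τ * σ ^ 2 by field_simp, mul_comm τ (slotSpec l j x).val]
  generalize monFam (typeC l) (lambdaMon l i j) = u₁ at *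
  generalize monFam (typeC l) (lambdaMon l i (flip (2 * l - x) j)) = u₂ at *
  generalize monFam (typeC l) (lambdaMon l i (flip x (flip (2 * l - x) j))) = u₃ at *
  rw [eq_sub_of_add_eq e1, eq_sub_of_add_eq e2]
  abel

/-- A blocked move means that the two parameters have ratio `σ²` or `τ²`. For `σ²` both terms have
the same vertex operator and opposite scalars; for `τ²` both scalars vanish and the vertex operators
need not be compared. Which case occurs depends on the kind of screening. -/
theorem slotCoeff_flip_flip (hl : 2 ≤ l) {κ : Fin l} (h : IsScreenPair ((typeC l).d κ) σ τ)
    {j : Fin i → ℕ} (hj : j ∈ indexSet l i) {x : ℕ} (hx : x ∈ nodeSlots κ) (hs : sgn j x = 1)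
    (hf : flip x j ∉ indexSet l i) (n : ℤ) (v : Fock l) :
    slotCoeff (l := l) τ j x • normalExp (typeC l) (slotFam σ τ κ j x) n v +
      slotCoeff (l := l) τ (flip x (flip (2 * l - x) j)) (2 * l - x) •
        normalExp (typeC l) (slotFam σ τ κ (flip x (flip (2 * l - x) j)) (2 * l - x)) n v = 0 := by
  obtain ⟨h1, h2, h3⟩ := one_le_of_mem_nodeSlots hx
  have hinj := (mem_indexSet.1 hj).2.1.injective
  obtain ⟨hxl, hs', hf', hf''⟩ := flip_flip_mem hj h1 h2 (by omega) hf
  rw [hs] at hs'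
  have far := far_other h2 hxl
  have hb := (slotSpec l j x).val_ne_zero
  have he := (slotSpec l j (2 * l - x)).val_ne_zero
  obtain ⟨hσ, hτ⟩ := h.ne_zero
  obtain ⟨A, -, -, B⟩ := slot_sub_ne hj h hx hs hxl (by omega)
  have hC := boxCoeff_flip_flip hl hj hx hs hf
  have hsf : sgn (flip (2 * l - x) j) x = 1 := by rw [sgn_flip_of_far far.symm, hs]
  have hv := slotSpec_val_flip_flip hinj h hx hxl hs hs'
  have hsg := sgn_flip_flip far j
  rw [hs, hs'] at hsg
  have hZ : zeroVal (typeC l) 0 (lambdaMon l i (flip x (flip (2 * l - x) j))) =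
      zeroVal (typeC l) 0 (lambdaMon l i j) * ((τ * σ) ^ 4)⁻¹ := by
    rw [zeroVal_flip hl h (mem_indexSet.1 hf').2.1 hx hsf,
      zeroVal_flip hl h (mem_indexSet.1 hj).2.1 (other_mem_nodeSlots hx) hs', mul_assoc,
      ← mul_inv, ← pow_add]
  have ho : otherSgn l j x = 1 := by rw [otherSgn, if_neg hxl, hs']
  have ho' : otherSgn l (flip x (flip (2 * l - x) j)) (2 * l - x) = -1 := by
    rw [otherSgn, if_neg (by omega), h3, hsg.1]
  have e1 : slotCoeff (l := l) τ j x = algebraMap KRing KFrac (boxCoeff l j) *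
      (zeroVal (typeC l) 0 (lambdaMon l i j) * ((((τ ^ 2)⁻¹ - 1) * (1 + ((τ ^ 2)⁻¹ - 1) *
        (τ * (slotSpec l j x).val)⁻¹ / ((τ * (slotSpec l j x).val)⁻¹ -
          (τ * (slotSpec l j (2 * l - x)).val)⁻¹))) * (((τ * (slotSpec l j x).val)⁻¹)⁻¹))) := by
    rw [slotCoeff, slotRes, poleRes₂, hs, ho, poleRes_one, poleInv_one, poleInv_one]
  have e2 : slotCoeff (l := l) τ (flip x (flip (2 * l - x) j)) (2 * l - x) =
      algebraMap KRing KFrac (boxCoeff l j) * (zeroVal (typeC l) 0 (lambdaMon l i j) *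
        ((τ * σ) ^ 4)⁻¹ * (((τ ^ 2 - 1) * (1 + (τ ^ 2 - 1) *
        (τ * ((slotSpec l j (2 * l - x)).val * (τ * σ) ^ 2)⁻¹) /
        (τ * ((slotSpec l j (2 * l - x)).val * (τ * σ) ^ 2)⁻¹ -
          τ * ((slotSpec l j x).val * (τ * σ) ^ 2)⁻¹))) *
        ((τ * ((slotSpec l j (2 * l - x)).val * (τ * σ) ^ 2)⁻¹)⁻¹))) := by
    rw [slotCoeff, slotRes, poleRes₂, hsg.2, ho', poleRes_neg_one, poleInv_neg_one, poleInv_neg_one,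
      h3, hv.1, hv.2, hC, hZ]
  rcases B hf with B | B
  · rw [slotFam_flip_flip hl h hj hx hxl hs hs' hf' B, e1, e2,
      residue_cancel_double hτ hσ hb A B, neg_smul, neg_add_cancel]
  · rw [e1, e2, residue_eq_zero hτ hb A B,
      residue_eq_zero' hτ hb (pow_ne_zero 2 (mul_ne_zero hτ hσ)) A B]
    simp only [mul_zero, zero_mul, zero_smul, add_zero]

end ScreeningSum

end

end DeformedW

/-! ### The field commutes with the screening operators -/

namespace DeformedW
noncomputable section
open PowerSeries Finset.HasAntidiagonal

section FundField

variable {l i : ℕ} {σ τ : KFrac}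

theorem smul_eq_map_smul_add (S : Module.End KFrac (TotalFock l)) (c : KFrac)
    {a b w : TotalFock l} (h : a - S b = w) : c • a = S (c • b) + c • w := by
  have h' : a = S b + w := @eq_add_of_sub_eq' (TotalFock l) _ _ _ _ h
  rw [h', map_smul]
  exact smul_add c (S b) w

open Classical in
variable (l) in
/-- The involution which pairs the cancelling terms of the commutator with a screening operator. -/
def slotSwap (p : (Fin i → ℕ) × ℕ) : (Fin i → ℕ) × ℕ :=
  if flip p.2 p.1 ∈ indexSet l i then (flip p.2 p.1, p.2)
  else (flip p.2 (flip (2 * l - p.2) p.1), 2 * l - p.2)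

theorem slotSwap_mem {κ : Fin l} {j : Fin i → ℕ} (hj : j ∈ indexSet l i) {x : ℕ}
    (hx : x ∈ nodeSlots κ) (hs : sgn j x ≠ 0) :
    (slotSwap l (j, x)).1 ∈ indexSet l i ∧ (slotSwap l (j, x)).2 ∈ nodeSlots κ ∧
    sgn (slotSwap l (j, x)).1 (slotSwap l (j, x)).2 = -sgn j x ∧
    slotSwap l (slotSwap l (j, x)) = (j, x) := by
  obtain ⟨h1, h2, h3⟩ := one_le_of_mem_nodeSlots hx
  by_cases hf : flip x j ∈ indexSet l i
  · have e : slotSwap l (j, x) = (flip x j, x) := if_pos hf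
    rw [e]
    refine ⟨hf, hx, sgn_flip_self x j, ?_⟩
    have e' : flip x (flip x j) = j := flip_flip x j
    rw [slotSwap, if_pos (by rw [e']; exact hj), e']
  · have e : slotSwap l (j, x) = (flip x (flip (2 * l - x) j), 2 * l - x) := if_neg hf
    rw [e]
    obtain ⟨hxl, hs', -, hf'⟩ := flip_flip_mem hj h1 h2 hs hf
    have far := far_other h2 hxl
    have e' : flip (2 * l - x) (flip x (flip (2 * l - x) j)) = flip x j := by
      rw [flip_comm far, flip_flip]
    refine ⟨hf', other_mem_nodeSlots hx, ?_, ?_⟩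
    · rw [(sgn_flip_flip far j).2, hs']
    · rw [slotSwap, if_neg (by rw [e']; exact hf), h3]
      simp only
      rw [flip_flip, flip_flip]

/-- Slots with `sgn = 0` contribute nothing. On the others `slotSwap` reverses `sgn`, so it has no
fixed point and each orbit contains one member with `sgn = 1`, for which the cancellation has been
established. -/
theorem sum_slots_eq_zero (hl : 2 ≤ l) {κ : Fin l} (h : IsScreenPair ((typeC l).d κ) σ τ) (n : ℤ)
    (v : Fock l) : ∑ j ∈ indexSet l i, ∑ x ∈ nodeSlots κ,
      slotCoeff (l := l) τ j x • normalExp (typeC l) (slotFam σ τ κ j x) n v = 0 := by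
  rw [← Finset.sum_product']
  rw [← Finset.sum_filter_of_ne (p := fun p : (Fin i → ℕ) × ℕ => sgn p.1 p.2 ≠ 0)]
  · have key : ∀ p : (Fin i → ℕ) × ℕ, p.1 ∈ indexSet l i → p.2 ∈ nodeSlots κ → sgn p.1 p.2 = 1 →
        slotCoeff (l := l) τ p.1 p.2 • normalExp (typeC l) (slotFam σ τ κ p.1 p.2) n v +
          slotCoeff (l := l) τ (slotSwap l p).1 (slotSwap l p).2 •
            normalExp (typeC l) (slotFam σ τ κ (slotSwap l p).1 (slotSwap l p).2) n v = 0 := by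
      rintro ⟨j, x⟩ hj hx hs
      by_cases hf : flip x j ∈ indexSet l i
      · rw [show slotSwap l (j, x) = (flip x j, x) from if_pos hf]
        simp only
        rw [slotFam_flip hl h hj hx hs, slotCoeff_flip hl h hj hx hs hf, neg_smul, neg_add_cancel]
      · rw [show slotSwap l (j, x) = (flip x (flip (2 * l - x) j), 2 * l - x) from if_neg hf]
        exact slotCoeff_flip_flip hl h hj hx hs hf n v
    have hmem : ∀ p : (Fin i → ℕ) × ℕ,
        p ∈ (indexSet l i ×ˢ nodeSlots κ).filter (fun p => sgn p.1 p.2 ≠ 0) ↔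
          (p.1 ∈ indexSet l i ∧ p.2 ∈ nodeSlots κ) ∧ sgn p.1 p.2 ≠ 0 := fun p => by
      rw [Finset.mem_filter, Finset.mem_product]
    refine Finset.sum_involution (fun p _ => slotSwap l p) ?_ ?_ ?_ ?_
    · rintro ⟨j, x⟩ hp
      obtain ⟨⟨hj, hx⟩, hs⟩ := (hmem _).1 hp
      obtain ⟨h1, h2, h3, h4⟩ := slotSwap_mem hj hx hs
      rcases (occ_of_sgn (mem_indexSet.1 hj).2.1.injective (x := x)).2.2 with hs1 | hs1 | hs1
      · exact key _ hj hx hs1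
      · exact absurd hs1 hs
      · have := key _ h1 h2 (by rw [h3]; simp only; rw [hs1]; rfl)
        rw [h4, add_comm] at this
        exact this
    · rintro ⟨j, x⟩ hp - he
      obtain ⟨⟨hj, hx⟩, hs⟩ := (hmem _).1 hp
      obtain ⟨h1, h2, h3, h4⟩ := slotSwap_mem hj hx hs
      rw [he] at h3
      simp only at h3 hs
      omega
    · rintro ⟨j, x⟩ hp
      obtain ⟨⟨hj, hx⟩, hs⟩ := (hmem _).1 hp
      obtain ⟨h1, h2, h3, h4⟩ := slotSwap_mem hj hx hs
      refine (hmem _).2 ⟨⟨h1, h2⟩, ?_⟩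
      rw [h3]
      exact neg_ne_zero.2 hs
    · rintro ⟨j, x⟩ hp
      obtain ⟨⟨hj, hx⟩, hs⟩ := (hmem _).1 hp
      exact (slotSwap_mem hj hx hs).2.2.2
  · rintro ⟨j, x⟩ - hne hs
    refine hne ?_
    simp only at hs ⊢
    rw [slotCoeff, slotRes_eq_zero hs, mul_zero, mul_zero, zero_smul]

theorem commutesOnVacuum_fundField (hl : 2 ≤ l) {κ : Fin l} {μ : Weights l}
    {S : Module.End KFrac (TotalFock l)} (hS : IsScreening κ σ τ μ S) :
    CommutesOnVacuum (fundField l i (boxCoeff l)) S := by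
  intro n v
  have key : ∀ j ∈ indexSet l i,
      (boxCoeff l j • (lambdaMon l i j).field (typeC l)) n (S (Finsupp.single 0 v)) =
        S ((boxCoeff l j • (lambdaMon l i j).field (typeC l)) n (Finsupp.single 0 v)) +
      Finsupp.lsingle (R := KFrac) μ (∑ x ∈ nodeSlots κ,
        slotCoeff (l := l) τ j x • normalExp (typeC l) (slotFam σ τ κ j x) (n - 1) v) := by
    intro j hj
    rw [Pi.smul_apply, LinearMap.smul_apply, LinearMap.smul_apply, ← algebraMap_smul KFrac,
      ← algebraMap_smul KFrac (boxCoeff l j) ((lambdaMon l i j).field (typeC l) n _)]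
    refine (smul_eq_map_smul_add S (algebraMap KRing KFrac (boxCoeff l j))
      (lambdaMon_commutator hl hS hj n v)).trans (congrArg _ ?_)
    rw [← Finsupp.lsingle_apply (R := KFrac), ← map_smul]
    congr 1
    rw [Finset.smul_sum, Finset.smul_sum]
    refine Finset.sum_congr rfl fun x _ => ?_
    rw [slotCoeff, mul_smul, mul_smul]
  rw [fundField, Finset.sum_apply, LinearMap.sum_apply, LinearMap.sum_apply, map_sum,
    Finset.sum_congr rfl key, Finset.sum_add_distrib,
    ← map_sum (Finsupp.lsingle (R := KFrac) μ), sum_slots_eq_zero hl hS.pair,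
    map_zero, add_zero]

theorem fundField_mem_deformedW (hl : 2 ≤ l) :
    fundField l i (boxCoeff l) ∈ deformedW (typeC l) := by
  refine ⟨Submodule.sum_mem _ fun j _ =>
    Submodule.smul_mem _ _ (Submodule.subset_span (Set.mem_range_self _)), fun κ => ⟨?_, ?_⟩⟩
  · obtain ⟨μ, hS⟩ := isScreening_screenPlus hl κ
    exact commutesOnVacuum_fundField hl hS
  · obtain ⟨μ, hS⟩ := isScreening_screenMinus hl κ
    exact commutesOnVacuum_fundField hl hS

end FundField

end

end DeformedW

theorem mainTheorem3 (l : ℕ) (hl : 2 ≤ l) (i : ℕ) (hi : 1 ≤ i) (hil : i ≤ l) :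
    ∃ c : (Fin i → ℕ) → DeformedW.KRing,
      -- the field with these coefficients lies in the deformed `W`-algebra
      DeformedW.fundField l i c ∈ DeformedW.deformedW (DeformedW.typeC l) ∧
      -- its only dominant monomial is `Y_i(z)`, with coefficient `1`, and no coefficient vanishes
      DeformedW.initialIndex i ∈ DeformedW.indexSet l i ∧
      DeformedW.lambdaMon l i (DeformedW.initialIndex i) = DeformedW.yMon l i (1, 0, 0) 0 0 ∧
      c (DeformedW.initialIndex i) = 1 ∧
      (∀ j ∈ DeformedW.indexSet l i, c j ≠ 0) ∧
      (∀ j ∈ DeformedW.indexSet l i, DeformedW.IsDominant (DeformedW.lambdaMon l i j) →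
        j = DeformedW.initialIndex i) ∧
      -- the monomials are pairwise distinct
      Set.InjOn (DeformedW.lambdaMon l i) (DeformedW.indexSet l i) ∧
      -- the algorithm started from `Y_i(z)` works, produces at step `n` exactly the monomials of
      -- height `n`, and the coefficients are those it attaches to them
      DeformedW.AlgorithmWorks (DeformedW.typeC l) (DeformedW.yMon l i (1, 0, 0) 0 0) ∧
      (∀ n : ℕ, DeformedW.algStep (DeformedW.typeC l) (DeformedW.yMon l i (1, 0, 0) 0 0) n =
        {M | ∃ j ∈ DeformedW.indexSet l i, DeformedW.height j = (n : ℤ) ∧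
          DeformedW.lambdaMon l i j = M}) ∧
      ∃ lam : DeformedW.Mon l → DeformedW.KRing,
        DeformedW.IsAlgorithmCoeff (DeformedW.typeC l) (DeformedW.yMon l i (1, 0, 0) 0 0) lam ∧
        ∀ j ∈ DeformedW.indexSet l i, c j = lam (DeformedW.lambdaMon l i j) := by
  exact ⟨DeformedW.boxCoeff l, DeformedW.fundField_mem_deformedW hl,
    DeformedW.initialIndex_mem hil, DeformedW.lambdaMon_initialIndex hl hi hil,
    DeformedW.boxCoeff_initialIndex hil, fun j hj => DeformedW.boxCoeff_ne_zero hj,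
    fun j hj h => DeformedW.eq_initialIndex_of_isDominant hl hj h, DeformedW.injOn_lambdaMon hl,
    DeformedW.algorithmWorks hl hi hil, DeformedW.algStep_eq hl hi hil, DeformedW.monCoeff l i,
    DeformedW.isAlgorithmCoeff_monCoeff hl hi hil,
    fun j hj => (DeformedW.monCoeff_lambdaMon hl hj).symm⟩
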